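/- **Fundamental lemma.** Let $E/F$ be an unramified quadratic extension of non-archimedean local fields (any characteristic, including $2$), with nontrivial automorphism $z\mapsto\bar z$, norm $\mathrm{Nm}$ and quadratic character $\eta$ of $F^\times$. Let $\Omega$ be an unramified character $E^\times\to\mathbb C^\times$ and $\omega=\Omega|_{F^\times}$. Take the Haar measures on $F^\times$ and $E^\times$ with $\mathrm{Vol}(\mathcal O_F^\times)=\mathrm{Vol}(\mathcal O_E^\times)=1$, and the quotient measure on $E^\times/F^\times$. *Groups.* Let $G=GL_2(E)$, $K=GL_2(\mathcal O_E)$, $w=\begin{bmatrix}0&1\\1&0\end{bmatrix}$, $\mathcal S=\{s\in G:\bar s^t=s\}$, $H_0=\{h\in G: hw\bar h^t=w\}$ and $K_{H_0}=K\cap H_0$. For $\epsilon\in F^\times$ let $B_\epsilon$ be the $F$-algebra of matrices $\begin{bmatrix}a&b\epsilon\\ \bar b&\bar a\end{bmatrix}$, $a,b\in E$; let $G_\epsilon=B_\epsilon^\times$, $T_\epsilon=\{\mathrm{diag}(a,\bar a):a\in E^\times\}\cong E^\times$, with center $Z_\epsilon\cong F^\times$, and $K_\epsilon=G_\epsilon\cap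 GL_2(\mathcal O_E)$. Fix an $F$-algebra isomorphism $B_1\cong M_2(F)$ whose induced isomorphism $G_1\cong GL_2(F)$ maps $K_1$ onto $GL_2(\mathcal O_F)$. Fix arbitrary Haar measures on $G$, $G_1\cong GL_2(F)$ and $H_0$. *Orbital integrals and matching.* For $f\in C_c^\infty(G)$ let $\Phi_f$ be the function on $\mathcal S$ supported on $\{gw\bar g^t:g\in G\}$ with $\Phi_f(gw\bar g^t)=\int_{H_0}f(gh)\,dh$. For $x\in F^\times-\{1\}$ and $\Phi\in C_c^\infty(\mathcal S)$ put $$\mathcal O(x,\Phi)=\int_{E^\times}\int_{F^\times}\Phi\left(z\begin{bmatrix}a&0\\0&1\end{bmatrix}\begin{bmatrix}x&1\\1&1\end{bmatrix}\begin{bmatrix}\bar a&0\\0&1\end{bmatrix}\right)\eta\omega^{-1}(z)\,\Omega^{-1}(a)\,dz\,da,$$ and for $x=\epsilon\mathrm{Nm}(b)\ne1$, $b\in E^\times$, and $f\in C_c^\infty(G_\epsilon)$ put $$\mathcal O(x,f)=\int_{T_\epsilon/Z_\epsilon}\int_{T_\epsilon}f\left(h_1^{-1}\begin{bmatrix}1&b\epsilon\\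 \bar b&1\end{bmatrix}h_2\right)\Omega(h_1)\Omega^{-1}(h_2)\,dh_2\,dh_1,$$ which does not depend on $b$. Say that $f\in C_c^\infty(G_1)$ *purely matches* $\Phi$ if $\mathcal O(x,\Phi)=\mathcal O(x,f)$ for all $x\in\mathrm{Nm}(E^\times)-\{1\}$, and $\mathcal O(x,\Phi)=0$ for all $x\in F^\times-\mathrm{Nm}(E^\times)$. *Base change.* For a bi-$K$-invariant $f\in C_c^\infty(G)$, its base change $\mathrm{bc}(f)$ is the bi-$K_1$-invariant function in $C_c^\infty(G_1)$ such that $\mathrm{tr}\,\Pi(f)=\mathrm{tr}\,\pi(\mathrm{bc}(f))$ for all quasi-characters $\chi_1,\chi_2$ of $F^\times$, where $\pi$ is the normalized principal series of $GL_2(F)\cong G_1$ attached to $(\chi_1,\chi_2)$ and $\Pi$ is its base change, the normalized principal series of $G$ attached to $(\chi_1\circ\mathrm{Nm},\chi_2\circ\mathrm{Nm})$. *Claim.* For every bi-$K$-invariant $f\in C_c^\infty(G)$, the base change $$\mathrm{bc}\left(\frac{\mathrm{Vol}(K_{H_0})\,\mathrm{Vol}(K_1)}{\mathrm{Vol}(K)}\,f\right)$$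 exists, is unique, and purely matches $\Phi_f$. In particular, $\dfrac{1_{K_1}}{\mathrm{Vol}(K_1)}$ purely matches $\Phi_{f_0}$, where $f_0=\dfrac{1_K}{\mathrm{Vol}(K_{H_0})\,\mathrm{Vol}(K_1)}$. -/

import Mathlib

open MeasureTheory ValuativeRel

/-!
# Unramified base change and orbital integrals for `GL₂` over a quadratic extension

Throughout, `F` and `E` are non-archimedean local fields, `E` is a quadratic extension of `F` and
`σ` is the nontrivial element of `Gal(E/F)`, written `z ↦ z̄` in the comments.
-/

namespace FundLemma

noncomputable section

/-! ### Local fields, `GL₂` and its spherical Hecke algebra -/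

section OneField

variable (L : Type*) [Field L] [ValuativeRel L] [TopologicalSpace L]
  [IsNonarchimedeanLocalField L]

/-- The normalized absolute value of a local field: `|ϖ| = q⁻¹`, where `ϖ` is a uniformizer and
`q` is the number of elements of the residue field. -/
def normAbs (x : L) : ℝ :=
  (WithZeroMulInt.toNNReal (e := (Nat.card 𝓀[L] : NNReal))
    (Nat.cast_ne_zero.mpr Nat.card_pos.ne')
    (IsNonarchimedeanLocalField.valueGroupWithZeroIsoInt L (valuation L x)) : ℝ)

/-- The standard maximal compact subgroup `GL₂(𝒪)` of `GL₂(L)`. -/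
def maxCompact : Subgroup (GL (Fin 2) L) :=
  (Matrix.GeneralLinearGroup.map (algebraMap 𝒪[L] L)).range

variable {L}

lemma mem_maxCompact_of_entries {g : GL (Fin 2) L}
    (h : ∀ i j, g.1 i j ∈ 𝒪[L]) (h' : ∀ i j, g⁻¹.1 i j ∈ 𝒪[L]) : g ∈ maxCompact L := by
  refine ⟨⟨Matrix.of fun i j => ⟨g.1 i j, h i j⟩, Matrix.of fun i j => ⟨g⁻¹.1 i j, h' i j⟩,
    ?_, ?_⟩, ?_⟩
  · ext i j
    have := congrFun (congrFun (Units.mul_inv g) i) j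
    rw [Matrix.mul_apply] at this ⊢
    simp only [Fin.sum_univ_two] at this ⊢
    refine this.trans ?_
    by_cases hij : i = j <;> simp [Matrix.one_apply, hij]
  · ext i j
    have := congrFun (congrFun (Units.inv_mul g) i) j
    rw [Matrix.mul_apply] at this ⊢
    simp only [Fin.sum_univ_two] at this ⊢
    refine this.trans ?_
    by_cases hij : i = j <;> simp [Matrix.one_apply, hij]
  · ext i j
    rfl

lemma isOpen_maxCompact : IsOpen (maxCompact L : Set (GL (Fin 2) L)) := by
  have hO : IsOpen (𝒪[L] : Set L) :=
    (valuation L).isOpen_integer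
  refine Subgroup.isOpen_of_mem_nhds (g := 1) _ ?_
  have hS : IsOpen {g : GL (Fin 2) L | (∀ i j, g.1 i j ∈ 𝒪[L]) ∧ ∀ i j, g⁻¹.1 i j ∈ 𝒪[L]} := by
    have c1 : ∀ i j, Continuous fun g : GL (Fin 2) L => g.1 i j := fun i j =>
      (Units.continuous_val.matrix_elem i j)
    have c2 : ∀ i j, Continuous fun g : GL (Fin 2) L => g⁻¹.1 i j := fun i j =>
      ((Units.continuous_val.comp continuous_inv).matrix_elem i j)
    simp only [Set.ofPred_and, Set.ofPred_forall]
    exact (isOpen_iInter_of_finite fun i => isOpen_iInter_of_finite fun j =>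
      hO.preimage (c1 i j)).inter
      (isOpen_iInter_of_finite fun i => isOpen_iInter_of_finite fun j => hO.preimage (c2 i j))
  refine Filter.mem_of_superset (hS.mem_nhds ⟨?_, ?_⟩)
    fun g hg => mem_maxCompact_of_entries hg.1 hg.2
  · intro i j
    by_cases hij : i = j <;> simp [hij]
  · intro i j
    by_cases hij : i = j <;> simp [hij]

variable (L)

/-- The spherical Hecke algebra of `GL₂(L)`, as a space of functions: the compactly supported
locally constant functions that are invariant under `GL₂(𝒪)` on both sides. -/
def sphericalHecke : Submodule ℂ (GL (Fin 2) L → ℂ) where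
  carrier := {f | (IsLocallyConstant f ∧ HasCompactSupport f) ∧
    ∀ k₁ ∈ maxCompact L, ∀ k₂ ∈ maxCompact L, ∀ g, f (k₁ * g * k₂) = f g}
  add_mem' := fun {f f'} hf hf' => ⟨⟨hf.1.1.add hf'.1.1, hf.1.2.add hf'.1.2⟩,
    fun k₁ h₁ k₂ h₂ g => by simp [hf.2 k₁ h₁ k₂ h₂ g, hf'.2 k₁ h₁ k₂ h₂ g]⟩
  zero_mem' := ⟨⟨IsLocallyConstant.const 0, HasCompactSupport.zero⟩, fun _ _ _ _ _ => rfl⟩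
  smul_mem' := fun c f hf => ⟨⟨hf.1.1.comp (c * ·), hf.1.2.smul_left (f := fun _ => c)⟩,
    fun k₁ h₁ k₂ h₂ g => by simp [hf.2 k₁ h₁ k₂ h₂ g]⟩

variable {L}

/-- The upper triangular matrix with diagonal entries `a`, `d` and upper right entry `b`. -/
def borelMat (a d : Lˣ) (b : L) : GL (Fin 2) L :=
  Matrix.GeneralLinearGroup.mkOfDetNeZero !![(a : L), b; 0, (d : L)] (by
    simp [Matrix.det_fin_two_of])

/-- The (normalized, smooth) principal series representation of `GL₂(L)` attached to the
quasi-characters `χ₁`, `χ₂` of `Lˣ`: the space of functions `φ` with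
`φ (b g) = χ₁(a) χ₂(d) |a / d|^{1/2} φ(g)` for all upper triangular `b` with diagonal `(a, d)`,
which are invariant on the right under some open subgroup. The group acts by right translation. -/
def principalSeries (χ₁ χ₂ : Lˣ →* ℂˣ) : Submodule ℂ (GL (Fin 2) L → ℂ) where
  carrier := {φ | (∀ (a d : Lˣ) (b : L) (g : GL (Fin 2) L),
      φ (borelMat a d b * g) =
        χ₁ a * χ₂ d * (Real.sqrt (normAbs L (a / d)) : ℂ) * φ g) ∧
    ∃ U : OpenSubgroup (GL (Fin 2) L), ∀ u ∈ U, ∀ g, φ (g * u) = φ g}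
  add_mem' := by
    rintro φ φ' ⟨h, U, hU⟩ ⟨h', U', hU'⟩
    refine ⟨fun a d b g => ?_, U ⊓ U', fun u hu g => ?_⟩
    · simp only [Pi.add_apply, h, h']; ring
    · simp only [Pi.add_apply, hU u hu.1, hU' u hu.2]
  zero_mem' := ⟨fun _ _ _ _ => by simp, ⊤, fun _ _ _ => rfl⟩
  smul_mem' := by
    rintro c φ ⟨h, U, hU⟩
    refine ⟨fun a d b g => ?_, U, fun u hu g => ?_⟩
    · simp only [Pi.smul_apply, smul_eq_mul, h]; ring
    · simp only [Pi.smul_apply, hU u hu]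

lemma continuous_of_mem_principalSeries {χ₁ χ₂ : Lˣ →* ℂˣ} {φ : GL (Fin 2) L → ℂ}
    (hφ : φ ∈ principalSeries χ₁ χ₂) : Continuous φ := by
  obtain ⟨-, U, hU⟩ := hφ
  refine IsLocallyConstant.continuous ((IsLocallyConstant.iff_exists_open φ).mpr fun x => ?_)
  refine ⟨(fun y => x⁻¹ * y) ⁻¹' (U : Set (GL (Fin 2) L)),
    U.isOpen.preimage (continuous_const_mul _), by simp, fun y hy => ?_⟩
  simpa using hU (x⁻¹ * y) hy x

section Hecke

variable [MeasurableSpace (GL (Fin 2) L)] [BorelSpace (GL (Fin 2) L)]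
  (μ : Measure (GL (Fin 2) L)) [μ.IsHaarMeasure]

lemma integrable_hecke {χ₁ χ₂ : Lˣ →* ℂˣ} {f φ : GL (Fin 2) L → ℂ} (hf : f ∈ sphericalHecke L)
    (hφ : φ ∈ principalSeries χ₁ χ₂) (x : GL (Fin 2) L) :
    Integrable (fun g => f g * φ (x * g)) μ := by
  refine Continuous.integrable_of_hasCompactSupport ?_ hf.1.2.mul_right
  exact hf.1.1.continuous.mul
    ((continuous_of_mem_principalSeries hφ).comp (continuous_const_mul _))

/-- The action `Π(f) φ = ∫ f(g) Π(g) φ dg` of an element `f` of the spherical Hecke algebra on the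
principal series `Π` attached to `χ₁`, `χ₂`. -/
def heckeOp (χ₁ χ₂ : Lˣ →* ℂˣ) (f : sphericalHecke L) :
    principalSeries χ₁ χ₂ →ₗ[ℂ] principalSeries χ₁ χ₂ where
  toFun φ := ⟨fun x => ∫ g, f.1 g * φ.1 (x * g) ∂μ, by
    refine ⟨fun a d b x => ?_, ⟨maxCompact L, isOpen_maxCompact⟩, fun u hu x => ?_⟩
    · rw [← integral_const_mul]
      refine integral_congr_ae (Filter.Eventually.of_forall fun g => ?_)
      simp only [mul_assoc (borelMat a d b), φ.2.1 a d b (x * g)]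
      ring
    · change ∫ g, f.1 g * φ.1 (x * u * g) ∂μ = ∫ g, f.1 g * φ.1 (x * g) ∂μ
      rw [← integral_mul_left_eq_self (fun g => f.1 g * φ.1 (x * g)) u]
      refine integral_congr_ae (Filter.Eventually.of_forall fun g => ?_)
      have := f.2.2 u hu 1 (one_mem _) g
      simp only [mul_one] at this
      simp only [this, mul_assoc]⟩
  map_add' φ φ' := by
    ext x
    simp only [Submodule.coe_add, Pi.add_apply, mul_add]
    exact integral_add (integrable_hecke μ f.2 φ.2 x) (integrable_hecke μ f.2 φ'.2 x)
  map_smul' c φ := by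
    ext x
    simp only [Submodule.coe_smul, Pi.smul_apply, smul_eq_mul, RingHom.id_apply,
      ← integral_const_mul]
    refine integral_congr_ae (Filter.Eventually.of_forall fun g => ?_)
    ring_nf

end Hecke

end OneField

/-- The trace of a linear endomorphism of finite rank: the trace of its restriction to its
(finite-dimensional) range. -/
def finiteRankTrace {V : Type*} [AddCommGroup V] [Module ℂ V] (T : V →ₗ[ℂ] V) : ℂ :=
  LinearMap.trace ℂ (LinearMap.range T) (T.rangeRestrict ∘ₗ (LinearMap.range T).subtype)

/-! ### Quadratic extensions -/

section Quadratic

variable {F E : Type*} [Field F] [Field E] [Algebra F E]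

variable (F E) in
/-- The inclusion `Fˣ → Eˣ`. -/
def unitsIncl : Fˣ →* Eˣ := Units.map (algebraMap F E : F →* E)

variable (F E) in
/-- The norm homomorphism `Nm : Eˣ → Fˣ`. -/
def unitsNorm : Eˣ →* Fˣ := Units.map (Algebra.norm F : E →* F)

/-- The extension `E/F` of local fields is unramified: `E` and `F` have the same value group. (The
residue fields are finite, so the residue extension is separable.) -/
def IsUnramifiedExt (F E : Type*) [Field F] [Field E] [Algebra F E] [ValuativeRel E] : Prop :=
  ∀ y : E, ∃ x : F, valuation E (algebraMap F E x) = valuation E y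

/-- `h` is the base change `bc(f)` of `f`: the function `f` in the spherical Hecke algebra of
`GL₂(E)` acts on `Π` with the same trace as the function `h` in the spherical Hecke algebra of
`GL₂(F)` acts on `π`, whenever `π` is the principal series attached to quasi-characters
`χ₁`, `χ₂` of `Fˣ` and `Π` is its base change, the principal series attached to
`χ₁ ∘ Nm`, `χ₂ ∘ Nm`. -/
def IsHeckeBaseChange [ValuativeRel F] [TopologicalSpace F] [IsNonarchimedeanLocalField F]
    [ValuativeRel E] [TopologicalSpace E] [IsNonarchimedeanLocalField E]
    [MeasurableSpace (GL (Fin 2) F)] [BorelSpace (GL (Fin 2) F)]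
    [MeasurableSpace (GL (Fin 2) E)] [BorelSpace (GL (Fin 2) E)]
    (μE : Measure (GL (Fin 2) E)) [μE.IsHaarMeasure]
    (μF : Measure (GL (Fin 2) F)) [μF.IsHaarMeasure]
    (f : sphericalHecke E) (h : sphericalHecke F) : Prop :=
  ∀ χ₁ χ₂ : Fˣ →* ℂˣ, Continuous χ₁ → Continuous χ₂ →
    finiteRankTrace (heckeOp μE (χ₁.comp (unitsNorm F E)) (χ₂.comp (unitsNorm F E)) f) =
      finiteRankTrace (heckeOp μF χ₁ χ₂ h)

variable (σ : E ≃ₐ[F] E) (hσ : Function.Involutive σ)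

/-- `x ∈ Nm(Eˣ)`. -/
def IsNorm (x : F) : Prop := ∃ b : Eˣ, algebraMap F E x = b * σ b

open Classical in
/-- The quadratic character `η` of `Fˣ` attached to `E/F`. -/
def etaChar (z : Fˣ) : ℂ := if IsNorm σ (z : F) then 1 else -1

/-! ### The quaternion side -/

/-- The quaternion algebra `B = E ⊕ E j`, `j² = ε`, `j z = z̄ j`, as the `F`-algebra of matrices
`a + b j = [[a, b ε], [b̄, ā]]`. -/
def quatAlg (ε : Fˣ) : Subalgebra F (Matrix (Fin 2) (Fin 2) E) where
  carrier := {M | ∃ a b : E, M = !![a, b * algebraMap F E ε; σ b, σ a]}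
  mul_mem' := by
    rintro _ _ ⟨a, b, rfl⟩ ⟨c, d, rfl⟩
    refine ⟨a * c + b * algebraMap F E ε * σ d, a * d + b * σ c, ?_⟩
    ext i j
    fin_cases i <;> fin_cases j <;>
      simp [Matrix.mul_apply, Fin.sum_univ_two, hσ _] <;> ring
  add_mem' := by
    rintro _ _ ⟨a, b, rfl⟩ ⟨c, d, rfl⟩
    refine ⟨a + c, b + d, ?_⟩
    ext i j
    fin_cases i <;> fin_cases j <;> simp [add_mul]
  algebraMap_mem' r := by
    refine ⟨algebraMap F E r, 0, ?_⟩
    ext i j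
    fin_cases i <;> fin_cases j <;> simp [Matrix.algebraMap_matrix_apply]

/-- The embedding `a ↦ diag(a, ā)` of `E` in the quaternion algebra. -/
def quatOfField (ε : Fˣ) : E →+* quatAlg σ hσ ε where
  toFun a := ⟨!![a, 0; 0, σ a], a, 0, by simp⟩
  map_one' := by ext i j; fin_cases i <;> fin_cases j <;> simp
  map_mul' a b := by ext i j; fin_cases i <;> fin_cases j <;> simp
  map_zero' := by ext i j; fin_cases i <;> fin_cases j <;> simp
  map_add' a b := by ext i j; fin_cases i <;> fin_cases j <;> simp

/-- The isomorphism `a ↦ diag(a, ā)` from `Eˣ` onto the torus `T_ε` of `G_ε = Bˣ`. -/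
def torus (ε : Fˣ) : Eˣ →* (quatAlg σ hσ ε)ˣ := Units.map (quatOfField σ hσ ε : E →* _)

/-- The element `1 + b j = [[1, b ε], [b̄, 1]]` of `G_ε`, where `ε Nm(b) ≠ 1`. -/
def deltaElt (ε : Fˣ) (b : E) (hb : algebraMap F E ε * (b * σ b) ≠ 1) : (quatAlg σ hσ ε)ˣ where
  val := ⟨!![1, b * algebraMap F E ε; σ b, 1], 1, b, by simp⟩
  inv := ⟨!![(1 - algebraMap F E ε * (b * σ b))⁻¹,
      -(1 - algebraMap F E ε * (b * σ b))⁻¹ * b * algebraMap F E ε;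
      -(1 - algebraMap F E ε * (b * σ b))⁻¹ * σ b, (1 - algebraMap F E ε * (b * σ b))⁻¹],
    (1 - algebraMap F E ε * (b * σ b))⁻¹, -(1 - algebraMap F E ε * (b * σ b))⁻¹ * b, by
      simp [hσ b, mul_comm (σ b) b]⟩
  val_inv := by
    have h : 1 - algebraMap F E ε * (b * σ b) ≠ 0 := sub_ne_zero.mpr (Ne.symm hb)
    have h1 := inv_mul_cancel₀ h
    ext i j
    fin_cases i <;> fin_cases j <;> simp [Matrix.mul_apply, Fin.sum_univ_two] <;>
      first | linear_combination h1 | ring1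
  inv_val := by
    have h : 1 - algebraMap F E ε * (b * σ b) ≠ 0 := sub_ne_zero.mpr (Ne.symm hb)
    have h1 := inv_mul_cancel₀ h
    ext i j
    fin_cases i <;> fin_cases j <;> simp [Matrix.mul_apply, Fin.sum_univ_two] <;>
      first | linear_combination h1 | ring1

/-- The maximal compact subgroup `K_ε = G_ε ∩ GL₂(𝒪_E)` of `G_ε`. -/
def quatMaxCompact [ValuativeRel E] [TopologicalSpace E] [IsNonarchimedeanLocalField E]
    (ε : Fˣ) : Subgroup (quatAlg σ hσ ε)ˣ :=
  (maxCompact E).comap (Units.map ((quatAlg σ hσ ε).val : _ →* Matrix (Fin 2) (Fin 2) E))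

/-- The orbital integral
`O(δ, f) = ∫_{T_ε/Z_ε} ∫_{T_ε} f(h₁⁻¹ δ h₂) Ω(h₁) Ω⁻¹(h₂) dh₂ dh₁` on `G_ε`, where `T_ε = Eˣ`,
`Z_ε = Fˣ`, and `μE`, `μQ` are the measures on `Eˣ` and on `Eˣ/Fˣ`. -/
def orbQuat [MeasurableSpace Eˣ] (μE : Measure Eˣ) (μQ : Measure (Eˣ ⧸ (unitsIncl F E).range))
    (Ω : Eˣ →* ℂˣ) (ε : Fˣ) (δ : (quatAlg σ hσ ε)ˣ) (f : (quatAlg σ hσ ε)ˣ → ℂ) : ℂ :=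
  ∫ q : Eˣ ⧸ (unitsIncl F E).range, ∫ h₂ : Eˣ,
    f ((torus σ hσ ε q.out)⁻¹ * δ * torus σ hσ ε h₂) *
      (Ω q.out : ℂ) * ((Ω h₂)⁻¹ : ℂˣ) ∂μE ∂μQ

/-- `μQ` is the quotient of the measure `μE` on `Eˣ` by the measure `μF` on `Fˣ`. -/
def IsQuotientMeasure [MeasurableSpace Eˣ] [MeasurableSpace Fˣ] (μE : Measure Eˣ)
    (μF : Measure Fˣ) (μQ : Measure (Eˣ ⧸ (unitsIncl F E).range)) : Prop :=
  ∀ A : Set Eˣ, MeasurableSet A →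
    μE A = ∫⁻ q : Eˣ ⧸ (unitsIncl F E).range, μF {z | q.out * unitsIncl F E z ∈ A} ∂μQ

/-! ### The Hermitian side -/

/-- The conjugate transpose of a matrix. -/
def conjT (M : Matrix (Fin 2) (Fin 2) E) : Matrix (Fin 2) (Fin 2) E := (M.map σ).transpose

lemma conjT_mul (M N : Matrix (Fin 2) (Fin 2) E) : conjT σ (M * N) = conjT σ N * conjT σ M := by
  ext i j
  simp [conjT, Matrix.mul_apply, mul_comm]

lemma conjT_one : conjT σ (1 : Matrix (Fin 2) (Fin 2) E) = 1 := by
  ext i j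
  fin_cases i <;> fin_cases j <;> simp [conjT]

variable (E) in
/-- The matrix `w = [[0, 1], [1, 0]]`. -/
def wMat : Matrix (Fin 2) (Fin 2) E := !![0, 1; 1, 0]

/-- The space `𝒮` of invertible Hermitian matrices, with the topology induced from `GL₂(E)`. -/
abbrev Herm : Type _ := {s : GL (Fin 2) E // conjT σ s.1 = s.1}

/-- The unitary group `H₀` of `w`: the stabilizer of `w` under `g · s = g s ḡᵗ`. -/
def unitaryGroup : Subgroup (GL (Fin 2) E) where
  carrier := {h | h.1 * wMat E * conjT σ h.1 = wMat E}
  one_mem' := by simp [conjT_one]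
  mul_mem' := by
    intro g h hg hh
    simp only [Set.mem_ofPred_eq] at hg hh ⊢
    rw [Units.val_mul, conjT_mul]
    calc g.1 * h.1 * wMat E * (conjT σ h.1 * conjT σ g.1)
        = g.1 * (h.1 * wMat E * conjT σ h.1) * conjT σ g.1 := by simp only [mul_assoc]
      _ = wMat E := by rw [hh, hg]
  inv_mem' := by
    intro g hg
    simp only [Set.mem_ofPred_eq] at hg ⊢
    have h1 : g⁻¹.1 * g.1 = 1 := Units.inv_mul g
    have h2 : conjT σ g.1 * conjT σ g⁻¹.1 = 1 := by rw [← conjT_mul, h1, conjT_one]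
    calc g⁻¹.1 * wMat E * conjT σ g⁻¹.1
        = g⁻¹.1 * (g.1 * wMat E * conjT σ g.1) * conjT σ g⁻¹.1 := by rw [hg]
      _ = (g⁻¹.1 * g.1) * wMat E * (conjT σ g.1 * conjT σ g⁻¹.1) := by simp only [mul_assoc]
      _ = wMat E := by rw [h1, h2, one_mul, mul_one]

open Classical in
/-- The function `Φ_f` on `𝒮`: it is supported on the orbit `G w` and takes the value
`∫_{H₀} f(g h) dh` at `g w ḡᵗ`. -/
def PhiOf [MeasurableSpace (GL (Fin 2) E)] (μH : Measure (unitaryGroup σ))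
    (f : GL (Fin 2) E → ℂ) (s : Herm σ) : ℂ :=
  if hs : ∃ g : GL (Fin 2) E, s.1.1 = g.1 * wMat E * conjT σ g.1 then
    ∫ h : unitaryGroup σ, f (hs.choose * h.1) ∂μH
  else 0

/-- The matrix `diag(a, d)`. -/
def diagMat (a d : Eˣ) : GL (Fin 2) E :=
  Matrix.GeneralLinearGroup.mkOfDetNeZero !![(a : E), 0; 0, (d : E)] (by
    simp [Matrix.det_fin_two_of])

lemma conjT_diagMat (a d : Eˣ) :
    conjT σ (diagMat a d).1 =
      (diagMat (Units.map (σ : E →* E) a) (Units.map (σ : E →* E) d)).1 := by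
  ext i j
  fin_cases i <;> fin_cases j <;>
    simp [conjT, diagMat, Matrix.GeneralLinearGroup.mkOfDetNeZero]

lemma scalar_comm (z : Eˣ) (M : Matrix (Fin 2) (Fin 2) E) :
    (diagMat z z).1 * M = M * (diagMat z z).1 := by
  ext i j
  fin_cases i <;> fin_cases j <;>
    simp [Matrix.mul_apply, Fin.sum_univ_two, diagMat, Matrix.GeneralLinearGroup.mkOfDetNeZero,
      mul_comm]

/-- The action `(a, z) · s = diag(a, 1) s diag(ā, 1) z` of `Eˣ × Fˣ` on `𝒮`. -/
def hermAct (a : Eˣ) (z : Fˣ) (s : Herm σ) : Herm σ :=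
  ⟨diagMat a 1 * s.1 * diagMat (Units.map (σ : E →* E) a) 1 *
      diagMat (unitsIncl F E z) (unitsIncl F E z), by
    have ha : Units.map (σ : E →* E) (Units.map (σ : E →* E) a) = a := by
      ext; simp [hσ _]
    have hz : Units.map (σ : E →* E) (unitsIncl F E z) = unitsIncl F E z := by
      ext; simp [unitsIncl]
    simp only [Units.val_mul, conjT_mul, s.2, conjT_diagMat, map_one, ha, hz]
    rw [scalar_comm]
    simp only [mul_assoc]⟩

/-- The element `γ(x) = [[x, 1], [1, 1]]` of `𝒮`, where `x ≠ 1`. -/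
def gammaElt (x : F) (hx : x ≠ 1) : Herm σ :=
  ⟨Matrix.GeneralLinearGroup.mkOfDetNeZero !![algebraMap F E x, 1; 1, 1] (by
    simpa [Matrix.det_fin_two_of, sub_eq_zero] using hx), by
    ext i j
    fin_cases i <;> fin_cases j <;> simp [conjT, Matrix.GeneralLinearGroup.mkOfDetNeZero]⟩

/-- The orbital integral
`O(γ, Φ) = ∫_{Eˣ} ∫_{Fˣ} Φ(z diag(a, 1) γ diag(ā, 1)) (η ω⁻¹)(z) Ω⁻¹(a) dz da` on `𝒮`, where
`ω` is the restriction of `Ω` to `Fˣ`. -/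
def orbHerm [MeasurableSpace Eˣ] [MeasurableSpace Fˣ] (μE : Measure Eˣ) (μF : Measure Fˣ)
    (Ω : Eˣ →* ℂˣ) (γ : Herm σ) (Φ : Herm σ → ℂ) : ℂ :=
  ∫ a : Eˣ, ∫ z : Fˣ, Φ (hermAct σ hσ a z γ) *
    (etaChar σ z * ((Ω (unitsIncl F E z))⁻¹ : ℂˣ)) * ((Ω a)⁻¹ : ℂˣ) ∂μF ∂μE

/-! ### Matching -/

/-- `Φ` and `f_ε` match: `O(x, Φ) = O(x, f_ε)` for every `x ∈ ε Nm(Eˣ) - {1}`, where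
`O(x, Φ) = O(γ(x), Φ)`, and `O(x, f_ε) = O(1 + b j, f_ε)` if `x = ε Nm(b)`. -/
def Matches [MeasurableSpace Eˣ] [MeasurableSpace Fˣ] (μE : Measure Eˣ) (μF : Measure Fˣ)
    (μQ : Measure (Eˣ ⧸ (unitsIncl F E).range)) (Ω : Eˣ →* ℂˣ)
    (Φ : Herm σ → ℂ) (ε : Fˣ) (f : (quatAlg σ hσ ε)ˣ → ℂ) : Prop :=
  ∀ (x : F) (hx : x ≠ 1) (b : Eˣ) (hb : algebraMap F E x = algebraMap F E ε * (b * σ b)),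
    orbHerm σ hσ μE μF Ω (gammaElt σ x hx) Φ =
      orbQuat σ hσ μE μQ Ω ε (deltaElt σ hσ ε b (by rw [← hb]; simpa using hx)) f

/-- `Φ` and `f_ε` purely match: `Φ` matches `f_ε`, and it matches `0` for the other class of
`Fˣ / Nm(Eˣ)`. -/
def PurelyMatches [MeasurableSpace Eˣ] [MeasurableSpace Fˣ] (μE : Measure Eˣ) (μF : Measure Fˣ)
    (μQ : Measure (Eˣ ⧸ (unitsIncl F E).range)) (Ω : Eˣ →* ℂˣ)
    (Φ : Herm σ → ℂ) (ε : Fˣ) (f : (quatAlg σ hσ ε)ˣ → ℂ) : Prop :=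
  Matches σ hσ μE μF μQ Ω Φ ε f ∧
    ∀ ε' : Fˣ, ¬ IsNorm σ ((ε' / ε : Fˣ) : F) → Matches σ hσ μE μF μQ Ω Φ ε' 0

end Quadratic

end

end FundLemma

open FundLemma

/-! A function on GL₂ of a local field that is invariant under the maximal compact subgroup on both
sides depends on two integers only: the content `m` (the least order of an entry) and `l = ord det -
2m`. `coef` and `ofCoef` pass between such a function and its values `c l m`. The other two spaces
reduce to the same pair of integers. A Hermitian matrix is equivalent under `K` to `diag(ϖ^(m+l),
ϖ^m)`, because some integer has unit trace and every unit of `F` is a norm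
(`exists_hermConj_eq_diag`). The isomorphism `B₁ ≅ M₂(F)` preserves content and order of the
determinant, because both maximal orders are additively generated by their units (`content_equiv`,
`ord_det_equiv`). The theorem thus becomes a statement about finitely supported functions of `(l,
m)`.

The relations take place along the rays `(l, m), (l+2, m-1), (l+4, m-2), …` on which the order of
the determinant is constant; put `(D X)(l, m) = X(l, m) - X(l+2, m-1)`. Summing `f` over the cosets
of `K` gives, up to the volume of `K ∩ H₀`, `Φ(l, m) = ∑ n_k c(l/2 + k, (m-k)/2)` over the `k ≡ m`
modulo 2 for even `l`, and `0` for odd `l` (`PhiOf_eq_hermCoef`). Here `n_k` is `1` for `k = 0` and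
`q^k + q^(k-1)` otherwise; it counts the `y` modulo `𝒪` for which `ϖ^k Nm(y) + ϖ^(-k)` is integral.
The Satake coefficients are ray sums of `c` with weights `1` and `q^k - q^(k-1)`, and base change
places those of `f`, formed with `q²`, at the pairs of even exponents. The weights telescope, and
base change turns into the single relation `D h = (-1)^m D Φ` (`raySum_sub`, `bcRay_sub`,
`raySum_bcCoef`). Functions supported in bounded `l` are determined by `D`, and the solution is the
explicit `bcCoef`. Traces on unramified principal series see all coefficients, since monomials are
linearly independent, so existence and uniqueness follow (`isHeckeBaseChange_iff`).

For the matching, put `t = Ω(ϖ)⁻¹` and `ψ(l) = ∑ Φ(l, m) (-t)^m`; the sign is `η(ϖ) = -1`. With `μ =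
min(0, ord b)` and `L = ord(1-x) - 2μ`, the quaternion integral is `t^(-μ) ∑ h(L, n) t^n`
(`orbQuat_eq`). The Hermitian integral is a sum over `j = ord a` (`orbHerm_eq`), whose terms get the
sign `(-1)^(ord x)` under `j ↦ -ord x - j` (`orbTerm_reflect`). It vanishes when `ord x` is odd,
that is, when `x` is not a norm. When `ord x` is even, folding it gives `t^(-μ) (ψ(L) + 2 ∑ t^r
ψ(L+2r))` with `r ≥ 1` (`tsum_orbTerm_of_even`), which is the generating series of `bcCoef`
(`tsum_bcCoef`). -/

namespace FundLemma

noncomputable section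

set_option linter.unusedSectionVars false

/-! ### Valuation, fractional ideals and denominators in a local field -/

section LocalField

variable {L : Type*} [Field L] [ValuativeRel L] [TopologicalSpace L]
  [IsNonarchimedeanLocalField L]

/-- The valuation of a local field with values in `ℤᵐ⁰`. -/
def intVal (x : L) : WithZero (Multiplicative ℤ) :=
  IsNonarchimedeanLocalField.valueGroupWithZeroIsoInt L (valuation L x)

lemma intVal_zero : intVal (0 : L) = 0 := by simp [intVal]
lemma intVal_one : intVal (1 : L) = 1 := by simp [intVal]
lemma intVal_mul (x y : L) : intVal (x * y) = intVal x * intVal y := by simp [intVal]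
lemma intVal_eq_zero {x : L} : intVal x = 0 ↔ x = 0 := by simp [intVal]
lemma intVal_neg (x : L) : intVal (-x) = intVal x := by simp [intVal, Valuation.map_neg]

lemma intVal_le_intVal {x y : L} : intVal x ≤ intVal y ↔ valuation L x ≤ valuation L y :=
  map_le_map_iff (IsNonarchimedeanLocalField.valueGroupWithZeroIsoInt L)

lemma intVal_eq_intVal {x y : L} : intVal x = intVal y ↔ valuation L x = valuation L y :=
  (IsNonarchimedeanLocalField.valueGroupWithZeroIsoInt L).injective.eq_iff

/-- The normalized additive valuation of a local field (with the value `0` at `0`). -/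
def ord (x : L) : ℤ := -WithZero.log (intVal x)

lemma intVal_eq_exp {x : L} (hx : x ≠ 0) : intVal x = WithZero.exp (-ord x) := by
  rw [ord, neg_neg, WithZero.exp_log (by rwa [Ne, intVal_eq_zero])]

lemma ord_one : ord (1 : L) = 0 := by simp [ord, intVal_one]

lemma ord_mul {x y : L} (hx : x ≠ 0) (hy : y ≠ 0) : ord (x * y) = ord x + ord y := by
  rw [ord, intVal_mul, WithZero.log_mul (by rwa [Ne, intVal_eq_zero])
    (by rwa [Ne, intVal_eq_zero]), ord, ord]
  ring

lemma ord_neg (x : L) : ord (-x) = ord x := by rw [ord, intVal_neg, ord]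

lemma ord_inv (x : L) : ord x⁻¹ = -ord x := by
  rcases eq_or_ne x 0 with rfl | hx
  · simp [ord, intVal_zero]
  · have := ord_mul hx (inv_ne_zero hx)
    rw [mul_inv_cancel₀ hx, ord_one] at this
    omega

/-- The normalized additive valuation as a homomorphism. -/
def ordHom : Lˣ →* Multiplicative ℤ where
  toFun u := Multiplicative.ofAdd (ord (u : L))
  map_one' := by simp [ord_one]
  map_mul' u u' := by simp [ord_mul u.ne_zero u'.ne_zero]

lemma ord_zpow (u : Lˣ) (n : ℤ) : ord ((u ^ n : Lˣ) : L) = n * ord (u : L) := by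
  have := map_zpow ordHom u n
  apply_fun Multiplicative.toAdd at this
  simpa [ordHom] using this

lemma ord_eq_zero_iff_valuation {x : L} (hx : x ≠ 0) : ord x = 0 ↔ valuation L x = 1 := by
  rw [← map_one (valuation L), ← intVal_eq_intVal, intVal_one, intVal_eq_exp hx]
  simp

/-- The fractional ideal of elements of valuation at least `n`. -/
def lat (L : Type*) [Field L] [ValuativeRel L] [TopologicalSpace L]
    [IsNonarchimedeanLocalField L] (n : ℤ) : AddSubgroup L where
  carrier := {x | intVal x ≤ WithZero.exp (-n)}
  zero_mem' := by simp [intVal_zero]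
  neg_mem' := by intro x hx; simpa [intVal_neg] using hx
  add_mem' := by
    intro x y hx hy
    have h := (valuation L).map_add x y
    rcases le_max_iff.mp h with h | h
    · exact (intVal_le_intVal.mpr h).trans hx
    · exact (intVal_le_intVal.mpr h).trans hy

lemma mem_lat {n : ℤ} {x : L} : x ∈ lat L n ↔ intVal x ≤ WithZero.exp (-n) := Iff.rfl

lemma mem_lat_iff {n : ℤ} {x : L} (hx : x ≠ 0) : x ∈ lat L n ↔ n ≤ ord x := by
  rw [mem_lat, intVal_eq_exp hx, WithZero.exp_le_exp]
  omega

lemma mem_lat_iff' {n : ℤ} {x : L} : x ∈ lat L n ↔ x = 0 ∨ n ≤ ord x := by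
  rcases eq_or_ne x 0 with rfl | hx
  · simp
  · simp [mem_lat_iff hx, hx]

lemma mem_lat_zero {x : L} : x ∈ lat L 0 ↔ x ∈ 𝒪[L] := by
  rw [Valuation.mem_integer_iff, ← map_one (valuation L), ← intVal_le_intVal, intVal_one, mem_lat]
  simp

lemma lat_anti {n m : ℤ} (h : n ≤ m) : lat L m ≤ lat L n := by
  intro x hx
  rw [mem_lat_iff'] at hx ⊢
  exact hx.imp_right h.trans

lemma mul_mem_lat {n m : ℤ} {x y : L} (hx : x ∈ lat L n) (hy : y ∈ lat L m) :
    x * y ∈ lat L (n + m) := by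
  rcases eq_or_ne x 0 with rfl | hx0
  · simp
  rcases eq_or_ne y 0 with rfl | hy0
  · simp
  rw [mem_lat_iff (mul_ne_zero hx0 hy0), ord_mul hx0 hy0]
  rw [mem_lat_iff hx0] at hx
  rw [mem_lat_iff hy0] at hy
  omega

lemma mul_mem_lat_iff {n : ℤ} {x y : L} (hx : x ≠ 0) : x * y ∈ lat L n ↔ y ∈ lat L (n - ord x) := by
  rcases eq_or_ne y 0 with rfl | hy0
  · simp
  rw [mem_lat_iff (mul_ne_zero hx hy0), mem_lat_iff hy0, ord_mul hx hy0]
  omega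

lemma mul_mem_lat_zero {x y : L} {n : ℤ} (hx : x ∈ lat L 0) (hy : y ∈ lat L n) :
    x * y ∈ lat L n := by
  simpa using mul_mem_lat hx hy

lemma one_mem_lat : (1 : L) ∈ lat L 0 := by simp [mem_lat_iff, ord_one]

/-- A term of strictly smaller order dominates in the ultrametric inequality: were `x + y` deeper
than `x`, subtracting `y` would put `x` deeper than its own order. -/
lemma ord_add_eq_left {x y : L} (hx : x ≠ 0) (hy : y ∈ lat L (ord x + 1)) :
    x + y ≠ 0 ∧ ord (x + y) = ord x := by
  have key : ∀ n, x + y ∈ lat L n → n ≤ ord x := by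
    intro n hn
    by_contra hlt
    have h1 := lat_anti (by omega : ord x + 1 ≤ n) hn
    have h2 := sub_mem h1 hy
    rw [add_sub_cancel_right, mem_lat_iff hx] at h2
    omega
  have h0 : x + y ≠ 0 := by
    intro h
    have := key (ord x + 1) (by rw [h]; exact zero_mem _)
    omega
  refine ⟨h0, le_antisymm (key _ ((mem_lat_iff h0).mpr le_rfl)) ?_⟩
  rw [← mem_lat_iff h0]
  exact add_mem ((mem_lat_iff hx).mpr le_rfl) (lat_anti (by omega) hy)

lemma eq_zero_of_forall_mem_lat {x : L} (h : ∀ n : ℕ, x ∈ lat L n) : x = 0 := by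
  by_contra hx
  have := (mem_lat_iff hx).mp (h (ord x + 1).toNat)
  omega

lemma exists_ord_eq_one : ∃ ϖ : Lˣ, ord (ϖ : L) = 1 := by
  obtain ⟨y, hy⟩ := ValuativeRel.valuation_surjective
    ((IsNonarchimedeanLocalField.valueGroupWithZeroIsoInt L).symm (WithZero.exp (-1)))
  have h : intVal y = WithZero.exp (-1) := by simp [intVal, hy]
  have hy0 : y ≠ 0 := by
    rintro rfl
    rw [intVal_zero] at h
    exact WithZero.exp_ne_zero h.symm
  exact ⟨Units.mk0 y hy0, by simp [ord, h]⟩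

lemma normAbs_eq {x : L} (hx : x ≠ 0) :
    normAbs L x = (Nat.card 𝓀[L] : ℝ) ^ (-ord x) := by
  have h : intVal x ≠ 0 := by rwa [Ne, intVal_eq_zero]
  have : normAbs L x = (WithZeroMulInt.toNNReal (e := (Nat.card 𝓀[L] : NNReal))
    (Nat.cast_ne_zero.mpr Nat.card_pos.ne') (intVal x) : ℝ) := rfl
  rw [this, WithZeroMulInt.toNNReal_neg_apply _ h, WithZero.toAdd_unzero_eq_log h, ord]
  simp

lemma isOpen_lat (n : ℤ) : IsOpen (lat L n : Set L) := by
  obtain ⟨ϖ, hϖ⟩ := exists_ord_eq_one (L := L)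
  have h0 : IsOpen (𝒪[L] : Set L) := (valuation L).isOpen_integer
  have : (lat L n : Set L) = (fun x => ((ϖ ^ (-n) : Lˣ) : L) * x) ⁻¹' (𝒪[L] : Set L) := by
    ext x
    simp only [Set.mem_preimage, SetLike.mem_coe, ← mem_lat_zero]
    rw [mul_mem_lat_iff (Units.ne_zero _), ord_zpow, hϖ]
    simp
  rw [this]
  exact h0.preimage (continuous_const_mul _)

lemma isClosed_lat (n : ℤ) : IsClosed (lat L n : Set L) :=
  AddSubgroup.isClosed_of_isOpen _ (isOpen_lat n)

lemma isCompact_lat_zero : IsCompact (lat L 0 : Set L) := by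
  have h := IsNonarchimedeanLocalField.isCompact_closedBall L 1
  convert! h using 1
  ext x
  exact mem_lat_zero

lemma exists_lat_subset {U : Set L} (hU : U ∈ nhds (0 : L)) : ∃ n : ℕ, (lat L n : Set L) ⊆ U := by
  obtain ⟨r, hr, h⟩ := (IsValuativeTopology.hasBasis_nhds_zero' L).mem_iff.mp hU
  obtain ⟨y, rfl⟩ := ValuativeRel.valuation_surjective r
  have hy : y ≠ 0 := by simpa using hr
  refine ⟨(ord y + 1).toNat, fun x hx => h ?_⟩
  simp only [Set.mem_ofPred_eq]
  rw [← not_le, ← intVal_le_intVal, intVal_eq_exp hy]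
  intro hle
  rcases eq_or_ne x 0 with rfl | hx0
  · simp [intVal_zero] at hle
  · rw [intVal_eq_exp hx0, WithZero.exp_le_exp] at hle
    have := (mem_lat_iff hx0).mp hx
    omega

instance : T2Space L := by
  let := IsTopologicalAddGroup.rightUniformSpace L
  have := isUniformAddGroup_of_addCommGroup (G := L)
  infer_instance

/-- The additive group `L/𝒪`. -/
abbrev LQuot (L : Type*) [Field L] [ValuativeRel L] [TopologicalSpace L]
    [IsNonarchimedeanLocalField L] : Type _ := L ⧸ lat L 0

/-- Multiplication by `u⁻¹` followed by reduction, on the elements of valuation at least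
`ord u`. -/
def latToResidue (u : Lˣ) : lat L (ord (u : L)) →+ 𝓀[L] where
  toFun x := IsLocalRing.residue 𝒪[L] ⟨(u : L)⁻¹ * x, by
    rw [← mem_lat_zero, mul_mem_lat_iff (inv_ne_zero u.ne_zero), ord_inv]
    simp⟩
  map_zero' := by
    rw [← map_zero (IsLocalRing.residue 𝒪[L])]
    congr 1
    ext
    simp
  map_add' x y := by
    rw [← map_add]
    congr 1
    ext
    simp [mul_add]

lemma mem_maximalIdeal_iff {x : 𝒪[L]} : x ∈ 𝓂[L] ↔ (x : L) ∈ lat L 1 := by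
  have hx : (x : L) ∈ lat L 0 := mem_lat_zero.mpr x.2
  rw [IsLocalRing.mem_maximalIdeal, mem_nonunits_iff, not_iff_comm]
  constructor
  · intro h
    have h0 : (x : L) ≠ 0 := by
      intro h0
      rw [h0] at h
      exact h (zero_mem _)
    rw [mem_lat_iff h0] at hx h
    have hinv : (x : L)⁻¹ ∈ 𝒪[L] := by
      rw [← mem_lat_zero, mem_lat_iff (inv_ne_zero h0), ord_inv]
      omega
    exact IsUnit.of_mul_eq_one ⟨_, hinv⟩ (Subtype.ext (mul_inv_cancel₀ h0))
  · rintro ⟨u, rfl⟩ h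
    have h1 : (u.1 : L) * (u⁻¹.1 : L) = 1 := by
      rw [← Subring.coe_mul, Units.mul_inv, Subring.coe_one]
    have h2 := mul_mem_lat h (mem_lat_zero.mpr u⁻¹.1.2)
    rw [h1, mem_lat_iff one_ne_zero, ord_one] at h2
    omega

lemma latToResidue_surjective (u : Lˣ) : Function.Surjective (latToResidue u) := by
  intro y
  obtain ⟨x, rfl⟩ := IsLocalRing.residue_surjective y
  refine ⟨⟨u * x, ?_⟩, ?_⟩
  · rw [mul_mem_lat_iff u.ne_zero, sub_self, mem_lat_zero]
    exact x.2
  · simp [latToResidue]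

lemma latToResidue_ker (u : Lˣ) :
    (latToResidue u).ker = (lat L (ord (u : L) + 1)).addSubgroupOf (lat L (ord (u : L))) := by
  ext x
  rw [AddMonoidHom.mem_ker, AddSubgroup.mem_addSubgroupOf]
  change IsLocalRing.residue 𝒪[L] _ = 0 ↔ _
  rw [IsLocalRing.residue_eq_zero_iff, mem_maximalIdeal_iff]
  change (u : L)⁻¹ * (x : L) ∈ _ ↔ _
  rw [mul_mem_lat_iff (inv_ne_zero u.ne_zero), ord_inv, sub_neg_eq_add, add_comm]

/-- Multiplication by the inverse of an element of order `n` identifies the quotient with the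
residue field (`latToResidue`). -/
lemma relIndex_lat_succ (n : ℤ) : (lat L (n + 1)).relIndex (lat L n) = Nat.card 𝓀[L] := by
  obtain ⟨ϖ, hϖ⟩ := exists_ord_eq_one (L := L)
  have h : ord ((ϖ ^ n : Lˣ) : L) = n  := by rw [ord_zpow, hϖ, mul_one]
  have h1 := AddSubgroup.index_ker (latToResidue (ϖ ^ n))
  rw [latToResidue_ker, AddMonoidHom.range_eq_top.mpr (latToResidue_surjective _),
    AddSubgroup.card_top] at h1
  rw [h] at h1
  exact h1

lemma relIndex_lat (n : ℤ) (k : ℕ) :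
    (lat L n).relIndex (lat L (n - k)) = Nat.card 𝓀[L] ^ k := by
  induction k with
  | zero => simp
  | succ k ih =>
    rw [pow_succ, ← ih, ← relIndex_lat_succ (n - (k + 1 : ℕ)),
      show n - (k + 1 : ℕ) + 1 = n - k by push_cast; ring]
    exact (AddSubgroup.relIndex_mul_relIndex _ _ _ (lat_anti (by omega))
      (lat_anti (by push_cast; omega))).symm

/-- The order of the denominator of an element of a local field. -/
def den (y : L) : ℕ := (-ord y).toNat

lemma den_le_iff {y : L} {k : ℕ} : den y ≤ k ↔ y ∈ lat L (-k) := by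
  rcases eq_or_ne y 0 with rfl | hy
  · simp [den, ord, intVal_zero]
  · rw [mem_lat_iff hy, den]
    omega

lemma den_eq_of_sub_mem {y y' : L} (h : y - y' ∈ lat L 0) : den y = den y' := by
  refine eq_of_forall_ge_iff fun k => ?_
  rw [den_le_iff, den_le_iff]
  have h' : y - y' ∈ lat L (-k) := lat_anti (by omega) h
  exact ⟨fun h1 => by simpa using sub_mem h1 h', fun h1 => by simpa using add_mem h' h1⟩

/-- The order of the denominator of an element of `L/𝒪`. -/
def denQ (y : LQuot L) : ℕ := den y.out

lemma out_sub_mem (y : L) : (QuotientAddGroup.mk y : LQuot L).out - y ∈ lat L 0 := by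
  have h := QuotientAddGroup.out_eq' (QuotientAddGroup.mk y : LQuot L)
  rw [eq_comm, QuotientAddGroup.eq] at h
  rwa [sub_eq_neg_add]

lemma denQ_mk (y : L) : denQ (QuotientAddGroup.mk y : LQuot L) = den y :=
  den_eq_of_sub_mem (out_sub_mem y)

/-- These classes form the image in `L/𝒪` of the fractional ideal `lat L (-k)`, whose size is the
index of `𝒪` in it. -/
lemma natCard_denQ_le (k : ℕ) : Nat.card {y : LQuot L // denQ y ≤ k} = Nat.card 𝓀[L] ^ k := by
  have h := AddSubgroup.relIndex_ker (lat L (0 - k)) (QuotientAddGroup.mk' (lat L 0))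
  rw [QuotientAddGroup.ker_mk', relIndex_lat] at h
  rw [h]
  refine Nat.card_congr (Equiv.subtypeEquivRight fun y => ?_)
  rw [AddSubgroup.mem_map, zero_sub]
  constructor
  · intro hy
    exact ⟨y.out, den_le_iff.mp hy, QuotientAddGroup.out_eq' y⟩
  · rintro ⟨x, hx, rfl⟩
    exact (denQ_mk x).trans_le (den_le_iff.mpr hx)

lemma one_lt_card_residue : 1 < Nat.card 𝓀[L] := Finite.one_lt_card

lemma finite_denQ_le (k : ℕ) : {y : LQuot L | denQ y ≤ k}.Finite := by
  refine Set.finite_of_ncard_ne_zero ?_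
  have h := natCard_denQ_le (L := L) k
  have h1 : {y : LQuot L | denQ y ≤ k}.ncard = Nat.card 𝓀[L] ^ k := h
  rw [h1]
  exact pow_ne_zero _ (one_lt_card_residue (L := L)).ne_bot

/-- The number of elements with denominator of order `k` in `L/𝒪`, where `q` is the number of
elements of the residue field. -/
def denCount (q : ℂ) : ℕ → ℂ
  | 0 => 1
  | k + 1 => q ^ (k + 1) - q ^ k

lemma finite_denQ_eq (k : ℕ) : {y : LQuot L | denQ y = k}.Finite :=
  (finite_denQ_le k).subset fun _ h => le_of_eq h

lemma ncard_denQ_eq (k : ℕ) :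
    ({y : LQuot L | denQ y = k}.ncard : ℂ) = denCount (Nat.card 𝓀[L]) k := by
  have h (k : ℕ) : {y : LQuot L | denQ y ≤ k}.ncard = Nat.card 𝓀[L] ^ k := natCard_denQ_le k
  cases k with
  | zero => simpa [denCount] using congrArg (Nat.cast : ℕ → ℂ) (h 0)
  | succ k =>
    have hu : {y : LQuot L | denQ y ≤ k + 1} = {y | denQ y ≤ k} ∪ {y | denQ y = k + 1} := by
      ext y
      simp only [Set.mem_ofPred_eq, Set.mem_union]
      omega
    have hd : Disjoint {y : LQuot L | denQ y ≤ k} {y | denQ y = k + 1} := by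
      rw [Set.disjoint_left]
      intro y h1 h2
      simp only [Set.mem_ofPred_eq] at h1 h2
      omega
    have h1 := Set.ncard_union_eq hd (finite_denQ_le k) (finite_denQ_eq (k + 1))
    rw [← hu, h, h] at h1
    rw [denCount, eq_sub_iff_add_eq, add_comm]
    exact_mod_cast h1.symm

/-- This carries out the sum over the unipotent coordinate in the Iwasawa decomposition, where
spherical functions depend only on the denominator. -/
lemma hasSum_denQ (G : ℕ → ℂ) (B : ℕ) (hG : ∀ k, B ≤ k → G k = 0) :
    HasSum (fun y : LQuot L => G (denQ y))
      (∑ k ∈ Finset.range B, denCount (Nat.card 𝓀[L]) k * G k) := by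
  classical
  let S := (finite_denQ_le (L := L) B).toFinset
  have h1 : HasSum (fun y : LQuot L => G (denQ y)) (∑ y ∈ S, G (denQ y)) := by
    refine hasSum_sum_of_ne_finset_zero fun y hy => hG _ ?_
    simp only [S, Set.Finite.mem_toFinset, Set.mem_ofPred_eq] at hy
    omega
  convert h1 using 1
  have h2 : ∑ y ∈ S, G (denQ y) =
      ∑ k ∈ Finset.range (B + 1), ∑ y ∈ S with denQ y = k, G (denQ y) := by
    refine (Finset.sum_fiberwise_of_maps_to (fun y hy => ?_) _).symm
    simp only [S, Set.Finite.mem_toFinset, Set.mem_ofPred_eq] at hy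
    simpa [Nat.lt_succ_iff] using hy
  rw [h2, Finset.sum_range_succ, Finset.sum_eq_zero (s := S.filter _), add_zero]
  · refine Finset.sum_congr rfl fun k hk => ?_
    rw [Finset.sum_congr rfl (g := fun _ => G k) (by simp +contextual), Finset.sum_const,
      nsmul_eq_mul, ← ncard_denQ_eq, ← Set.ncard_coe_finset]
    congr 3
    ext y
    simp only [Finset.mem_range] at hk
    simp only [S, Finset.coe_filter, Set.Finite.mem_toFinset, Set.mem_ofPred_eq]
    omega
  · intro y hy
    rw [(Finset.mem_filter.mp hy).2]
    exact hG _ le_rfl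

end LocalField

/-! ### Integrals as sums over the cosets of an open subgroup -/

section Cosets

variable {G : Type*} [Group G] [TopologicalSpace G] [IsTopologicalGroup G]

/-- All integrals over `GL₂`, `H₀`, `Eˣ` and `Fˣ` are reduced to sums in this way. The hypothesis on
`r` says that it is a system of representatives of `G/K`; finitely many contributing cosets make
integrability automatic. -/
lemma integral_eq_tsum_cosets [MeasurableSpace G] [BorelSpace G] (μ : Measure G)
    [μ.IsMulLeftInvariant] (K : Subgroup G) (hK : IsOpen (K : Set G)) (hfin : μ K ≠ ⊤)
    {ι : Type*} (r : ι → G) (hr : ∀ g, ∃! i, (r i)⁻¹ * g ∈ K) (φ : G → ℂ)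
    (hφ : ∀ g, ∀ k ∈ K, φ (g * k) = φ g) (hs : {i | φ (r i) ≠ 0}.Finite) :
    ∫ g, φ g ∂μ = μ.real K * ∑' i, φ (r i) := by
  classical
  choose j hj hj' using hr
  have hval (g : G) : φ g = φ (r (j g)) := by
    conv_lhs => rw [← mul_inv_cancel_left (r (j g)) g]
    exact hφ _ _ (hj g)
  have hr1 (i : ι) : j (r i) = i := (hj' (r i) i (by simp [one_mem])).symm
  let A (i : ι) : Set G := (fun g => (r i)⁻¹ * g) ⁻¹' K
  have hA (i : ι) : MeasurableSet (A i) :=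
    (hK.preimage (continuous_const_mul _)).measurableSet
  have hμA (i : ι) : μ (A i) = μ K := measure_preimage_mul μ _ _
  have hmem (g : G) (i : ι) : g ∈ A i ↔ j g = i :=
    ⟨fun h => (hj' g i h).symm, fun h => h ▸ hj g⟩
  have hsum : φ = fun g => ∑ i ∈ hs.toFinset, (A i).indicator (fun _ => φ (r i)) g := by
    funext g
    simp only [Set.indicator_apply, hmem, Finset.sum_ite_eq]
    split_ifs with h
    · exact hval g
    · rw [hval g]
      simpa using h
  calc ∫ g, φ g ∂μ = ∫ g, ∑ i ∈ hs.toFinset, (A i).indicator (fun _ => φ (r i)) g ∂μ := by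
        rw [← hsum]
    _ = ∑ i ∈ hs.toFinset, ∫ g, (A i).indicator (fun _ => φ (r i)) g ∂μ := by
        refine integral_finsetSum _ fun i _ => ?_
        refine (integrable_indicator_iff (hA i)).mpr ?_
        exact integrableOn_const (by rw [hμA]; exact hfin)
    _ = ∑ i ∈ hs.toFinset, μ.real K * φ (r i) := by
        refine Finset.sum_congr rfl fun i _ => ?_
        rw [integral_indicator (hA i), setIntegral_const, measureReal_def, hμA]
        simp [measureReal_def]
    _ = μ.real K * ∑' i, φ (r i) := by
        rw [← Finset.mul_sum, tsum_eq_sum]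
        intro i hi
        simpa using hi

/-- The image of a compact set in the discrete space `G/K` is finite. -/
lemma finite_cosets_of_compact (K : Subgroup G) (hK : IsOpen (K : Set G)) {C : Set G}
    (hC : IsCompact C) {ι : Type*} (r : ι → G)
    (hr : ∀ i i', (r i)⁻¹ * r i' ∈ K → i = i') : {i | r i ∈ C}.Finite := by
  have : DiscreteTopology (G ⧸ K) := QuotientGroup.discreteTopology hK
  have h1 : ((QuotientGroup.mk : G → G ⧸ K) '' C).Finite :=
    (hC.image QuotientGroup.continuous_mk).finite_of_discrete
  refine Set.Finite.of_finite_image (f := fun i => (QuotientGroup.mk (r i) : G ⧸ K))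
    (h1.subset ?_) ?_
  · rintro _ ⟨i, hi, rfl⟩
    exact ⟨_, hi, rfl⟩
  · intro i _ i' _ h
    exact hr i i' (QuotientGroup.eq.mp h)

end Cosets

/-! ### Content and determinant of matrices -/

section Content

variable {L : Type*} [Field L] [ValuativeRel L] [TopologicalSpace L]
  [IsNonarchimedeanLocalField L]

lemma exists_minOrd {ι : Type*} [Finite ι] (x : ι → L) (hx : ∃ i, x i ≠ 0) :
    ∃ m : ℤ, ∀ n, n ≤ m ↔ ∀ i, x i ∈ lat L n := by
  classical
  cases nonempty_fintype ι
  obtain ⟨i₀, h₀⟩ := hx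
  obtain ⟨i, hi, hmin⟩ := Finset.exists_min_image (Finset.univ.filter fun i => x i ≠ 0)
    (fun i => ord (x i)) ⟨i₀, by simpa using h₀⟩
  refine ⟨ord (x i), fun n => ⟨fun h j => ?_, fun h => ?_⟩⟩
  · rw [mem_lat_iff']
    by_cases hj : x j = 0
    · exact Or.inl hj
    · exact Or.inr (h.trans (hmin j (by simpa using hj)))
  · exact (mem_lat_iff (by simpa using hi)).mp (h i)

open Classical in
/-- The minimum of the valuations of a finite nonzero family. -/
def minOrd {ι : Type*} [Finite ι] (x : ι → L) : ℤ :=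
  if hx : ∃ i, x i ≠ 0 then (exists_minOrd x hx).choose else 0

lemma le_minOrd_iff {ι : Type*} [Finite ι] {x : ι → L} (hx : ∃ i, x i ≠ 0) {n : ℤ} :
    n ≤ minOrd x ↔ ∀ i, x i ∈ lat L n := by
  rw [minOrd, dif_pos hx]
  exact (exists_minOrd x hx).choose_spec n

lemma exists_ord_eq_minOrd {ι : Type*} [Finite ι] {x : ι → L} (hx : ∃ i, x i ≠ 0) :
    ∃ i, x i ≠ 0 ∧ ord (x i) = minOrd x := by
  have h : ¬ (∀ i, x i ∈ lat L (minOrd x + 1)) := by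
    rw [← le_minOrd_iff hx]
    omega
  push Not at h
  obtain ⟨i, hi⟩ := h
  have hi0 : x i ≠ 0 := fun h => hi (h ▸ zero_mem _)
  refine ⟨i, hi0, le_antisymm ?_ ?_⟩
  · rw [mem_lat_iff hi0] at hi
    omega
  · exact (mem_lat_iff hi0).mp ((le_minOrd_iff hx).mp le_rfl i)

/-- The minimum of the valuations of the entries of a matrix. -/
def content (M : Matrix (Fin 2) (Fin 2) L) : ℤ := minOrd fun p : Fin 2 × Fin 2 => M p.1 p.2

lemma exists_entry_ne_zero (g : GL (Fin 2) L) : ∃ p : Fin 2 × Fin 2, g.1 p.1 p.2 ≠ 0 := by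
  by_contra! h
  have h0 : g.1 = 0 := by
    ext i j
    exact h (i, j)
  exact g.ne_zero h0

lemma le_content_iff (g : GL (Fin 2) L) {n : ℤ} :
    n ≤ content g.1 ↔ ∀ i j, g.1 i j ∈ lat L n := by
  rw [content, le_minOrd_iff (exists_entry_ne_zero g)]
  exact Prod.forall

lemma content_eq_of_forall {g g' : GL (Fin 2) L}
    (h : ∀ n, (∀ i j, g.1 i j ∈ lat L n) ↔ ∀ i j, g'.1 i j ∈ lat L n) :
    content g.1 = content g'.1 := by
  refine eq_of_forall_le_iff fun n => ?_
  rw [le_content_iff, le_content_iff, h]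

lemma content_mul_le (g h : GL (Fin 2) L) : content g.1 + content h.1 ≤ content (g * h).1 := by
  rw [le_content_iff]
  intro i j
  rw [Units.val_mul, Matrix.mul_apply]
  exact sum_mem fun k _ => mul_mem_lat ((le_content_iff g).mp le_rfl i k)
    ((le_content_iff h).mp le_rfl k j)

lemma det_ne_zero (g : GL (Fin 2) L) : g.1.det ≠ 0 :=
  (Matrix.GeneralLinearGroup.det g).ne_zero

lemma ord_det_mul (g h : GL (Fin 2) L) :
    ord (g * h).1.det = ord g.1.det + ord h.1.det := by
  rw [Units.val_mul, Matrix.det_mul, ord_mul (det_ne_zero g) (det_ne_zero h)]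

lemma ord_det_inv (g : GL (Fin 2) L) : ord g⁻¹.1.det = -ord g.1.det := by
  have h := ord_det_mul g g⁻¹
  rw [mul_inv_cancel, Units.val_one, Matrix.det_one, ord_one] at h
  omega

lemma coe_inv_eq (g : GL (Fin 2) L) : g⁻¹.1 = g.1.det⁻¹ • g.1.adjugate := by
  rw [Matrix.coe_units_inv, Matrix.inv_def, Ring.inverse_eq_inv']

/-- The inverse is the adjugate divided by the determinant, and the adjugate of a 2 × 2 matrix has
the same entries up to place and sign. -/
lemma content_inv (g : GL (Fin 2) L) : content g⁻¹.1 = content g.1 - ord g.1.det := by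
  refine eq_of_forall_le_iff fun n => ?_
  rw [le_content_iff, le_sub_iff_add_le, le_content_iff, coe_inv_eq]
  have h (x : L) : g.1.det⁻¹ * x ∈ lat L n ↔ x ∈ lat L (n + ord g.1.det) := by
    rw [mul_mem_lat_iff (inv_ne_zero (det_ne_zero g)), ord_inv, sub_neg_eq_add]
  simp only [Matrix.smul_apply, smul_eq_mul, h, Matrix.adjugate_fin_two, Fin.forall_fin_two]
  simp
  tauto

lemma two_content_le_ord_det (g : GL (Fin 2) L) : 2 * content g.1 ≤ ord g.1.det := by
  rw [← mem_lat_iff (det_ne_zero g), Matrix.det_fin_two, two_mul]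
  have h := (le_content_iff g).mp le_rfl
  exact sub_mem (mul_mem_lat (h _ _) (h _ _)) (mul_mem_lat (h _ _) (h _ _))

lemma mem_maxCompact_iff {g : GL (Fin 2) L} :
    g ∈ maxCompact L ↔ (∀ i j, g.1 i j ∈ lat L 0) ∧ ord g.1.det = 0 := by
  have key (k : GL (Fin 2) 𝒪[L]) (i j : Fin 2) :
      (Matrix.GeneralLinearGroup.map (algebraMap 𝒪[L] L) k).1 i j ∈ lat L 0 :=
    mem_lat_zero.mpr (k.1 i j).2
  constructor
  · rintro ⟨k, rfl⟩
    -- With `c` the content and `d` the order of the determinant, integrality of `k` and `k⁻¹` gives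
    -- `0 ≤ c` and `d ≤ c`; together with `2c ≤ d` this forces `c = d = 0`.
    have h1 := (le_content_iff _).mpr (key k)
    have h2 := (le_content_iff _).mpr (key k⁻¹)
    rw [map_inv, content_inv] at h2
    have h3 := two_content_le_ord_det (Matrix.GeneralLinearGroup.map (algebraMap 𝒪[L] L) k)
    have h4 := two_content_le_ord_det (Matrix.GeneralLinearGroup.map (algebraMap 𝒪[L] L) k)⁻¹
    rw [ord_det_inv, content_inv] at h4
    exact ⟨key k, by omega⟩
  · rintro ⟨h, h'⟩
    refine mem_maxCompact_of_entries (fun i j => mem_lat_zero.mp (h i j)) fun i j => ?_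
    rw [← mem_lat_zero]
    revert i j
    rw [← le_content_iff, content_inv, h', sub_zero, le_content_iff]
    exact h

lemma mem_maxCompact_iff' {g : GL (Fin 2) L} :
    g ∈ maxCompact L ↔ 0 ≤ content g.1 ∧ ord g.1.det = 0 := by
  rw [mem_maxCompact_iff, le_content_iff]

/-- Content is superadditive and elements of `K` have nonnegative content; apply this to `k` and to
`k⁻¹`. -/
lemma content_mul_left {k : GL (Fin 2) L} (hk : k ∈ maxCompact L) (g : GL (Fin 2) L) :
    content (k * g).1 = content g.1 := by
  have h1 := content_mul_le k g
  have h2 := content_mul_le k⁻¹ (k * g)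
  rw [inv_mul_cancel_left] at h2
  have h3 := (mem_maxCompact_iff'.mp hk).1
  have h4 := (mem_maxCompact_iff'.mp (inv_mem hk)).1
  omega

lemma content_mul_right {k : GL (Fin 2) L} (hk : k ∈ maxCompact L) (g : GL (Fin 2) L) :
    content (g * k).1 = content g.1 := by
  have h1 := content_mul_le g k
  have h2 := content_mul_le (g * k) k⁻¹
  rw [mul_inv_cancel_right] at h2
  have h3 := (mem_maxCompact_iff'.mp hk).1
  have h4 := (mem_maxCompact_iff'.mp (inv_mem hk)).1
  omega

lemma ord_det_mul_left {k : GL (Fin 2) L} (hk : k ∈ maxCompact L) (g : GL (Fin 2) L) :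
    ord (k * g).1.det = ord g.1.det := by
  rw [ord_det_mul, (mem_maxCompact_iff'.mp hk).2, zero_add]

lemma ord_det_mul_right {k : GL (Fin 2) L} (hk : k ∈ maxCompact L) (g : GL (Fin 2) L) :
    ord (g * k).1.det = ord g.1.det := by
  rw [ord_det_mul, (mem_maxCompact_iff'.mp hk).2, add_zero]

lemma coe_borelMat (a d : Lˣ) (b : L) : (borelMat a d b).1 = !![(a : L), b; 0, (d : L)] := rfl

lemma det_borelMat (a d : Lˣ) (b : L) : (borelMat a d b).1.det = a * d := by
  simp [coe_borelMat, Matrix.det_fin_two_of]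

lemma borelMat_mul (a d a' d' : Lˣ) (b b' : L) :
    borelMat a d b * borelMat a' d' b' = borelMat (a * a') (d * d') (a * b' + b * d') := by
  ext i j
  fin_cases i <;> fin_cases j <;> simp [coe_borelMat]

lemma borelMat_one : borelMat (1 : Lˣ) 1 0 = 1 := by
  ext i j
  fin_cases i <;> fin_cases j <;> simp [coe_borelMat]

lemma inv_borelMat (a d : Lˣ) (b : L) :
    (borelMat a d b)⁻¹ = borelMat a⁻¹ d⁻¹ (-(a⁻¹ : Lˣ) * b * (d⁻¹ : Lˣ)) := by
  rw [inv_eq_iff_mul_eq_one, borelMat_mul, ← borelMat_one]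
  congr 1
  · simp
  · simp
  · simp [← mul_assoc]

lemma borelMat_mem_maxCompact {a d : Lˣ} {b : L} :
    borelMat a d b ∈ maxCompact L ↔ ord (a : L) = 0 ∧ ord (d : L) = 0 ∧ b ∈ lat L 0 := by
  rw [mem_maxCompact_iff, det_borelMat, ord_mul a.ne_zero d.ne_zero]
  simp only [coe_borelMat, Fin.forall_fin_two]
  simp only [Matrix.of_apply, Matrix.cons_val', Matrix.cons_val_zero, Matrix.cons_val_one,
    Matrix.cons_val_fin_one, mem_lat_iff a.ne_zero, mem_lat_iff d.ne_zero, zero_mem, true_and]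
  constructor
  · rintro ⟨⟨⟨h1, h2⟩, h3⟩, h4⟩
    exact ⟨by omega, by omega, h2⟩
  · rintro ⟨h1, h2, h3⟩
    exact ⟨⟨⟨by omega, h3⟩, by omega⟩, by omega⟩

/-- The lower triangular unipotent matrix with lower left entry `c`. -/
def lowerMat (c : L) : GL (Fin 2) L :=
  Matrix.GeneralLinearGroup.mkOfDetNeZero !![1, 0; c, 1] (by simp [Matrix.det_fin_two_of])

lemma coe_lowerMat (c : L) : (lowerMat c).1 = !![1, 0; c, 1] := rfl

lemma lowerMat_mem_maxCompact {c : L} (hc : c ∈ lat L 0) : lowerMat c ∈ maxCompact L := by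
  rw [mem_maxCompact_iff]
  simp [coe_lowerMat, Matrix.det_fin_two_of, Fin.forall_fin_two, hc, one_mem_lat, ord_one]

/-- The Weyl element. -/
def swapMat (L : Type*) [Field L] : GL (Fin 2) L :=
  Matrix.GeneralLinearGroup.mkOfDetNeZero !![0, 1; 1, 0] (by simp [Matrix.det_fin_two_of])

lemma coe_swapMat : (swapMat L).1 = !![0, 1; 1, 0] := rfl

lemma swapMat_mem_maxCompact : swapMat L ∈ maxCompact L := by
  rw [mem_maxCompact_iff]
  simp [coe_swapMat, Matrix.det_fin_two_of, Fin.forall_fin_two, one_mem_lat, ord_one, ord_neg]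

lemma swapMat_mul_swapMat : swapMat L * swapMat L = 1 := by
  ext i j
  fin_cases i <;> fin_cases j <;> simp [coe_swapMat]

lemma isCompact_maxCompact : IsCompact (maxCompact L : Set (GL (Fin 2) L)) := by
  have : CompactSpace (Matrix (Fin 2) (Fin 2) 𝒪[L]) :=
    inferInstanceAs (CompactSpace (Fin 2 → Fin 2 → 𝒪[L]))
  have : T1Space (Matrix (Fin 2) (Fin 2) 𝒪[L]) :=
    inferInstanceAs (T1Space (Fin 2 → Fin 2 → 𝒪[L]))
  have h : Continuous (Matrix.GeneralLinearGroup.map (n := Fin 2) (algebraMap 𝒪[L] L)) := by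
    refine Continuous.units_map _ ?_
    exact continuous_id.matrix_map continuous_subtype_val
  have := isCompact_range h
  rwa [maxCompact, MonoidHom.coe_range]

end Content

/-! ### Iwasawa and Cartan decompositions, and representatives of GL₂(L)/GL₂(𝒪) -/

section Decompositions

variable {L : Type*} [Field L] [ValuativeRel L] [TopologicalSpace L]
  [IsNonarchimedeanLocalField L]

/-- The minimum of the valuations of the bottom row of a matrix. -/
def bottomOrd (M : Matrix (Fin 2) (Fin 2) L) : ℤ := minOrd fun j : Fin 2 => M 1 j

lemma exists_bottom_ne_zero (g : GL (Fin 2) L) : ∃ j : Fin 2, g.1 1 j ≠ 0 := by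
  by_contra! h
  refine det_ne_zero g ?_
  rw [Matrix.det_fin_two, h 0, h 1]
  ring

lemma le_bottomOrd_iff (g : GL (Fin 2) L) {n : ℤ} :
    n ≤ bottomOrd g.1 ↔ ∀ j, g.1 1 j ∈ lat L n :=
  le_minOrd_iff (exists_bottom_ne_zero g)

lemma bottomOrd_mul_le {k : GL (Fin 2) L} (hk : k ∈ maxCompact L) (g : GL (Fin 2) L) :
    bottomOrd g.1 ≤ bottomOrd (g * k).1 := by
  rw [le_bottomOrd_iff]
  intro j
  rw [Units.val_mul, Matrix.mul_apply]
  refine sum_mem fun i _ => ?_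
  simpa using mul_mem_lat ((le_bottomOrd_iff g).mp le_rfl i) ((mem_maxCompact_iff.mp hk).1 i j)

lemma bottomOrd_mul_right {k : GL (Fin 2) L} (hk : k ∈ maxCompact L) (g : GL (Fin 2) L) :
    bottomOrd (g * k).1 = bottomOrd g.1 := by
  refine le_antisymm ?_ (bottomOrd_mul_le hk g)
  simpa using bottomOrd_mul_le (inv_mem hk) (g * k)

lemma bottomOrd_borelMat_mul (a d : Lˣ) (b : L) (g : GL (Fin 2) L) :
    bottomOrd (borelMat a d b * g).1 = ord (d : L) + bottomOrd g.1 := by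
  refine eq_of_forall_le_iff fun n => ?_
  rw [le_bottomOrd_iff, ← sub_le_iff_le_add', le_bottomOrd_iff]
  refine forall_congr' fun j => ?_
  simp only [Units.val_mul, coe_borelMat, Matrix.mul_apply, Fin.sum_univ_two]
  simp [mul_mem_lat_iff d.ne_zero]

lemma bottomOrd_one : bottomOrd (1 : GL (Fin 2) L).1 = 0 := by
  refine eq_of_forall_le_iff fun n => ?_
  rw [le_bottomOrd_iff]
  simp [Fin.forall_fin_two, mem_lat_iff, ord_one]

lemma swapMat_mul_apply (g : GL (Fin 2) L) (i j : Fin 2) :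
    (swapMat L * g).1 i j = g.1 (Equiv.swap 0 1 i) j := by
  rw [Units.val_mul, Matrix.mul_apply, Fin.sum_univ_two, coe_swapMat]
  fin_cases i <;> simp

lemma mul_swapMat_apply (g : GL (Fin 2) L) (i j : Fin 2) :
    (g * swapMat L).1 i j = g.1 i (Equiv.swap 0 1 j) := by
  rw [Units.val_mul, Matrix.mul_apply, Fin.sum_univ_two, coe_swapMat]
  fin_cases j <;> simp

/-- The Iwasawa decomposition. -/
lemma exists_borelMat_mul (g : GL (Fin 2) L) :
    ∃ (a d : Lˣ) (b : L), ∃ k ∈ maxCompact L, g = borelMat a d b * k := by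
  -- If the lower right entry divides the lower left one, an integral column operation clears the
  -- latter. The other case follows after a swap of the columns.
  have key (g : GL (Fin 2) L) (h1 : g.1 1 1 ≠ 0) (h2 : g.1 1 0 ∈ lat L (ord (g.1 1 1))) :
      ∃ (a d : Lˣ) (b : L), ∃ k ∈ maxCompact L, g = borelMat a d b * k := by
    refine ⟨Units.mk0 (g.1.det / g.1 1 1) (div_ne_zero (det_ne_zero g) h1), Units.mk0 _ h1,
      g.1 0 1, lowerMat (g.1 1 0 / g.1 1 1), lowerMat_mem_maxCompact ?_, ?_⟩
    · rw [div_eq_mul_inv, mul_comm, mul_mem_lat_iff (inv_ne_zero h1), ord_inv]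
      simpa using h2
    · ext i j
      fin_cases i <;> fin_cases j <;> simp [coe_borelMat, coe_lowerMat, Matrix.det_fin_two] <;>
        field_simp
      ring
  obtain ⟨j, hj0, hj⟩ := exists_ord_eq_minOrd (exists_bottom_ne_zero g)
  have hmin := (le_minOrd_iff (exists_bottom_ne_zero g)).mp le_rfl
  rw [← hj] at hmin
  fin_cases j
  · obtain ⟨a, d, b, k, hk, h⟩ := key (g * swapMat L) (by simpa [mul_swapMat_apply] using hj0)
      (by simpa [mul_swapMat_apply] using hmin 1)
    refine ⟨a, d, b, k * swapMat L, mul_mem hk swapMat_mem_maxCompact, ?_⟩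
    rw [← mul_assoc, ← h, mul_assoc, swapMat_mul_swapMat, mul_one]
  · exact key g hj0 (hmin 0)

/-- Representatives of `GL₂(L)/GL₂(𝒪)`. -/
def cosetRep (ϖ : Lˣ) (i : (ℤ × ℤ) × LQuot L) : GL (Fin 2) L :=
  borelMat (ϖ ^ i.1.1) (ϖ ^ i.1.2) (((ϖ ^ i.1.1 : Lˣ) : L) * i.2.out)

variable {ϖ : Lˣ} (hϖ : ord (ϖ : L) = 1)

include hϖ

lemma ord_uniformizer_zpow (n : ℤ) : ord ((ϖ ^ n : Lˣ) : L) = n := by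
  rw [ord_zpow, hϖ, mul_one]

lemma cosetRep_inv_mul (i i' : (ℤ × ℤ) × LQuot L) :
    (cosetRep ϖ i)⁻¹ * cosetRep ϖ i' ∈ maxCompact L ↔ i = i' := by
  obtain ⟨⟨a, d⟩, y⟩ := i
  obtain ⟨⟨a', d'⟩, y'⟩ := i'
  simp only [cosetRep, inv_borelMat, borelMat_mul, ← zpow_neg, ← zpow_add, borelMat_mem_maxCompact,
    ord_uniformizer_zpow hϖ, Prod.mk.injEq]
  constructor
  · rintro ⟨h1, h2, h3⟩
    obtain rfl : a = a' := by omega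
    obtain rfl : d = d' := by omega
    refine ⟨⟨rfl, rfl⟩, ?_⟩
    rw [← QuotientAddGroup.out_eq' y, ← QuotientAddGroup.out_eq' y', QuotientAddGroup.eq]
    convert! h3 using 1
    have h4 : ((ϖ ^ (-a) : Lˣ) : L) * ((ϖ ^ a : Lˣ) : L) = 1 := by
      rw [← Units.val_mul, ← zpow_add]
      simp
    have h5 : ((ϖ ^ (-d) : Lˣ) : L) * ((ϖ ^ d : Lˣ) : L) = 1 := by
      rw [← Units.val_mul, ← zpow_add]
      simp
    linear_combination (y.out * ((ϖ ^ (-d) : Lˣ) : L) * ((ϖ ^ d : Lˣ) : L) - y'.out) * h4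
      + y.out * h5
  · rintro ⟨⟨rfl, rfl⟩, rfl⟩
    refine ⟨by omega, by omega, ?_⟩
    convert! zero_mem (lat L 0) using 1
    have h4 : ((ϖ ^ (-a) : Lˣ) : L) * ((ϖ ^ a : Lˣ) : L) = 1 := by
      rw [← Units.val_mul, ← zpow_add]
      simp
    have h5 : ((ϖ ^ (-d) : Lˣ) : L) * ((ϖ ^ d : Lˣ) : L) = 1 := by
      rw [← Units.val_mul, ← zpow_add]
      simp
    linear_combination (y.out - y.out * ((ϖ ^ (-d) : Lˣ) : L) * ((ϖ ^ d : Lˣ) : L)) * h4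
      - y.out * h5

lemma existsUnique_cosetRep (g : GL (Fin 2) L) :
    ∃! i, (cosetRep ϖ i)⁻¹ * g ∈ maxCompact L := by
  have hex : ∃ i, (cosetRep ϖ i)⁻¹ * g ∈ maxCompact L := by
    obtain ⟨a, d, b, k, hk, rfl⟩ := exists_borelMat_mul g
    let α := ord (a : L)
    let δ := ord (d : L)
    let u := a * ϖ ^ (-α)
    let t := d * ϖ ^ (-δ)
    have hu : ord (u : L) = 0 := by
      simp only [u, Units.val_mul]
      rw [ord_mul a.ne_zero (Units.ne_zero _), ord_uniformizer_zpow hϖ]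
      omega
    have ht : ord (t : L) = 0 := by
      simp only [t, Units.val_mul]
      rw [ord_mul d.ne_zero (Units.ne_zero _), ord_uniformizer_zpow hϖ]
      omega
    let y : L := ((ϖ ^ (-α) : Lˣ) : L) * b * (t⁻¹ : Lˣ)
    refine ⟨⟨⟨α, δ⟩, QuotientAddGroup.mk y⟩, ?_⟩
    rw [← mul_assoc]
    refine mul_mem ?_ hk
    simp only [cosetRep, inv_borelMat, borelMat_mul, borelMat_mem_maxCompact]
    refine ⟨?_, ?_, ?_⟩
    · convert hu using 3
      simp [u, mul_comm]
    · convert ht using 3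
      simp [t, mul_comm]
    · have h := neg_mem (mul_mem_lat (out_sub_mem y) ((mem_lat_iff t.ne_zero).mpr ht.ge))
      rw [add_zero] at h
      convert! h using 1
      have h4 : (((ϖ ^ α)⁻¹ : Lˣ) : L) * ((ϖ ^ α : Lˣ) : L) = 1 := Units.inv_mul _
      have h5 : ((t⁻¹ : Lˣ) : L) * t = 1 := by simp
      have h6 : (((ϖ ^ δ)⁻¹ : Lˣ) : L) * d = t := by simp [t, mul_comm]
      have h7 : y = (((ϖ ^ α)⁻¹ : Lˣ) : L) * b * (t⁻¹ : Lˣ) := by simp [y]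
      generalize (QuotientAddGroup.mk y : LQuot L).out = z at *
      rw [h7]
      linear_combination (-z * (((ϖ ^ δ)⁻¹ : Lˣ) : L) * d) * h4 - z * h6 -
        (((ϖ ^ α)⁻¹ : Lˣ) : L) * b * h5
  obtain ⟨i, hi⟩ := hex
  refine ⟨i, hi, fun i' hi' => ?_⟩
  rw [← cosetRep_inv_mul hϖ]
  have := mul_mem hi' (inv_mem hi)
  simpa [mul_assoc] using this

/-- The Cartan decomposition. -/
lemma exists_cartan (g : GL (Fin 2) L) : ∃ k₁ ∈ maxCompact L, ∃ k₂ ∈ maxCompact L,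
    g = k₁ * borelMat (ϖ ^ (ord g.1.det - content g.1)) (ϖ ^ content g.1) 0 * k₂ := by
  -- If the lower right entry has minimal order, it divides all others, so integral row and column
  -- operations clear its row and column. The unit parts of the remaining diagonal are absorbed in
  -- `k₂`.
  have key (g : GL (Fin 2) L) (h0 : g.1 1 1 ≠ 0) (h1 : ord (g.1 1 1) = content g.1) :
      ∃ k₁ ∈ maxCompact L, ∃ k₂ ∈ maxCompact L,
        g = k₁ * borelMat (ϖ ^ (ord g.1.det - content g.1)) (ϖ ^ content g.1) 0 * k₂ := by
    have hle := (le_content_iff g).mp le_rfl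
    have hq (i j : Fin 2) : g.1 i j / g.1 1 1 ∈ lat L 0 := by
      rw [div_eq_mul_inv, mul_comm, mul_mem_lat_iff (inv_ne_zero h0), ord_inv, h1]
      simpa using hle i j
    have hd := div_ne_zero (det_ne_zero g) h0
    have hod : ord (g.1.det / g.1 1 1) = ord g.1.det - content g.1 := by
      rw [div_eq_mul_inv, ord_mul (det_ne_zero g) (inv_ne_zero h0), ord_inv, h1]
      ring
    let a : Lˣ := Units.mk0 _ hd
    let d : Lˣ := Units.mk0 _ h0
    let α := ord g.1.det - content g.1
    let δ := content g.1
    refine ⟨borelMat 1 1 (g.1 0 1 / g.1 1 1), ?_,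
      borelMat (ϖ ^ (-α) * a) (ϖ ^ (-δ) * d) 0 * lowerMat (g.1 1 0 / g.1 1 1), ?_, ?_⟩
    · rw [borelMat_mem_maxCompact]
      simp [ord_one, hq]
    · refine mul_mem ?_ (lowerMat_mem_maxCompact (hq _ _))
      rw [borelMat_mem_maxCompact, Units.val_mul, Units.val_mul,
        ord_mul (Units.ne_zero _) a.ne_zero, ord_mul (Units.ne_zero _) d.ne_zero,
        ord_uniformizer_zpow hϖ, ord_uniformizer_zpow hϖ]
      refine ⟨?_, ?_, zero_mem _⟩
      · simp [a, α, hod]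
      · simp [d, δ, h1]
    · rw [← mul_assoc, borelMat_mul, borelMat_mul]
      have ha : (1 : Lˣ) * ϖ ^ α * (ϖ ^ (-α) * a) = a := by simp
      have hd : (1 : Lˣ) * ϖ ^ δ * (ϖ ^ (-δ) * d) = d := by simp
      rw [ha, hd]
      have hb : ((1 * ϖ ^ α : Lˣ) : L) * 0 + (((1 : Lˣ) : L) * 0 +
          g.1 0 1 / g.1 1 1 * ((ϖ ^ δ : Lˣ) : L)) * ((ϖ ^ (-δ) * d : Lˣ) : L) = g.1 0 1 := by
        have h5 : ((ϖ ^ (-δ) : Lˣ) : L) * ((ϖ ^ δ : Lˣ) : L) = 1 := by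
          rw [← Units.val_mul, ← zpow_add]
          simp
        have h6 : g.1 0 1 / g.1 1 1 * (d : L) = g.1 0 1 := div_mul_cancel₀ _ h0
        rw [Units.val_mul (ϖ ^ (-δ))]
        linear_combination (g.1 0 1 / g.1 1 1 * d) * h5 + h6
      rw [hb]
      ext i j
      fin_cases i <;> fin_cases j <;>
        simp [coe_borelMat, coe_lowerMat, Matrix.det_fin_two, a, d] <;> field_simp
      ring
  -- An entry of minimal order is moved to the lower right corner by Weyl elements on either side.
  obtain ⟨⟨i, j⟩, h0, h1⟩ := exists_ord_eq_minOrd (exists_entry_ne_zero g)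
  have hw := swapMat_mem_maxCompact (L := L)
  have hww := swapMat_mul_swapMat (L := L)
  change ord (g.1 i j) = content g.1 at h1
  have hL (g : GL (Fin 2) L) (j : Fin 2) : (swapMat L * g).1 1 j = g.1 0 j := by
    simp [swapMat_mul_apply]
  have hR (g : GL (Fin 2) L) (i : Fin 2) : (g * swapMat L).1 i 1 = g.1 i 0 := by
    simp [mul_swapMat_apply]
  have key1 (g : GL (Fin 2) L) (i : Fin 2) (h0 : g.1 i 1 ≠ 0) (h1 : ord (g.1 i 1) = content g.1) :
      ∃ k₁ ∈ maxCompact L, ∃ k₂ ∈ maxCompact L,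
        g = k₁ * borelMat (ϖ ^ (ord g.1.det - content g.1)) (ϖ ^ content g.1) 0 * k₂ := by
    fin_cases i
    · obtain ⟨k₁, hk₁, k₂, hk₂, h⟩ := key (swapMat L * g) (by rwa [hL])
        (by rwa [hL, content_mul_left hw])
      rw [content_mul_left hw, ord_det_mul_left hw] at h
      refine ⟨swapMat L * k₁, mul_mem hw hk₁, k₂, hk₂, ?_⟩
      rw [mul_assoc, mul_assoc, ← mul_assoc k₁, ← h, ← mul_assoc, hww, one_mul]
    · exact key g h0 h1
  fin_cases j
  · obtain ⟨k₁, hk₁, k₂, hk₂, h⟩ := key1 (g * swapMat L) i (by rwa [hR])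
      (by rwa [hR, content_mul_right hw])
    rw [content_mul_right hw, ord_det_mul_right hw] at h
    refine ⟨k₁, hk₁, k₂ * swapMat L, mul_mem hk₂ hw, ?_⟩
    rw [← mul_assoc, ← h, mul_assoc, hww, mul_one]
  · exact key1 g i h0 h1

end Decompositions

/-! ### Spherical functions as finitely supported functions of two integers -/

section Coefficients

variable {L : Type*} [Field L] [ValuativeRel L] [TopologicalSpace L]
  [IsNonarchimedeanLocalField L]

lemma content_borelMat {a d : Lˣ} {b : L} {n : ℤ} :
    n ≤ content (borelMat a d b).1 ↔ n ≤ ord (a : L) ∧ n ≤ ord (d : L) ∧ b ∈ lat L n := by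
  rw [le_content_iff]
  simp only [coe_borelMat, Fin.forall_fin_two]
  simp only [Matrix.of_apply, Matrix.cons_val', Matrix.cons_val_zero, Matrix.cons_val_one,
    Matrix.cons_val_fin_one, mem_lat_iff a.ne_zero, mem_lat_iff d.ne_zero, zero_mem, true_and]
  tauto

/-- The value of a function on `GL₂(L)` at `diag(ϖ^(m+l), ϖ^m)`. -/
def coef (ϖ : Lˣ) (f : GL (Fin 2) L → ℂ) (l : ℕ) (m : ℤ) : ℂ :=
  f (borelMat (ϖ ^ (m + l)) (ϖ ^ m) 0)

/-- The function on `GL₂(L)`, invariant under `GL₂(𝒪)` on both sides, with given values. -/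
def ofCoef (c : ℕ → ℤ → ℂ) (g : GL (Fin 2) L) : ℂ :=
  c (ord g.1.det - 2 * content g.1).toNat (content g.1)

lemma ofCoef_bi_invariant (c : ℕ → ℤ → ℂ) {k₁ k₂ : GL (Fin 2) L} (h₁ : k₁ ∈ maxCompact L)
    (h₂ : k₂ ∈ maxCompact L) (g : GL (Fin 2) L) : ofCoef c (k₁ * g * k₂) = ofCoef c g := by
  simp only [ofCoef, content_mul_left h₁, content_mul_right h₂, ord_det_mul_left h₁,
    ord_det_mul_right h₂]

variable {ϖ : Lˣ} (hϖ : ord (ϖ : L) = 1)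

include hϖ

lemma content_diag (l : ℕ) (m : ℤ) : content (borelMat (ϖ ^ (m + l)) (ϖ ^ m) 0).1 = m := by
  refine eq_of_forall_le_iff fun n => ?_
  rw [content_borelMat, ord_uniformizer_zpow hϖ, ord_uniformizer_zpow hϖ]
  simp
  omega

lemma ord_det_borelMat_zpow (a d : ℤ) (b : L) : ord (borelMat (ϖ ^ a) (ϖ ^ d) b).1.det = a + d := by
  rw [det_borelMat, ord_mul (Units.ne_zero _) (Units.ne_zero _), ord_uniformizer_zpow hϖ,
    ord_uniformizer_zpow hϖ]

lemma coef_ofCoef (c : ℕ → ℤ → ℂ) : coef ϖ (ofCoef c) = c := by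
  funext l m
  rw [coef, ofCoef, content_diag hϖ, ord_det_borelMat_zpow hϖ]
  congr
  omega

lemma apply_eq_ofCoef {f : GL (Fin 2) L → ℂ}
    (hf : ∀ k₁ ∈ maxCompact L, ∀ k₂ ∈ maxCompact L, ∀ g, f (k₁ * g * k₂) = f g)
    (g : GL (Fin 2) L) : f g = ofCoef (coef ϖ f) g := by
  obtain ⟨k₁, h₁, k₂, h₂, h⟩ := exists_cartan hϖ g
  have h0 := two_content_le_ord_det g
  conv_lhs => rw [h, hf k₁ h₁ k₂ h₂]
  rw [ofCoef, coef]
  congr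
  omega

/-- The entry `ϖ^a y` has order `a - den y` when `y` is not integral; when `y` is integral the
denominator is `0` and the diagonal entry `ϖ^a` accounts for the first term. -/
lemma content_cosetRep (i : (ℤ × ℤ) × LQuot L) :
    content (cosetRep ϖ i).1 = min (i.1.1 - denQ i.2) i.1.2 := by
  refine eq_of_forall_le_iff fun n => ?_
  rw [cosetRep, content_borelMat, ord_uniformizer_zpow hϖ, ord_uniformizer_zpow hϖ,
    mul_mem_lat_iff (Units.ne_zero _), ord_uniformizer_zpow hϖ, le_min_iff, denQ]
  have key : (n ≤ i.1.1 ∧ i.2.out ∈ lat L (n - i.1.1)) ↔ n ≤ i.1.1 - den i.2.out := by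
    constructor
    · rintro ⟨h1, h2⟩
      have h3 : den i.2.out ≤ (i.1.1 - n).toNat := by
        rw [den_le_iff]
        convert h2 using 2
        omega
      omega
    · intro h
      refine ⟨by omega, ?_⟩
      have h3 : den i.2.out ≤ (i.1.1 - n).toNat := by omega
      rw [den_le_iff] at h3
      convert h3 using 2
      omega
  rw [← key]
  tauto

lemma ord_det_cosetRep (i : (ℤ × ℤ) × LQuot L) :
    ord (cosetRep ϖ i).1.det = i.1.1 + i.1.2 := ord_det_borelMat_zpow hϖ _ _ _

lemma ofCoef_cosetRep (c : ℕ → ℤ → ℂ) (i : (ℤ × ℤ) × LQuot L) :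
    ofCoef c (cosetRep ϖ i) = c (i.1.1 + i.1.2 - 2 * min (i.1.1 - denQ i.2) i.1.2).toNat
      (min (i.1.1 - denQ i.2) i.1.2) := by
  rw [ofCoef, content_cosetRep hϖ, ord_det_cosetRep hϖ]

/-- Distinct pairs give diagonal matrices in distinct cosets of `K`, and only finitely many cosets
meet the compact support. -/
lemma finite_coef {f : GL (Fin 2) L → ℂ} (hf : f ∈ sphericalHecke L) :
    {p : ℕ × ℤ | coef ϖ f p.1 p.2 ≠ 0}.Finite := by
  refine (finite_cosets_of_compact (maxCompact L) isOpen_maxCompact hf.1.2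
    (fun p : ℕ × ℤ => borelMat (ϖ ^ (p.2 + p.1)) (ϖ ^ p.2) 0) ?_).subset
    fun p hp => subset_tsupport f hp
  rintro ⟨l, m⟩ ⟨l', m'⟩ h
  rw [inv_borelMat, borelMat_mul, borelMat_mem_maxCompact, ← zpow_neg, ← zpow_neg, ← zpow_add,
    ← zpow_add, ord_uniformizer_zpow hϖ, ord_uniformizer_zpow hϖ] at h
  obtain ⟨h1, h2, -⟩ := h
  simp only [Prod.mk.injEq]
  simp only at h1 h2
  omega

lemma finite_cosetRep {f : GL (Fin 2) L → ℂ} (hf : f ∈ sphericalHecke L) :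
    {i | f (cosetRep ϖ i) ≠ 0}.Finite :=
  (finite_cosets_of_compact (maxCompact L) isOpen_maxCompact hf.1.2 (cosetRep ϖ)
    (fun i i' h => (cosetRep_inv_mul hϖ i i').mp h)).subset fun _ hi => subset_tsupport f hi

lemma ofCoef_mem {c : ℕ → ℤ → ℂ} (hc : {p : ℕ × ℤ | c p.1 p.2 ≠ 0}.Finite) :
    ofCoef c ∈ sphericalHecke L := by
  refine ⟨⟨?_, ?_⟩, fun k₁ h₁ k₂ h₂ g => ofCoef_bi_invariant c h₁ h₂ g⟩
  · refine (IsLocallyConstant.iff_exists_open _).mpr fun x => ?_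
    refine ⟨(fun y => x⁻¹ * y) ⁻¹' (maxCompact L : Set (GL (Fin 2) L)),
      isOpen_maxCompact.preimage (continuous_const_mul _), by simp [one_mem], fun y hy => ?_⟩
    have := ofCoef_bi_invariant c (one_mem (maxCompact L)) hy x
    simpa using this
  · let C : Set (GL (Fin 2) L) := ⋃ p ∈ hc.toFinset,
      (fun k : GL (Fin 2) L × GL (Fin 2) L =>
        k.1 * borelMat (ϖ ^ (p.2 + p.1)) (ϖ ^ p.2) 0 * k.2) ''
          ((maxCompact L : Set (GL (Fin 2) L)) ×ˢ (maxCompact L : Set (GL (Fin 2) L)))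
    have hC : IsCompact C := by
      refine hc.toFinset.isCompact_biUnion fun p _ => ?_
      refine (isCompact_maxCompact.prod isCompact_maxCompact).image ?_
      fun_prop
    refine HasCompactSupport.intro hC fun g hg => ?_
    by_contra hne
    refine hg ?_
    obtain ⟨k₁, h₁, k₂, h₂, h⟩ := exists_cartan hϖ g
    have h0 := two_content_le_ord_det g
    refine Set.mem_iUnion₂.mpr ⟨⟨(ord g.1.det - 2 * content g.1).toNat, content g.1⟩,
      hc.mem_toFinset.mpr hne, ⟨k₁, k₂⟩, ⟨h₁, h₂⟩, ?_⟩
    conv_rhs => rw [h]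
    rw [show ord g.1.det - content g.1 =
      content g.1 + ((ord g.1.det - 2 * content g.1).toNat : ℕ) by omega]

end Coefficients

lemma exists_bound_of_finite {c : ℕ → ℤ → ℂ} (hc : {p : ℕ × ℤ | c p.1 p.2 ≠ 0}.Finite) :
    ∃ B : ℕ, ∀ l, B ≤ l → ∀ m, c l m = 0 := by
  obtain ⟨B, hB⟩ := (hc.image Prod.fst).bddAbove
  refine ⟨B + 1, fun l hl m => ?_⟩
  by_contra h
  have := hB ⟨(l, m), h, rfl⟩
  simp only at this
  omega

/-! ### Traces on principal series and the Satake transform -/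

section Satake

variable {L : Type*} [Field L] [ValuativeRel L] [TopologicalSpace L]
  [IsNonarchimedeanLocalField L]

/-- The coefficients of the Satake transform, up to the square root of the modulus character, of
the function with the values `c`, where `c l m = 0` for `l ≥ B`. -/
def satakeCoef (q : ℂ) (B : ℕ) (c : ℕ → ℤ → ℂ) (a d : ℤ) : ℂ :=
  ∑ k ∈ Finset.range B, denCount q k * c (a + d - 2 * min (a - k) d).toNat (min (a - k) d)

/-- The spherical vector of an unramified principal series. -/
def sphericalVec (α β : ℂˣ) (g : GL (Fin 2) L) : ℂ :=
  (α ^ (ord g.1.det - bottomOrd g.1) : ℂˣ) * (β ^ bottomOrd g.1 : ℂˣ) *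
    (Real.sqrt ((Nat.card 𝓀[L] : ℝ) ^ (2 * bottomOrd g.1 - ord g.1.det)) : ℂ)

variable {ϖ : Lˣ} (hϖ : ord (ϖ : L) = 1)

include hϖ

lemma apply_eq_zpow_ord {M : Type*} [Group M] {χ : Lˣ →* M}
    (hχ : ∀ u : Lˣ, valuation L (u : L) = 1 → χ u = 1) (u : Lˣ) : χ u = χ ϖ ^ ord (u : L) := by
  have h : χ (u * ϖ ^ (-ord (u : L))) = 1 := by
    refine hχ _ ?_
    rw [← ord_eq_zero_iff_valuation (Units.ne_zero _), Units.val_mul,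
      ord_mul (Units.ne_zero _) (Units.ne_zero _), ord_uniformizer_zpow hϖ]
    ring
  rw [map_mul, map_zpow, zpow_neg, mul_inv_eq_one] at h
  exact h

lemma sphericalVec_mem {χ₁ χ₂ : Lˣ →* ℂˣ} (h₁ : ∀ u : Lˣ, valuation L (u : L) = 1 → χ₁ u = 1)
    (h₂ : ∀ u : Lˣ, valuation L (u : L) = 1 → χ₂ u = 1) :
    sphericalVec (χ₁ ϖ) (χ₂ ϖ) ∈ principalSeries χ₁ χ₂ := by
  refine ⟨fun a d b g => ?_, ⟨maxCompact L, isOpen_maxCompact⟩, fun u hu g => ?_⟩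
  · have hq : (0 : ℝ) < Nat.card 𝓀[L] := by exact_mod_cast Nat.card_pos
    rw [sphericalVec, sphericalVec, bottomOrd_borelMat_mul, ord_det_mul, det_borelMat,
      ord_mul a.ne_zero d.ne_zero, apply_eq_zpow_ord hϖ h₁ a, apply_eq_zpow_ord hϖ h₂ d,
      normAbs_eq (div_ne_zero a.ne_zero d.ne_zero), div_eq_mul_inv,
      ord_mul a.ne_zero (inv_ne_zero d.ne_zero), ord_inv]
    set α := χ₁ ϖ
    set β := χ₂ ϖ
    set x := ord (a : L)
    set y := ord (d : L)
    set D := ord g.1.det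
    set b := bottomOrd g.1
    rw [show x + y + D - (y + b) = x + (D - b) by ring, zpow_add, zpow_add,
      show 2 * (y + b) - (x + y + D) = -(x + -y) + (2 * b - D) by ring, zpow_add₀ hq.ne',
      Real.sqrt_mul (by positivity)]
    push_cast
    ring
  · rw [sphericalVec, sphericalVec, bottomOrd_mul_right hu, ord_det_mul_right hu]

lemma sphericalVec_cosetRep (α β : ℂˣ) (i : (ℤ × ℤ) × LQuot L) :
    sphericalVec α β (cosetRep ϖ i) = (α ^ i.1.1 : ℂˣ) * (β ^ i.1.2 : ℂˣ) *
      (Real.sqrt ((Nat.card 𝓀[L] : ℝ) ^ (i.1.2 - i.1.1)) : ℂ) := by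
  have h : bottomOrd (cosetRep ϖ i).1 = i.1.2 := by
    have := bottomOrd_borelMat_mul (ϖ ^ i.1.1) (ϖ ^ i.1.2) (((ϖ ^ i.1.1 : Lˣ) : L) * i.2.out) 1
    rwa [mul_one, bottomOrd_one, add_zero, ord_uniformizer_zpow hϖ] at this
  rw [sphericalVec, h, ord_det_cosetRep hϖ, add_sub_cancel_right,
    show 2 * i.1.2 - (i.1.1 + i.1.2) = i.1.2 - i.1.1 by ring]

omit hϖ in
lemma sphericalVec_one (α β : ℂˣ) : sphericalVec α β (1 : GL (Fin 2) L) = 1 := by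
  rw [sphericalVec, bottomOrd_one, Units.val_one, Matrix.det_one, ord_one]
  simp

omit hϖ in
-- By the Iwasawa decomposition a `K`-invariant vector is determined by its value at `1`.
lemma invariant_eq_zero {χ₁ χ₂ : Lˣ →* ℂˣ} {φ : GL (Fin 2) L → ℂ} (hφ : φ ∈ principalSeries χ₁ χ₂)
    (hK : ∀ k ∈ maxCompact L, ∀ g, φ (g * k) = φ g) (h1 : φ 1 = 0) : φ = 0 := by
  funext g
  obtain ⟨a, d, b, k, hk, rfl⟩ := exists_borelMat_mul g
  rw [hK k hk, ← mul_one (borelMat a d b), hφ.1, h1, mul_zero]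
  rfl

omit hϖ in
-- A diagonal matrix of units lies both in the Borel subgroup and in `K`; comparing the two actions
-- at `1` forces the value there to vanish as soon as the character is nontrivial on such a matrix.
lemma invariant_eq_zero_of_ramified {χ₁ χ₂ : Lˣ →* ℂˣ} {φ : GL (Fin 2) L → ℂ}
    (hφ : φ ∈ principalSeries χ₁ χ₂) (hK : ∀ k ∈ maxCompact L, ∀ g, φ (g * k) = φ g)
    (hr : ¬ ((∀ u : Lˣ, valuation L (u : L) = 1 → χ₁ u = 1) ∧
      ∀ u : Lˣ, valuation L (u : L) = 1 → χ₂ u = 1)) : φ = 0 := by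
  refine invariant_eq_zero hφ hK ?_
  have key (a d : Lˣ) (ha : valuation L (a : L) = 1) (hd : valuation L (d : L) = 1)
      (hne : (χ₁ a * χ₂ d : ℂ) ≠ 1) : φ 1 = 0 := by
    rw [← ord_eq_zero_iff_valuation a.ne_zero] at ha
    rw [← ord_eq_zero_iff_valuation d.ne_zero] at hd
    have hb : borelMat a d 0 ∈ maxCompact L :=
      borelMat_mem_maxCompact.mpr ⟨ha, hd, zero_mem _⟩
    have h1 := hφ.1 a d 0 1
    have h2 := hK _ hb 1
    rw [one_mul] at h2
    rw [mul_one, h2, normAbs_eq (div_ne_zero a.ne_zero d.ne_zero), div_eq_mul_inv,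
      ord_mul a.ne_zero (inv_ne_zero d.ne_zero), ord_inv, ha, hd] at h1
    simp only [neg_zero, add_zero, zpow_zero, Real.sqrt_one, Complex.ofReal_one, mul_one] at h1
    by_contra h0
    exact hne (mul_right_cancel₀ h0 (by rw [one_mul]; exact h1.symm))
  rw [not_and_or] at hr
  push Not at hr
  rcases hr with ⟨u, hu, h⟩ | ⟨u, hu, h⟩
  · exact key u 1 hu (by simp) (by simpa using h)
  · exact key 1 u (by simp) hu (by simpa using h)

section Trace

variable [MeasurableSpace (GL (Fin 2) L)] [BorelSpace (GL (Fin 2) L)]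
  (μ : Measure (GL (Fin 2) L)) [μ.IsHaarMeasure]

omit hϖ in
lemma heckeOp_invariant (χ₁ χ₂ : Lˣ →* ℂˣ) (f : sphericalHecke L) (φ : principalSeries χ₁ χ₂) :
    ∀ k ∈ maxCompact L, ∀ g, (heckeOp μ χ₁ χ₂ f φ).1 (g * k) = (heckeOp μ χ₁ χ₂ f φ).1 g := by
  intro u hu x
  change ∫ g, f.1 g * φ.1 (x * u * g) ∂μ = ∫ g, f.1 g * φ.1 (x * g) ∂μ
  rw [← integral_mul_left_eq_self (fun g => f.1 g * φ.1 (x * g)) u]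
  refine integral_congr_ae (Filter.Eventually.of_forall fun g => ?_)
  have := f.2.2 u hu 1 (one_mem _) g
  simp only [mul_one] at this
  simp only [this, mul_assoc]

omit hϖ in
-- The trace is that of the restriction to the range, which is the zero map when `T² = 0`.
lemma finiteRankTrace_eq_zero {V : Type*} [AddCommGroup V] [Module ℂ V] {T : V →ₗ[ℂ] V}
    (h : ∀ x, T (T x) = 0) : finiteRankTrace T = 0 := by
  have h0 : T.rangeRestrict ∘ₗ (LinearMap.range T).subtype = 0 := by
    ext ⟨_, y, rfl⟩
    simp [h]
  rw [finiteRankTrace, h0, map_zero]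

omit hϖ in
lemma trace_eq_zero_of_ramified {χ₁ χ₂ : Lˣ →* ℂˣ} (f : sphericalHecke L)
    (hr : ¬ ((∀ u : Lˣ, valuation L (u : L) = 1 → χ₁ u = 1) ∧
      ∀ u : Lˣ, valuation L (u : L) = 1 → χ₂ u = 1)) :
    finiteRankTrace (heckeOp μ χ₁ χ₂ f) = 0 := by
  have h : heckeOp μ χ₁ χ₂ f = 0 := by
    ext1 φ
    exact Subtype.ext (invariant_eq_zero_of_ramified (heckeOp μ χ₁ χ₂ f φ).2
      (heckeOp_invariant μ χ₁ χ₂ f φ) hr)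
  rw [h]
  exact finiteRankTrace_eq_zero fun _ => rfl

omit hϖ in
/-- An endomorphism with values in a line has the eigenvalue on that line as its trace. -/
lemma finiteRankTrace_eq_of_range_le_span {V : Type*} [AddCommGroup V] [Module ℂ V]
    (T : V →ₗ[ℂ] V) (v : V) (hv : v ≠ 0) (c : ℂ) (hT : T v = c • v)
    (hr : LinearMap.range T ≤ Submodule.span ℂ {v}) : finiteRankTrace T = c := by
  let W := Submodule.span ℂ {v}
  have hW : ∀ x ∈ W, T x ∈ W := fun x _ => hr (LinearMap.mem_range_self T x)
  let S : W →ₗ[ℂ] W := T.restrict hW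
  have hS : S = c • LinearMap.id := by
    ext ⟨x, hx⟩
    obtain ⟨r, rfl⟩ := Submodule.mem_span_singleton.mp hx
    simp [S, LinearMap.restrict_apply, hT, smul_comm r c]
  have hfr : Module.finrank ℂ W = 1 := finrank_span_singleton hv
  have htr : LinearMap.trace ℂ W S = c := by
    rw [hS, map_smul, LinearMap.trace_id, hfr]
    simp
  -- If `c = 0` the range need not be the whole line, but then `T² = 0`. If `c ≠ 0` the range is the
  -- line and the trace is computed there.
  by_cases hc : c = 0
  · have hT0 : ∀ x, T (T x) = 0 := by
      intro x
      obtain ⟨r, hr'⟩ := Submodule.mem_span_singleton.mp (hr (LinearMap.mem_range_self T x))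
      rw [← hr', map_smul, hT, hc, zero_smul, smul_zero]
    rw [hc]
    exact finiteRankTrace_eq_zero hT0
  · have hrange : LinearMap.range T = W := by
      refine le_antisymm hr ?_
      rw [Submodule.span_singleton_le_iff_mem]
      exact ⟨c⁻¹ • v, by rw [map_smul, hT, smul_smul, inv_mul_cancel₀ hc, one_smul]⟩
    rw [finiteRankTrace, ← htr]
    have e := LinearMap.trace_conj' (R := ℂ) S (LinearEquiv.ofEq _ _ hrange).symm
    rw [← e]
    congr 1

/-- The operator has values in the line of `K`-invariant vectors, so its trace is its eigenvalue on
the spherical vector, read off at `1` where that vector has the value `1`. -/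
lemma trace_eq_integral {χ₁ χ₂ : Lˣ →* ℂˣ} (f : sphericalHecke L)
    (h₁ : ∀ u : Lˣ, valuation L (u : L) = 1 → χ₁ u = 1)
    (h₂ : ∀ u : Lˣ, valuation L (u : L) = 1 → χ₂ u = 1) :
    finiteRankTrace (heckeOp μ χ₁ χ₂ f) =
      ∫ g, f.1 g * sphericalVec (χ₁ ϖ) (χ₂ ϖ) g ∂μ := by
  let φ₀ : principalSeries χ₁ χ₂ := ⟨_, sphericalVec_mem hϖ h₁ h₂⟩
  have hφ₀ : φ₀.1 1 = 1 := sphericalVec_one _ _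
  have hφK : ∀ k ∈ maxCompact L, ∀ g, φ₀.1 (g * k) = φ₀.1 g := fun k hk g => by
    simp only [φ₀, sphericalVec, bottomOrd_mul_right hk, ord_det_mul_right hk]
  have key (φ : principalSeries χ₁ χ₂) (h : ∀ k ∈ maxCompact L, ∀ g, φ.1 (g * k) = φ.1 g) :
      φ = φ.1 1 • φ₀ := by
    rw [← sub_eq_zero]
    refine Subtype.ext (invariant_eq_zero (φ - φ.1 1 • φ₀).2 (fun k hk g => ?_) ?_)
    · simp [h k hk, hφK k hk]
    · simp [hφ₀]
  refine finiteRankTrace_eq_of_range_le_span _ φ₀ ?_ _ ?_ ?_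
  · intro h
    rw [h] at hφ₀
    simp at hφ₀
  · rw [key _ (heckeOp_invariant μ χ₁ χ₂ f φ₀)]
    congr 1
    change ∫ g, f.1 g * φ₀.1 (1 * g) ∂μ = _
    simp only [one_mul]
    rfl
  · rintro _ ⟨φ, rfl⟩
    rw [key _ (heckeOp_invariant μ χ₁ χ₂ f φ)]
    exact Submodule.smul_mem _ _ (Submodule.mem_span_singleton_self _)

/-- The integral is a sum over `cosetRep`; for fixed torus exponents the spherical vector is
constant, and the inner sum over `L/𝒪` is `satakeCoef`. -/
lemma hasSum_trace {χ₁ χ₂ : Lˣ →* ℂˣ} (f : sphericalHecke L)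
    (h₁ : ∀ u : Lˣ, valuation L (u : L) = 1 → χ₁ u = 1)
    (h₂ : ∀ u : Lˣ, valuation L (u : L) = 1 → χ₂ u = 1)
    {B : ℕ} (hB : ∀ l, B ≤ l → ∀ m, coef ϖ f.1 l m = 0) :
    HasSum (fun p : ℤ × ℤ => μ.real (maxCompact L) *
      (satakeCoef (Nat.card 𝓀[L]) B (coef ϖ f.1) p.1 p.2 *
      ((χ₁ ϖ ^ p.1 : ℂˣ) * (χ₂ ϖ ^ p.2 : ℂˣ) *
      (Real.sqrt ((Nat.card 𝓀[L] : ℝ) ^ (p.2 - p.1)) : ℂ))))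
    (finiteRankTrace (heckeOp μ χ₁ χ₂ f)) := by
  have hfin : {i | f.1 (cosetRep ϖ i) * sphericalVec (χ₁ ϖ) (χ₂ ϖ) (cosetRep ϖ i) ≠ 0}.Finite :=
    (finite_cosetRep hϖ f.2).subset fun i hi => left_ne_zero_of_mul hi
  rw [trace_eq_integral hϖ μ f h₁ h₂, integral_eq_tsum_cosets μ (maxCompact L) isOpen_maxCompact
    isCompact_maxCompact.measure_lt_top.ne (cosetRep ϖ) (existsUnique_cosetRep hϖ) _ ?_ hfin]
  · refine HasSum.mul_left _ ?_
    refine (summable_of_hasFiniteSupport hfin).hasSum.prod_fiberwise fun p => ?_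
    simp only [sphericalVec_cosetRep hϖ]
    refine HasSum.mul_right _ ?_
    -- The first index is `k + |a - k - d|`, hence at least `k`, so the bound `B` on `l` also
    -- truncates the sum over denominators.
    have h := hasSum_denQ (L := L)
      (fun k => coef ϖ f.1 (p.1 + p.2 - 2 * min (p.1 - k) p.2).toNat (min (p.1 - k) p.2)) B
      (fun k hk => hB _ (by omega) _)
    simp only [apply_eq_ofCoef hϖ f.2.2, ofCoef_cosetRep hϖ]
    exact h
  · intro g k hk
    have h := f.2.2 1 (one_mem _) k hk g
    rw [one_mul] at h
    rw [h, sphericalVec, sphericalVec, bottomOrd_mul_right hk, ord_det_mul_right hk]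

end Trace

end Satake

/-! ### Ray sums, base change of coefficients and the difference relation -/

section Combinatorics

/-- `c l m = 0` for `l ≥ B`. -/
def BoundedBy (B : ℕ) (c : ℕ → ℤ → ℂ) : Prop := ∀ l, B ≤ l → ∀ m, c l m = 0

lemma BoundedBy.mono {B B' : ℕ} {c : ℕ → ℤ → ℂ} (hc : BoundedBy B c) (h : B ≤ B') :
    BoundedBy B' c := fun l hl m => hc l (h.trans hl) m

lemma sum_range_eq_of_zero {B B' : ℕ} {F : ℕ → ℂ} (h : ∀ k, B ≤ k → F k = 0) (hB : B ≤ B') :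
    ∑ k ∈ Finset.range B, F k = ∑ k ∈ Finset.range B', F k :=
  Finset.sum_subset (by simpa using hB) fun k _ hk => h k (by simpa using hk)

lemma sum_range_eq_shift {B : ℕ} {F : ℕ → ℂ} (h : ∀ k, B ≤ k → F k = 0) :
    ∑ k ∈ Finset.range B, F k = F 0 + ∑ k ∈ Finset.range B, F (k + 1) := by
  rw [sum_range_eq_of_zero h (Nat.le_succ B), Finset.sum_range_succ']
  ring

lemma sum_range_eq_even_add_odd {B : ℕ} {F : ℕ → ℂ} (h : ∀ k, B ≤ k → F k = 0) :
    ∑ k ∈ Finset.range B, F k = ∑ r ∈ Finset.range B, (F (2 * r) + F (2 * r + 1)) := by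
  rw [sum_range_eq_of_zero h (by omega : B ≤ 2 * B)]
  have key (n : ℕ) : ∑ k ∈ Finset.range (2 * n), F k =
      ∑ r ∈ Finset.range n, (F (2 * r) + F (2 * r + 1)) := by
    induction n with
    | zero => simp
    | succ n ih =>
      rw [show 2 * (n + 1) = 2 * n + 1 + 1 by ring, Finset.sum_range_succ, Finset.sum_range_succ,
        Finset.sum_range_succ, ih]
      ring
  exact key B

/-- Iterating moves the index along its ray until `l ≥ B`, where the function vanishes. -/
lemma eq_zero_of_ray {B : ℕ} {X : ℕ → ℤ → ℂ} (hX : BoundedBy B X) (z : ℂ)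
    (h : ∀ l m, X l m = z * X (l + 2) (m - 1)) : X = 0 := by
  have key (n : ℕ) : ∀ l m, X l m = z ^ n * X (l + 2 * n) (m - n) := by
    induction n with
    | zero => simp
    | succ n ih =>
      intro l m
      rw [ih, h, pow_succ, show l + 2 * n + 2 = l + 2 * (n + 1) by ring,
        show m - n - 1 = m - (n + 1 : ℕ) by push_cast; ring]
      ring
  funext l m
  rw [key B, hX _ (by omega), mul_zero]
  rfl

lemma eq_of_ray {B : ℕ} {X Y : ℕ → ℤ → ℂ} (hX : BoundedBy B X) (hY : BoundedBy B Y) (z : ℂ)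
    (h : ∀ l m, X l m - z * X (l + 2) (m - 1) = Y l m - z * Y (l + 2) (m - 1)) : X = Y := by
  have h0 : X - Y = 0 := by
    refine eq_zero_of_ray (B := B) (fun l hl m => ?_) z fun l m => ?_
    · simp [hX l hl, hY l hl]
    · simp only [Pi.sub_apply]
      linear_combination h l m
  exact sub_eq_zero.mp h0

/-- The sum of the values of `c` along a ray, weighted with the numbers `denCount q k`. -/
def raySum (q : ℂ) (B : ℕ) (c : ℕ → ℤ → ℂ) (l : ℕ) (m : ℤ) : ℂ :=
  ∑ k ∈ Finset.range B, denCount q k * c (l + 2 * k) (m - k)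

lemma raySum_boundedBy {q : ℂ} {B : ℕ} {c : ℕ → ℤ → ℂ} (hc : BoundedBy B c) :
    BoundedBy B (raySum q B c) := fun l hl m =>
  Finset.sum_eq_zero fun k _ => by rw [hc _ (by omega), mul_zero]

/-- The difference `denCount q (k+1) - q * denCount q k` is `-1` for `k = 0` and vanishes for `k ≥
1`, so only two terms survive. -/
lemma raySum_sub {q : ℂ} {B : ℕ} {c : ℕ → ℤ → ℂ} (hc : BoundedBy B c) (l : ℕ) (m : ℤ) :
    raySum q B c l m - q * raySum q B c (l + 2) (m - 1) = c l m - c (l + 2) (m - 1) := by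
  have h1 : raySum q B c l m =
      c l m + ∑ k ∈ Finset.range B, denCount q (k + 1) * c (l + 2 * (k + 1)) (m - (k + 1 : ℕ)) := by
    rw [raySum, sum_range_eq_shift fun k hk => by rw [hc _ (by omega), mul_zero]]
    simp [denCount]
  have h2 : (∑ k ∈ Finset.range B, denCount q (k + 1) * c (l + 2 * (k + 1)) (m - (k + 1 : ℕ))) -
      q * raySum q B c (l + 2) (m - 1) =
      ∑ k ∈ Finset.range B, (denCount q (k + 1) - q * denCount q k) *
        c (l + 2 * (k + 1)) (m - (k + 1 : ℕ)) := by
    rw [raySum, Finset.mul_sum, ← Finset.sum_sub_distrib]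
    refine Finset.sum_congr rfl fun k _ => ?_
    rw [show l + 2 + 2 * k = l + 2 * (k + 1) by ring,
      show m - 1 - k = m - (k + 1 : ℕ) by push_cast; ring]
    ring
  have h3 : ∑ k ∈ Finset.range B, (denCount q (k + 1) - q * denCount q k) *
        c (l + 2 * (k + 1)) (m - (k + 1 : ℕ)) = -c (l + 2) (m - 1) := by
    rw [sum_range_eq_shift fun k hk => by rw [hc _ (by omega), mul_zero],
      Finset.sum_eq_zero (s := Finset.range B), add_zero]
    · simp [denCount]
    · intro k _
      simp only [denCount]
      ring
  rw [h1, add_sub_assoc, h2, h3]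
  ring

lemma sum_denCount (q : ℂ) (n : ℕ) : ∑ k ∈ Finset.range (n + 1), denCount q k = q ^ n := by
  induction n with
  | zero => simp [denCount]
  | succ n ih => rw [Finset.sum_range_succ, ih, denCount]; ring

lemma satakeCoef_of_le {q : ℂ} {B : ℕ} {c : ℕ → ℤ → ℂ} {a d : ℤ} (h : a ≤ d) :
    satakeCoef q B c a d = raySum q B c (d - a).toNat a := by
  refine Finset.sum_congr rfl fun k _ => ?_
  rw [min_eq_left (by omega)]
  congr 2
  omega

/-- This is the Weyl symmetry of the Satake transform, up to the modulus. With `n = a - d`, the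
denominators `k ≤ n` all give the same value of `c`, with total weight `q^n`, and beyond them
`denCount q (n+k+1) = q^n * denCount q (k+1)`. -/
lemma satakeCoef_of_ge {q : ℂ} {B : ℕ} {c : ℕ → ℤ → ℂ} (hc : BoundedBy B c) {a d : ℤ}
    (h : d ≤ a) : satakeCoef q B c a d = q ^ (a - d).toNat * raySum q B c (a - d).toNat d := by
  obtain ⟨n, rfl⟩ : ∃ n : ℕ, a = d + n := ⟨(a - d).toNat, by omega⟩
  rw [show (d + n - d).toNat = n by omega, satakeCoef,
    sum_range_eq_of_zero (B' := n + 1 + B)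
      (fun k hk => by rw [hc _ (by omega), mul_zero]) (by omega),
    Finset.sum_range_add, raySum,
    sum_range_eq_shift (F := fun k => denCount q k * c (n + 2 * k) (d - k))
      fun k hk => by rw [hc _ (by omega), mul_zero]]
  rw [mul_add, Finset.mul_sum]
  congr 1
  · rw [← sum_denCount, Finset.sum_mul]
    refine Finset.sum_congr rfl fun k hk => ?_
    have hk' := Finset.mem_range.mp hk
    rw [min_eq_right (by omega), show (d + n + d - 2 * d).toNat = n by omega]
    simp [denCount]
  · refine Finset.sum_congr rfl fun k _ => ?_
    rw [min_eq_left (by push_cast; omega), show n + 1 + k = (n + k) + 1 by ring,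
      show (d + n + d - 2 * (d + n - (n + k + 1 : ℕ))).toNat = n + 2 * (k + 1) by push_cast; omega,
      show d + n - (n + k + 1 : ℕ) = d - (k + 1 : ℕ) by push_cast; ring]
    simp only [denCount]
    ring

/-- The number of elements of norm `1` modulo the `k`-th power of the maximal ideal. -/
def normOneCount (q : ℂ) : ℕ → ℂ
  | 0 => 1
  | k + 1 => q ^ (k + 1) + q ^ k

/-- The value of the function on Hermitian matrices attached to the spherical function with
the values `c`, at the class of `diag(ϖ^(m+l), ϖ^m)`. -/
def hermCoef (q : ℂ) (B : ℕ) (c : ℕ → ℤ → ℂ) (l : ℕ) (m : ℤ) : ℂ :=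
  if Even l then ∑ k ∈ Finset.range B,
    if Even (m - k) then normOneCount q k * c (l / 2 + k) ((m - k) / 2) else 0
  else 0

/-- The values of the base change of the ray sums. -/
def bcRay (q : ℂ) (B : ℕ) (c : ℕ → ℤ → ℂ) (l : ℕ) (m : ℤ) : ℂ :=
  if Even l ∧ Even m then raySum (q ^ 2) B c (l / 2) (m / 2) else 0

lemma hermCoef_boundedBy {q : ℂ} {B : ℕ} {c : ℕ → ℤ → ℂ} (hc : BoundedBy B c) :
    BoundedBy (2 * B) (hermCoef q B c) := fun l hl m => by
  rw [hermCoef]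
  split_ifs
  · refine Finset.sum_eq_zero fun k _ => ?_
    rw [hc _ (by omega), mul_zero, ite_self]
  · rfl

lemma bcRay_boundedBy {q : ℂ} {B : ℕ} {c : ℕ → ℤ → ℂ} (hc : BoundedBy B c) :
    BoundedBy (2 * B) (bcRay q B c) := fun l hl m => by
  rw [bcRay]
  split_ifs
  · exact raySum_boundedBy hc _ (by omega) _
  · rfl

lemma hermCoef_even {q : ℂ} {B : ℕ} {c : ℕ → ℤ → ℂ} (hc : BoundedBy B c) (l : ℕ) (m : ℤ) :
    hermCoef q B c (2 * l) (2 * m) =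
      ∑ r ∈ Finset.range B, normOneCount q (2 * r) * c (l + 2 * r) (m - r) := by
  rw [hermCoef, if_pos (even_two_mul l), sum_range_eq_even_add_odd]
  · refine Finset.sum_congr rfl fun r _ => ?_
    rw [if_pos (by push_cast; exact ⟨m - r, by ring⟩),
      if_neg (by rw [Int.even_iff]; push_cast; omega), add_zero,
      show 2 * l / 2 = l by omega, show (2 * m - (2 * r : ℕ)) / 2 = m - r by push_cast; omega]
  · intro k hk
    rw [hc _ (by omega), mul_zero, ite_self]

lemma hermCoef_odd {q : ℂ} {B : ℕ} {c : ℕ → ℤ → ℂ} (hc : BoundedBy B c) (l : ℕ) (m : ℤ) :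
    hermCoef q B c (2 * l) (2 * m + 1) =
      ∑ r ∈ Finset.range B, normOneCount q (2 * r + 1) * c (l + 2 * r + 1) (m - r) := by
  rw [hermCoef, if_pos (even_two_mul l), sum_range_eq_even_add_odd]
  · refine Finset.sum_congr rfl fun r _ => ?_
    rw [if_neg (by rw [Int.even_iff]; push_cast; omega),
      if_pos (by push_cast; exact ⟨m - r, by ring⟩), zero_add,
      show 2 * l / 2 + (2 * r + 1) = l + 2 * r + 1 by omega,
      show (2 * m + 1 - (2 * r + 1 : ℕ)) / 2 = m - r by push_cast; omega]
  · intro k hk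
    rw [hc _ (by omega), mul_zero, ite_self]

/-- For even `m` this rests on `n_(2r+2) - n_(2r+1) = q^(2r+2) - q^(2r)`, a weight of the ray sum
for `q²`; for odd `m` on `n_(2r+1) - n_(2r)`, which is `q` times the weight of index `r`. Here `n_k`
is `normOneCount q k`. The sign `(-1)^m` appears because the nonzero value of `bcRay` sits at `(l,
m)` for even `m` and at `(l+2, m-1)` for odd `m`. -/
lemma bcRay_sub {q : ℂ} {B : ℕ} {c : ℕ → ℤ → ℂ} (hc : BoundedBy B c) (l : ℕ) (m : ℤ) :
    bcRay q B c l m - q * bcRay q B c (l + 2) (m - 1) =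
      (-1) ^ m * (hermCoef q B c l m - hermCoef q B c (l + 2) (m - 1)) := by
  rcases Nat.even_or_odd' l with ⟨l, rfl | rfl⟩
  · rcases Int.even_or_odd' m with ⟨m, rfl | rfl⟩
    · have h1 : hermCoef q B c (2 * l + 2) (2 * m - 1) =
          ∑ r ∈ Finset.range B, normOneCount q (2 * r + 1) * c (l + 2 * (r + 1))
            (m - (r + 1 : ℕ)) := by
        rw [show 2 * l + 2 = 2 * (l + 1) by ring, show 2 * m - 1 = 2 * (m - 1) + 1 by ring,
          hermCoef_odd hc]
        refine Finset.sum_congr rfl fun r _ => ?_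
        congr 2
        · ring
        · push_cast; ring
      rw [h1, hermCoef_even hc, sum_range_eq_shift
        (F := fun r => normOneCount q (2 * r) * c (l + 2 * r) (m - r))
        fun k hk => by rw [hc _ (by omega), mul_zero]]
      rw [bcRay, if_pos ⟨even_two_mul l, even_two_mul m⟩, bcRay,
        if_neg (by rw [Int.even_iff]; omega), raySum, sum_range_eq_shift
        fun k hk => by rw [hc _ (by omega), mul_zero],
        show 2 * l / 2 = l by omega, show 2 * m / 2 = m by omega, mul_zero q, sub_zero, add_sub_assoc,
        ← Finset.sum_sub_distrib, (even_two_mul m).neg_one_zpow]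
      simp only [denCount, normOneCount, mul_zero, one_mul]
      congr 1
      refine Finset.sum_congr rfl fun r _ => ?_
      rw [show 2 * (r + 1) = 2 * r + 1 + 1 by ring]
      simp only
      ring
    · have h1 : hermCoef q B c (2 * l + 2) (2 * m + 1 - 1) =
          ∑ r ∈ Finset.range B, normOneCount q (2 * r) * c (l + 2 * r + 1) (m - r) := by
        rw [show 2 * l + 2 = 2 * (l + 1) by ring, show 2 * m + 1 - 1 = 2 * m by ring,
          hermCoef_even hc]
        refine Finset.sum_congr rfl fun r _ => ?_
        congr 2
        ring
      rw [h1, hermCoef_odd hc, ← Finset.sum_sub_distrib, bcRay,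
        if_neg (by rw [Int.even_iff]; omega), bcRay,
        if_pos ⟨⟨l + 1, by ring⟩, ⟨m, by ring⟩⟩, raySum,
        show (2 * l + 2) / 2 = l + 1 by omega, show (2 * m + 1 - 1) / 2 = m by omega,
        (odd_two_mul_add_one m).neg_one_zpow, Finset.mul_sum, zero_sub, neg_one_mul]
      congr 1
      refine Finset.sum_congr rfl fun r _ => ?_
      rw [show l + 1 + 2 * r = l + 2 * r + 1 by ring, ← sub_mul, ← mul_assoc]
      congr 1
      cases r with
      | zero => simp [denCount, normOneCount]
      | succ r =>
        rw [show 2 * (r + 1) = 2 * r + 1 + 1 by ring]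
        simp only [denCount, normOneCount]
        ring
  · have h1 : ¬ Even (2 * l + 1) := by rw [Nat.even_iff]; omega
    have h2 : ¬ Even (2 * l + 1 + 2) := by rw [Nat.even_iff]; omega
    simp [bcRay, hermCoef, h1, h2]

/-- The values of the base change of the spherical function whose function on Hermitian matrices
has the values `Φ`. -/
def bcCoef (B : ℕ) (Φ : ℕ → ℤ → ℂ) (l : ℕ) (m : ℤ) : ℂ :=
  (-1) ^ m * (Φ l m + 2 * ∑ r ∈ Finset.range B, (-1) ^ (r + 1) * Φ (l + 2 * (r + 1))
    (m - (r + 1 : ℕ)))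

lemma bcCoef_boundedBy {B : ℕ} {Φ : ℕ → ℤ → ℂ} (hΦ : BoundedBy B Φ) :
    BoundedBy B (bcCoef B Φ) := fun l hl m => by
  rw [bcCoef, hΦ l hl, Finset.sum_eq_zero fun r _ => by rw [hΦ _ (by omega), mul_zero]]
  simp

/-- The sign `(-1)^m` changes from one point of the ray to the next, so the alternating tails cancel
and only the first term of the sum, with its factor `2`, is left over. -/
lemma bcCoef_sub {B : ℕ} {Φ : ℕ → ℤ → ℂ} (hΦ : BoundedBy B Φ) (l : ℕ) (m : ℤ) :
    bcCoef B Φ l m - bcCoef B Φ (l + 2) (m - 1) = (-1) ^ m * (Φ l m - Φ (l + 2) (m - 1)) := by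
  have h1 : ∑ r ∈ Finset.range B, (-1) ^ (r + 1) * Φ (l + 2 * (r + 1)) (m - (r + 1 : ℕ)) =
      -Φ (l + 2) (m - 1) - ∑ r ∈ Finset.range B, (-1) ^ (r + 1) * Φ (l + 2 + 2 * (r + 1))
        (m - 1 - (r + 1 : ℕ)) := by
    rw [sum_range_eq_shift fun k hk => by rw [hΦ _ (by omega), mul_zero],
      sub_eq_add_neg (-Φ (l + 2) (m - 1)), ← Finset.sum_neg_distrib]
    congr 1
    · simp
    · refine Finset.sum_congr rfl fun r _ => ?_
      rw [show l + 2 * (r + 1 + 1) = l + 2 + 2 * (r + 1) by ring,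
        show m - (r + 1 + 1 : ℕ) = m - 1 - (r + 1 : ℕ) by push_cast; ring]
      ring
  have h2 : (-1 : ℂ) ^ (m - 1) = -(-1) ^ m := by
    rw [zpow_sub_one₀ (by norm_num)]
    norm_num
  rw [bcCoef, bcCoef, h1, h2]
  ring

/-- Both sides satisfy the same recursion `X(l, m) - q X(l+2, m-1)` along rays and vanish for large
`l`. -/
lemma raySum_bcCoef {q : ℂ} {B B' : ℕ} {c h : ℕ → ℤ → ℂ} (hc : BoundedBy B c)
    (hh : BoundedBy B' h)
    (hD : ∀ l m, h l m - h (l + 2) (m - 1) =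
      (-1) ^ m * (hermCoef q B c l m - hermCoef q B c (l + 2) (m - 1))) :
    raySum q B' h = bcRay q B c := by
  refine eq_of_ray (B := max B' (2 * B)) ((raySum_boundedBy hh).mono (le_max_left _ _))
    ((bcRay_boundedBy hc).mono (le_max_right _ _)) q fun l m => ?_
  rw [raySum_sub hh, hD, bcRay_sub hc]

lemma eq_of_raySum_eq {q : ℂ} {B B' : ℕ} {c c' : ℕ → ℤ → ℂ} (hc : BoundedBy B c)
    (hc' : BoundedBy B' c') (h : raySum q B c = raySum q B' c') : c = c' := by
  refine eq_of_ray (B := max B B') (hc.mono (le_max_left _ _)) (hc'.mono (le_max_right _ _)) 1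
    fun l m => ?_
  rw [one_mul, one_mul, ← raySum_sub hc (q := q), ← raySum_sub hc', h]

/-- The coefficients of the base change of a Satake transform. -/
def bcSatake (q : ℂ) (B : ℕ) (c : ℕ → ℤ → ℂ) (a d : ℤ) : ℂ :=
  if Even a ∧ Even d then satakeCoef (q ^ 2) B c (a / 2) (d / 2) else 0

/-- The coefficients with `a ≤ d` are the ray sums. The others are determined by the Weyl symmetry,
whose factors agree because `(q²)^((a-d)/2) = q^(a-d)`. -/
lemma satakeCoef_eq_bcSatake_iff {q : ℂ} {B B' : ℕ} {c h : ℕ → ℤ → ℂ} (hc : BoundedBy B c)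
    (hh : BoundedBy B' h) :
    satakeCoef q B' h = bcSatake q B c ↔ raySum q B' h = bcRay q B c := by
  constructor
  · intro heq
    funext l m
    have := congrFun (congrFun heq m) (m + l)
    rw [satakeCoef_of_le (by omega), bcSatake] at this
    rw [show (m + l - m).toNat = l by omega] at this
    rw [this, bcRay]
    have hev : Even m ∧ Even (m + l) ↔ Even l ∧ Even m := by
      rw [Int.even_iff, Int.even_iff, Nat.even_iff]
      omega
    by_cases he : Even l ∧ Even m
    · rw [if_pos he, if_pos (hev.mpr he)]
      obtain ⟨⟨l, rfl⟩, ⟨m, rfl⟩⟩ := he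
      rw [satakeCoef_of_le (by omega)]
      congr 1
      omega
    · rw [if_neg he, if_neg (mt hev.mp he)]
  · intro heq
    funext a d
    rcases le_total a d with hle | hle
    · rw [satakeCoef_of_le hle, heq, bcRay, bcSatake]
      have hev : Even a ∧ Even d ↔ Even (d - a).toNat ∧ Even a := by
        rw [Int.even_iff, Int.even_iff, Nat.even_iff]
        omega
      by_cases he : Even a ∧ Even d
      · rw [if_pos he, if_pos (hev.mp he)]
        obtain ⟨⟨a, rfl⟩, ⟨d, rfl⟩⟩ := he
        rw [satakeCoef_of_le (by omega)]
        congr 1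
        omega
      · rw [if_neg he, if_neg (mt hev.mpr he)]
    · rw [satakeCoef_of_ge hh hle, heq, bcRay, bcSatake]
      have hev : Even a ∧ Even d ↔ Even (a - d).toNat ∧ Even d := by
        rw [Int.even_iff, Int.even_iff, Nat.even_iff]
        omega
      by_cases he : Even a ∧ Even d
      · rw [if_pos he, if_pos (hev.mp he)]
        obtain ⟨⟨a, rfl⟩, ⟨d, rfl⟩⟩ := he
        rw [satakeCoef_of_ge hc (by omega), ← pow_mul]
        congr 2
        · omega
        · omega
      · rw [if_neg he, if_neg (mt hev.mpr he), mul_zero]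

lemma finite_hermCoef {q : ℂ} {B : ℕ} {c : ℕ → ℤ → ℂ}
    (hc : {p : ℕ × ℤ | c p.1 p.2 ≠ 0}.Finite) :
    {p : ℕ × ℤ | hermCoef q B c p.1 p.2 ≠ 0}.Finite := by
  have hfin : (⋃ k ∈ Finset.range B, (fun p : ℕ × ℤ => (2 * (p.1 - k), 2 * p.2 + (k : ℤ))) ''
      {p : ℕ × ℤ | c p.1 p.2 ≠ 0}).Finite :=
    (Finset.range B).finite_toSet.biUnion fun k _ => hc.image _
  refine hfin.subset ?_
  rintro ⟨l, m⟩ hp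
  simp only [Set.mem_ofPred_eq, hermCoef] at hp
  split_ifs at hp with hl
  · obtain ⟨k, hk, hne⟩ := Finset.exists_ne_zero_of_sum_ne_zero hp
    split_ifs at hne with hm
    · refine Set.mem_iUnion₂.mpr ⟨k, hk, (l / 2 + k, (m - k) / 2), right_ne_zero_of_mul hne, ?_⟩
      rw [Nat.even_iff] at hl
      rw [Int.even_iff] at hm
      simp only [Prod.mk.injEq]
      omega
    · exact absurd rfl hne
  · exact absurd rfl hp

lemma finite_bcCoef {B : ℕ} {Φ : ℕ → ℤ → ℂ} (hΦ : {p : ℕ × ℤ | Φ p.1 p.2 ≠ 0}.Finite) :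
    {p : ℕ × ℤ | bcCoef B Φ p.1 p.2 ≠ 0}.Finite := by
  have hfin : (⋃ k ∈ Finset.range (B + 1), (fun p : ℕ × ℤ => (p.1 - 2 * k, p.2 + (k : ℤ))) ''
      {p : ℕ × ℤ | Φ p.1 p.2 ≠ 0}).Finite :=
    (Finset.range (B + 1)).finite_toSet.biUnion fun k _ => hΦ.image _
  refine hfin.subset ?_
  rintro ⟨l, m⟩ hp
  by_contra hnot
  have hz (k : ℕ) (hk : k < B + 1) : Φ (l + 2 * k) (m - k) = 0 := by
    by_contra hne
    refine hnot (Set.mem_iUnion₂.mpr ⟨k, by simpa using hk, (l + 2 * k, m - k), hne, ?_⟩)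
    simp
  refine hp ?_
  have h0 := hz 0 (by omega)
  simp only [mul_zero, add_zero, Nat.cast_zero, sub_zero] at h0
  simp only [bcCoef]
  rw [h0, Finset.sum_eq_zero]
  · simp
  · intro r hr
    rw [hz (r + 1) (by simpa using hr), mul_zero]

end Combinatorics

/-! ### Congruences modulo the maximal ideal -/

section ResidueLemmas

variable {L : Type*} [Field L] [ValuativeRel L] [TopologicalSpace L]
  [IsNonarchimedeanLocalField L]

lemma residue_eq_residue_iff {x y : 𝒪[L]} : IsLocalRing.residue 𝒪[L] x = IsLocalRing.residue 𝒪[L] y ↔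
    (x : L) - y ∈ lat L 1 := by
  rw [← sub_eq_zero, ← map_sub, IsLocalRing.residue_eq_zero_iff, mem_maximalIdeal_iff]
  rfl

lemma ringChar_residue_eq_two (h2 : (2 : L) ∈ lat L 1) : ringChar 𝓀[L] = 2 := by
  have h : (2 : 𝓀[L]) = 0 := by
    have h0 : IsLocalRing.residue 𝒪[L] 2 = 0 := by
      rw [IsLocalRing.residue_eq_zero_iff, mem_maximalIdeal_iff]
      exact h2
    rwa [map_ofNat] at h0
  have := CharTwo.of_one_ne_zero_of_two_eq_zero (one_ne_zero (α := 𝓀[L])) h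
  exact ringChar.eq 𝓀[L] 2

lemma ringChar_residue_ne_two (h2 : (2 : L) ∉ lat L 1) : ringChar 𝓀[L] ≠ 2 := by
  intro h
  apply h2
  have : CharP 𝓀[L] 2 := ringChar.of_eq h
  have h0 : (2 : 𝓀[L]) = 0 := CharTwo.two_eq_zero
  rw [← map_ofNat (IsLocalRing.residue 𝒪[L]), IsLocalRing.residue_eq_zero_iff,
    mem_maximalIdeal_iff] at h0
  exact h0

/-- In residue characteristic two every integer is a square modulo the maximal ideal. -/
lemma exists_sq_sub_mem (h2 : (2 : L) ∈ lat L 1) {n : L} (hn : n ∈ lat L 0) :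
    ∃ b ∈ lat L 0, n - b ^ 2 ∈ lat L 1 := by
  obtain ⟨c, hc⟩ := FiniteField.isSquare_of_char_two (ringChar_residue_eq_two h2)
    (IsLocalRing.residue 𝒪[L] ⟨n, mem_lat_zero.mp hn⟩)
  obtain ⟨b, rfl⟩ := IsLocalRing.residue_surjective c
  refine ⟨b, mem_lat_zero.mpr b.2, ?_⟩
  rw [← map_mul, residue_eq_residue_iff] at hc
  rw [sq]
  exact hc

/-- In odd residue characteristic the form `x² - d y²` represents every unit modulo the maximal
ideal. -/
lemma exists_quadratic_sub_mem (h2 : (2 : L) ∉ lat L 1) {d u : L} (hd : d ∈ lat L 0)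
    (hd' : d ∉ lat L 1) (hu : u ∈ lat L 0) :
    ∃ x ∈ lat L 0, ∃ y ∈ lat L 0, u - (x ^ 2 - d * y ^ 2) ∈ lat L 1 := by
  classical
  have : Fintype 𝓀[L] := Fintype.ofFinite _
  let D := IsLocalRing.residue 𝒪[L] ⟨d, mem_lat_zero.mp hd⟩
  let U := IsLocalRing.residue 𝒪[L] ⟨u, mem_lat_zero.mp hu⟩
  have hD : D ≠ 0 := by
    rw [Ne, IsLocalRing.residue_eq_zero_iff, mem_maximalIdeal_iff]
    exact hd'
  obtain ⟨x, y, hxy⟩ := FiniteField.exists_root_sum_quadratic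
    (f := Polynomial.C 1 * Polynomial.X ^ 2 + Polynomial.C 0 * Polynomial.X + Polynomial.C (-U))
    (g := Polynomial.C (-D) * Polynomial.X ^ 2 + Polynomial.C 0 * Polynomial.X + Polynomial.C 0)
    (Polynomial.degree_quadratic one_ne_zero) (Polynomial.degree_quadratic (neg_ne_zero.mpr hD))
    (FiniteField.odd_card_of_char_ne_two (ringChar_residue_ne_two h2))
  obtain ⟨x, rfl⟩ := IsLocalRing.residue_surjective x
  obtain ⟨y, rfl⟩ := IsLocalRing.residue_surjective y
  refine ⟨x, mem_lat_zero.mpr x.2, y, mem_lat_zero.mpr y.2, ?_⟩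
  have h : U = IsLocalRing.residue 𝒪[L] (x ^ 2 - ⟨d, mem_lat_zero.mp hd⟩ * y ^ 2) := by
    rw [map_sub, map_mul, map_pow, map_pow]
    simp only [Polynomial.eval_add, Polynomial.eval_mul, Polynomial.eval_C, Polynomial.eval_pow,
      Polynomial.eval_X] at hxy
    change U = _ - D * _
    linear_combination -hxy
  rw [residue_eq_residue_iff] at h
  exact h

lemma mul_mem_lat_right {x y : L} {n : ℤ} (hx : x ∈ lat L n) (hy : y ∈ lat L 0) :
    x * y ∈ lat L n := by
  simpa using mul_mem_lat hx hy

lemma lat_one_of_sq {x : L} (h : x ^ 2 ∈ lat L 1) : x ∈ lat L 1 := by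
  rcases eq_or_ne x 0 with rfl | hx
  · exact zero_mem _
  · rw [mem_lat_iff (pow_ne_zero 2 hx), sq, ord_mul hx hx] at h
    rw [mem_lat_iff hx]
    omega

lemma ord_eq_zero_of_mem {x : L} (h0 : x ∈ lat L 0) (h1 : x ∉ lat L 1) : x ≠ 0 ∧ ord x = 0 := by
  have hx : x ≠ 0 := by
    rintro rfl
    exact h1 (zero_mem _)
  rw [mem_lat_iff hx] at h0 h1
  exact ⟨hx, by omega⟩

lemma not_mem_lat_one {x : L} (hx : x ≠ 0) (h : ord x = 0) : x ∉ lat L 1 := by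
  rw [mem_lat_iff hx, h]
  omega

end ResidueLemmas

/-! ### Arithmetic of the unramified quadratic extension -/

section Quadratic

variable {F E : Type*} [Field F] [Field E] [Algebra F E]
  [ValuativeRel F] [TopologicalSpace F] [IsNonarchimedeanLocalField F]
  [ValuativeRel E] [TopologicalSpace E] [IsNonarchimedeanLocalField E]
  [ValuativeExtension F E]

/-- `σ` is the nontrivial automorphism of the unramified quadratic extension `E/F`. -/
structure IsUnramQuad (σ : E ≃ₐ[F] E) : Prop where
  finrank : Module.finrank F E = 2
  unr : IsUnramifiedExt F E
  invol : Function.Involutive σ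
  ne_refl : σ ≠ AlgEquiv.refl

namespace IsUnramQuad

variable {σ : E ≃ₐ[F] E} (h : IsUnramQuad σ)

include h

lemma ord_algebraMap (x : F) : ord (algebraMap F E x) = ord x := by
  obtain ⟨ϖ, hϖ⟩ := exists_ord_eq_one (L := F)
  have hone (x : F) (hx : x ≠ 0) (h0 : ord x = 0) : ord (algebraMap F E x) = 0 := by
    have hx' : algebraMap F E x ≠ 0 := by simpa using hx
    rw [ord_eq_zero_iff_valuation hx] at h0
    rw [ord_eq_zero_iff_valuation hx', ← map_one (valuation E), ← map_one (algebraMap F E)]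
    rw [← map_one (valuation F)] at h0
    rw [← Valuation.veq_iff_eq] at h0 ⊢
    exact ⟨(ValuativeExtension.vle_iff_vle _ _).mpr h0.1,
      (ValuativeExtension.vle_iff_vle _ _).mpr h0.2⟩
  have hmul (x : F) (hx : x ≠ 0) : ord (algebraMap F E x) = ord x * ord (algebraMap F E ϖ) := by
    have h1 : x = ((ϖ ^ ord x : Fˣ) : F) * (x * ((ϖ ^ (-ord x) : Fˣ) : F)) := by
      have : ((ϖ ^ ord x : Fˣ) : F) * ((ϖ ^ (-ord x) : Fˣ) : F) = 1 := by
        rw [← Units.val_mul, ← zpow_add]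
        simp
      linear_combination -x * this
    have h2 : x * ((ϖ ^ (-ord x) : Fˣ) : F) ≠ 0 := mul_ne_zero hx (Units.ne_zero _)
    have h3 := hone _ h2 (by
      rw [ord_mul hx (Units.ne_zero _), ord_uniformizer_zpow hϖ]
      ring)
    have h4 := ord_zpow (unitsIncl F E ϖ) (ord x)
    rw [← map_zpow] at h4
    conv_lhs => rw [h1]
    rw [map_mul, ord_mul ((map_ne_zero _).mpr (Units.ne_zero _)) ((map_ne_zero _).mpr h2), h3, add_zero]
    exact h4
  obtain ⟨y₁, hy₁⟩ := exists_ord_eq_one (L := E)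
  obtain ⟨y, hy⟩ := h.unr y₁
  have hy0 : y ≠ 0 := by
    rintro rfl
    rw [map_zero, map_zero, eq_comm, map_eq_zero] at hy
    exact y₁.ne_zero hy
  have hy1 : ord (algebraMap F E y) = 1 := by
    rw [← hy₁, ord, ord, intVal_eq_intVal.mpr hy]
  have hpos : 0 ≤ ord (algebraMap F E (ϖ : F)) := by
    rw [← mem_lat_iff (by simp), mem_lat_zero, Valuation.mem_integer_iff,
      ← map_one (valuation E), ← map_one (algebraMap F E), ← Valuation.vle_iff_le,
      ValuativeExtension.vle_iff_vle, Valuation.vle_iff_le (valuation F), map_one,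
      ← Valuation.mem_integer_iff, ← mem_lat_zero, mem_lat_iff ϖ.ne_zero, hϖ]
    omega
  have hϖ1 : ord (algebraMap F E (ϖ : F)) = 1 := by
    rw [hmul y hy0] at hy1
    rcases Int.isUnit_iff.mp (IsUnit.of_mul_eq_one_right _ hy1) with h1 | h1 <;> omega
  rcases eq_or_ne x 0 with rfl | hx
  · simp [ord, intVal_zero]
  · rw [hmul x hx, hϖ1, mul_one]

lemma algebraMap_mem_lat {x : F} {n : ℤ} : algebraMap F E x ∈ lat E n ↔ x ∈ lat F n := by
  rw [mem_lat_iff', mem_lat_iff', h.ord_algebraMap]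
  simp

lemma ord_unitsIncl (x : Fˣ) : ord (unitsIncl F E x : E) = ord (x : F) := h.ord_algebraMap x

lemma finiteDimensional : FiniteDimensional F E :=
  FiniteDimensional.of_finrank_pos (by rw [h.finrank]; norm_num)

lemma eq_one_or_eq (τ : E ≃ₐ[F] E) : τ = 1 ∨ τ = σ := by
  classical
  have := h.finiteDimensional
  have hc := AlgEquiv.card_le (F := F) (K := E)
  rw [h.finrank] at hc
  by_contra! hne
  have h3 : ({1, σ, τ} : Finset (E ≃ₐ[F] E)).card = 3 :=
    Finset.card_eq_three.mpr ⟨1, σ, τ, fun h1 => h.ne_refl h1.symm, hne.1.symm, hne.2.symm, rfl⟩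
  have := Finset.card_le_univ ({1, σ, τ} : Finset (E ≃ₐ[F] E))
  omega

lemma univ_eq [Fintype (E ≃ₐ[F] E)] [DecidableEq (E ≃ₐ[F] E)] :
    (Finset.univ : Finset (E ≃ₐ[F] E)) = {1, σ} := by
  ext τ
  simpa using h.eq_one_or_eq τ

lemma isGalois : IsGalois F E := by
  classical
  have := h.finiteDimensional
  refine IsGalois.of_card_aut_eq_finrank (F := F) (E := E) ?_
  rw [h.finrank, Nat.card_eq_fintype_card, ← Finset.card_univ, h.univ_eq]
  exact Finset.card_pair fun h1 => h.ne_refl h1.symm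

lemma exists_of_fixed {x : E} (hx : σ x = x) : ∃ y : F, algebraMap F E y = x := by
  have := h.finiteDimensional
  have := h.isGalois
  rw [← Set.mem_range, ← IntermediateField.mem_bot, IsGalois.mem_bot_iff_fixed]
  intro τ
  rcases h.eq_one_or_eq τ with rfl | rfl
  · rfl
  · exact hx

lemma algebraMap_norm (x : E) : algebraMap F E (Algebra.norm F x) = x * σ x := by
  classical
  have := h.finiteDimensional
  have := h.isGalois
  rw [Algebra.norm_eq_prod_automorphisms, h.univ_eq,
    Finset.prod_pair (a := (1 : E ≃ₐ[F] E)) fun h1 => h.ne_refl h1.symm]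
  rfl

/-- `F` is closed in `E`: the approximations within given precision form a decreasing sequence of
nonempty closed sets in a compact one. -/
lemma exists_of_forall_approx {y : E} (hy : ∀ N : ℕ, ∃ b : F, y - algebraMap F E b ∈ lat E N) :
    ∃ b : F, y = algebraMap F E b := by
  choose b hb using hy
  let S (N : ℕ) : Set F := (fun x => b N - x) ⁻¹' (lat F N : Set F)
  have hS (N : ℕ) (x : F) : x ∈ S N ↔ y - algebraMap F E x ∈ lat E N := by
    have h1 : x ∈ S N ↔ algebraMap F E (b N) - algebraMap F E x ∈ lat E N := by
      rw [← map_sub, h.algebraMap_mem_lat]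
      rfl
    rw [h1, ← (lat E N).add_mem_cancel_left (hb N), sub_add_sub_cancel]
  have hclosed (N : ℕ) : IsClosed (S N) :=
    (isClosed_lat _).preimage (continuous_const.sub continuous_id)
  have hcomp : IsCompact (S 0) := by
    have : S 0 = (fun x => b 0 - x) '' (lat F 0 : Set F) := by
      ext x
      constructor
      · intro hx
        exact ⟨b 0 - x, hx, by simp⟩
      · rintro ⟨z, hz, rfl⟩
        simpa [S] using hz
    rw [this]
    exact isCompact_lat_zero.image (continuous_const.sub continuous_id)
  obtain ⟨x, hx⟩ := IsCompact.nonempty_iInter_of_sequence_nonempty_isCompact_isClosed S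
    (fun N x hx => (hS N x).mpr (lat_anti (by omega) ((hS _ x).mp hx)))
    (fun N => ⟨b N, (hS N _).mpr (hb N)⟩) hcomp hclosed
  refine ⟨x, sub_eq_zero.mp (eq_zero_of_forall_mem_lat fun N => ?_)⟩
  exact (hS N x).mp (Set.mem_iInter.mp hx N)

/-- Invariance of the valuation is proved by hand. If `σ y` had positive order, the traces `y^k + (σ
y)^k ∈ F` would be dominated by `y^k`, and the quotients of consecutive traces would converge to
`y`. Then `y ∈ F`, so `σ y = y`, a contradiction. -/
lemma ord_sigma_nonpos {y : E} (hy0 : y ≠ 0) (hy : ord y = 0) : ord (σ y) ≤ 0 := by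
  by_contra! hpos
  have hz0 : σ y ≠ 0 := by simpa using hy0
  have ht (k : ℕ) : ∃ b : F, algebraMap F E b = y ^ k + σ y ^ k := by
    apply h.exists_of_fixed
    rw [map_add, map_pow, map_pow, h.invol, add_comm]
  have hzpow (k : ℕ) (hk : 1 ≤ k) : σ y ^ k ∈ lat E k := by
    have : ((Units.mk0 _ hz0 ^ (k : ℤ) : Eˣ) : E) = σ y ^ k := by simp
    rw [← this, mem_lat_iff (Units.ne_zero _), ord_zpow]
    change _ ≤ (k : ℤ) * ord (σ y)
    nlinarith
  have hypow (k : ℕ) : ord (y ^ k) = 0 := by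
    have : ((Units.mk0 _ hy0 ^ (k : ℤ) : Eˣ) : E) = y ^ k := by simp
    rw [← this, ord_zpow]
    simp [hy]
  obtain ⟨b, hb⟩ : ∃ b : F, y = algebraMap F E b := by
    refine h.exists_of_forall_approx fun N => ?_
    obtain ⟨b, hb⟩ := ht (N + 1)
    obtain ⟨b', hb'⟩ := ht (N + 2)
    obtain ⟨h1, h2⟩ := ord_add_eq_left (pow_ne_zero (N + 1) hy0) (y := σ y ^ (N + 1)) (by
      rw [hypow]
      exact lat_anti (by push_cast; omega) (hzpow (N + 1) (by omega)))
    rw [hypow] at h2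
    refine ⟨b' / b, ?_⟩
    have h3 : y - algebraMap F E (b' / b) =
        (y ^ (N + 1) + σ y ^ (N + 1))⁻¹ * (σ y ^ (N + 1) * (y - σ y)) := by
      rw [map_div₀, hb, hb']
      field_simp
      ring
    rw [h3, mul_mem_lat_iff (inv_ne_zero h1), ord_inv, h2]
    refine lat_anti (m := (N + 1 : ℕ) + 0) (by push_cast; omega)
      (mul_mem_lat (hzpow (N + 1) (by omega)) ?_)
    exact sub_mem ((mem_lat_iff hy0).mpr hy.ge) ((mem_lat_iff hz0).mpr hpos.le)
  rw [hb, AlgEquiv.commutes, ← hb, hy] at hpos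
  omega

lemma ord_sigma (x : E) : ord (σ x) = ord x := by
  rcases eq_or_ne x 0 with rfl | hx
  · simp
  have hunit (y : E) (hy0 : y ≠ 0) (hy : ord y = 0) : ord (σ y) = 0 := by
    refine le_antisymm (h.ord_sigma_nonpos hy0 hy) ?_
    have := h.ord_sigma_nonpos (inv_ne_zero hy0) (by rw [ord_inv, hy, neg_zero])
    rw [map_inv₀, ord_inv] at this
    omega
  obtain ⟨ϖ, hϖ⟩ := exists_ord_eq_one (L := F)
  have h1 : ord (unitsIncl F E (ϖ ^ (-ord x)) : E) = -ord x := by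
    rw [h.ord_unitsIncl, ord_uniformizer_zpow hϖ]
  have h2 := hunit (x * unitsIncl F E (ϖ ^ (-ord x))) (mul_ne_zero hx (Units.ne_zero _)) (by
    rw [ord_mul hx (Units.ne_zero _), h1]
    ring)
  have h3 : σ (unitsIncl F E (ϖ ^ (-ord x)) : E) = unitsIncl F E (ϖ ^ (-ord x)) :=
    AlgEquiv.commutes _ _
  rw [map_mul, h3, ord_mul (by simpa using hx) (Units.ne_zero _), h1] at h2
  omega

lemma sigma_mem_lat {x : E} {n : ℤ} : σ x ∈ lat E n ↔ x ∈ lat E n := by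
  rw [mem_lat_iff', mem_lat_iff', h.ord_sigma]
  simp

/-- If `2` is not a unit, choose `b ∈ F` with `b² ≡ y σ(y) ≡ y²`; then `(y - b)² ≡ 0`. If `2` is a
unit, half the trace of `y` works. -/
lemma exists_approx_of_trivial (htriv : ∀ y ∈ lat E 0, y - σ y ∈ lat E 1) {y : E}
    (hy : y ∈ lat E 0) : ∃ b ∈ lat F 0, y - algebraMap F E b ∈ lat E 1 := by
  have hσy := h.sigma_mem_lat.mpr hy
  by_cases h2 : (2 : F) ∈ lat F 1
  · obtain ⟨n, hn⟩ := h.exists_of_fixed (x := y * σ y) (by rw [map_mul, h.invol, mul_comm])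
    have hn0 : n ∈ lat F 0 := by
      rw [← h.algebraMap_mem_lat, hn]
      exact mul_mem_lat_zero hy hσy
    obtain ⟨b, hb, hnb⟩ := exists_sq_sub_mem h2 hn0
    refine ⟨b, hb, lat_one_of_sq ?_⟩
    rw [← h.algebraMap_mem_lat] at h2 hnb hb
    rw [map_ofNat] at h2
    rw [map_sub, map_pow, hn] at hnb
    have e : (y - algebraMap F E b) ^ 2 = y * (y - σ y) + (y * σ y - algebraMap F E b ^ 2) -
        (algebraMap F E b * (y - algebraMap F E b)) * 2 := by ring
    rw [e]
    refine sub_mem (add_mem (mul_mem_lat_zero hy (htriv y hy)) hnb) ?_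
    exact mul_mem_lat_zero (mul_mem_lat_zero hb (sub_mem hy hb)) h2
  · have h20 : (2 : F) ∈ lat F 0 := by
      rw [← one_add_one_eq_two]
      exact add_mem one_mem_lat one_mem_lat
    obtain ⟨hne, hord⟩ := ord_eq_zero_of_mem h20 h2
    have hE2 : (2 : E) ≠ 0 := by
      rw [← map_ofNat (algebraMap F E)]
      simpa using hne
    have hE2' : ord (2 : E) = 0 := by
      rw [← map_ofNat (algebraMap F E), h.ord_algebraMap, hord]
    obtain ⟨t, ht⟩ := h.exists_of_fixed (x := 2⁻¹ * (y + σ y)) (by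
      rw [map_mul, map_add, h.invol, map_inv₀, map_ofNat, add_comm])
    refine ⟨t, ?_, ?_⟩
    · rw [← h.algebraMap_mem_lat, ht, mul_mem_lat_iff (inv_ne_zero hE2), ord_inv, hE2']
      exact add_mem hy hσy
    · rw [ht, show y - 2⁻¹ * (y + σ y) = 2⁻¹ * (y - σ y) by field_simp; ring,
        mul_mem_lat_iff (inv_ne_zero hE2), ord_inv, hE2']
      exact htriv y hy

/-- The automorphism acts nontrivially on the residue field. -/
lemma exists_sub_sigma : ∃ τ ∈ lat E 0, τ - σ τ ∉ lat E 1 := by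
  by_contra! htriv
  obtain ⟨ϖ, hϖ⟩ := exists_ord_eq_one (L := F)
  have hϖE : ord (algebraMap F E (ϖ : F)) = 1 := by rw [h.ord_algebraMap, hϖ]
  have hϖ0 : algebraMap F E (ϖ : F) ≠ 0 := by simp
  -- As `ϖ` is a uniformizer of `E` too, the approximation modulo the maximal ideal can be repeated
  -- on the quotient by `ϖ`. Every integer of `E` is then a limit of elements of `F`, so `σ` would
  -- be the identity.
  have happ (N : ℕ) : ∀ y ∈ lat E 0, ∃ b : F, y - algebraMap F E b ∈ lat E N := by
    induction N with
    | zero => exact fun y hy => ⟨0, by simpa using hy⟩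
    | succ N ih =>
      intro y hy
      obtain ⟨b, -, hb⟩ := h.exists_approx_of_trivial htriv hy
      obtain ⟨b', hb'⟩ := ih ((algebraMap F E (ϖ : F))⁻¹ * (y - algebraMap F E b)) (by
        rw [mul_mem_lat_iff (inv_ne_zero hϖ0), ord_inv, hϖE]
        exact hb)
      refine ⟨b + ϖ * b', ?_⟩
      have e : y - algebraMap F E (b + ϖ * b') = algebraMap F E (ϖ : F) *
          ((algebraMap F E (ϖ : F))⁻¹ * (y - algebraMap F E b) - algebraMap F E b') := by
        rw [map_add, map_mul]
        field_simp
        ring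
      rw [e, mul_mem_lat_iff hϖ0, hϖE]
      simpa using hb'
  have hfix (y : E) (hy : y ∈ lat E 0) : σ y = y := by
    obtain ⟨b, rfl⟩ := h.exists_of_forall_approx fun N => happ N y hy
    exact σ.commutes b
  refine h.ne_refl (AlgEquiv.ext fun x => ?_)
  have h1 := hfix (algebraMap F E ((ϖ ^ (-ord x) : Fˣ) : F) * x) (by
    rw [mul_mem_lat_iff ((map_ne_zero _).mpr (Units.ne_zero _)), h.ord_algebraMap, ord_uniformizer_zpow hϖ, mem_lat_iff']
    right
    omega)
  rw [map_mul, AlgEquiv.commutes] at h1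
  exact mul_left_cancel₀ ((map_ne_zero _).mpr (Units.ne_zero _)) h1

/-- If no trace were a unit, then neither would `2 = Tr 1` be, and `τ - σ τ = Tr τ - 2 σ τ` would
lie in the maximal ideal for every integer `τ`. Taking a trace of unit value instead of dividing by
`2` covers residue characteristic two. -/
lemma exists_trace_unit : ∃ t ∈ lat E 0, t + σ t ∉ lat E 1 := by
  by_contra! htr
  obtain ⟨τ, hτ, hτ'⟩ := h.exists_sub_sigma
  have h2 := htr 1 one_mem_lat
  rw [map_one, one_add_one_eq_two] at h2
  apply hτ'
  have e : τ - σ τ = (τ + σ τ) - σ τ * 2 := by ring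
  rw [e]
  exact sub_mem (htr τ hτ) (mul_mem_lat_zero (h.sigma_mem_lat.mpr hτ) h2)

/-- In residue characteristic two the norms of elements of `F` are squares and already suffice.
Otherwise `δ = τ - σ τ` satisfies `σ δ = -δ`, and the norm form `x² - δ² y²` represents every
residue class. -/
lemma exists_norm_sub_mem_one {u : F} (hu : u ∈ lat F 0) :
    ∃ y ∈ lat E 0, y * σ y - algebraMap F E u ∈ lat E 1 := by
  by_cases h2 : (2 : F) ∈ lat F 1
  · obtain ⟨b, hb, hub⟩ := exists_sq_sub_mem h2 hu
    refine ⟨algebraMap F E b, h.algebraMap_mem_lat.mpr hb, ?_⟩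
    rw [AlgEquiv.commutes, ← map_mul, ← map_sub, h.algebraMap_mem_lat, ← neg_mem_iff]
    convert! hub using 1
    ring
  · obtain ⟨τ, hτ, hτ'⟩ := h.exists_sub_sigma
    have hδ0 : τ - σ τ ∈ lat E 0 := sub_mem hτ (h.sigma_mem_lat.mpr hτ)
    obtain ⟨hne, hord⟩ := ord_eq_zero_of_mem hδ0 hτ'
    have hσ : σ (τ - σ τ) = -(τ - σ τ) := by rw [map_sub, h.invol]; ring
    obtain ⟨d, hd⟩ := h.exists_of_fixed (x := (τ - σ τ) ^ 2) (by rw [map_pow, hσ]; ring)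
    have hd0 : d ∈ lat F 0 := by
      rw [← h.algebraMap_mem_lat, hd, sq]
      exact mul_mem_lat_zero hδ0 hδ0
    have hd1 : d ∉ lat F 1 := by
      rw [← h.algebraMap_mem_lat, hd]
      exact fun h1 => hτ' (lat_one_of_sq h1)
    obtain ⟨x, hx, y, hy, hxy⟩ := exists_quadratic_sub_mem h2 hd0 hd1 hu
    refine ⟨algebraMap F E x + algebraMap F E y * (τ - σ τ),
      add_mem (h.algebraMap_mem_lat.mpr hx)
        (mul_mem_lat_zero (h.algebraMap_mem_lat.mpr hy) hδ0), ?_⟩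
    rw [← h.algebraMap_mem_lat, ← neg_mem_iff] at hxy
    convert! hxy using 1
    rw [map_add, map_mul, AlgEquiv.commutes, AlgEquiv.commutes, hσ]
    simp only [map_sub, map_mul, map_pow, hd]
    ring

/-- Newton iteration: `Nm(y (1 + r t)) = Nm(y) (1 + r Tr t + r² Nm t)` for `r ∈ F`. As `Tr t` is a
unit, `r` can be chosen so that the linear term removes the error, and a quadratic error remains. -/
lemma exists_norm_sub_mem {u : F} (hu : u ∈ lat F 0) (hu' : u ∉ lat F 1) (N : ℕ) :
    ∃ y ∈ lat E 0, y * σ y - algebraMap F E u ∈ lat E (N + 1) := by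
  obtain ⟨t, ht, ht'⟩ := h.exists_trace_unit
  obtain ⟨htne, htord⟩ := ord_eq_zero_of_mem (add_mem ht (h.sigma_mem_lat.mpr ht)) ht'
  obtain ⟨hune, huord⟩ := ord_eq_zero_of_mem hu hu'
  induction N with
  | zero => simpa using h.exists_norm_sub_mem_one hu
  | succ N ih =>
    obtain ⟨y, hy, hyu⟩ := ih
    have hnu : ord (algebraMap F E u) = 0 := by rw [h.ord_algebraMap, huord]
    obtain ⟨hn0, hn⟩ := ord_add_eq_left (x := algebraMap F E u) (by simpa using hune)
      (y := y * σ y - algebraMap F E u) (lat_anti (by rw [hnu]; omega) hyu)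
    rw [add_sub_cancel, hnu] at hn
    rw [add_sub_cancel] at hn0
    have hy0 : y ≠ 0 := left_ne_zero_of_mul hn0
    have hσy0 : σ y ≠ 0 := right_ne_zero_of_mul hn0
    set r := (algebraMap F E u - y * σ y) / ((y * σ y) * (t + σ t)) with hr
    have hσr : σ r = r := by
      simp only [hr, map_div₀, map_sub, map_mul, map_add, h.invol y, h.invol t, AlgEquiv.commutes]
      ring
    have hrm : r ∈ lat E (N + 1) := by
      rw [hr, div_eq_inv_mul, mul_mem_lat_iff (inv_ne_zero (mul_ne_zero hn0 htne)), ord_inv,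
        ord_mul hn0 htne, hn, htord, ← neg_mem_iff]
      simpa using hyu
    have hw : r * t ∈ lat E (N + 1) := by simpa using mul_mem_lat hrm ht
    refine ⟨y * (1 + r * t), mul_mem_lat_zero hy (add_mem one_mem_lat (lat_anti (by omega) hw)), ?_⟩
    have e : y * (1 + r * t) * σ (y * (1 + r * t)) - algebraMap F E u =
        (y * σ y) * ((r * t) * σ (r * t)) := by
      have h1 : r * ((y * σ y) * (t + σ t)) = algebraMap F E u - y * σ y :=
        div_mul_cancel₀ _ (mul_ne_zero hn0 htne)
      simp only [map_mul, map_add, map_one, hσr]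
      linear_combination h1
    rw [e, mul_mem_lat_iff hn0, hn]
    refine lat_anti (m := (N + 1 : ℤ) + (N + 1)) (by push_cast; omega)
      (mul_mem_lat hw (h.sigma_mem_lat.mpr hw))

lemma continuous_sigma : Continuous σ := by
  refine continuous_of_continuousAt_zero σ.toAlgHom.toRingHom.toAddMonoidHom ?_
  rw [ContinuousAt, map_zero]
  intro U hU
  obtain ⟨n, hn⟩ := exists_lat_subset hU
  refine Filter.mem_map.mpr <|
    Filter.mem_of_superset ((isOpen_lat (L := E) n).mem_nhds (zero_mem _)) fun x hx => hn ?_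
  exact h.sigma_mem_lat.mpr hx

/-- The norm is surjective on units. -/
lemma exists_norm_eq {u : F} (hu0 : u ≠ 0) (hu : ord u = 0) :
    ∃ y : Eˣ, ord (y : E) = 0 ∧ (y : E) * σ y = algebraMap F E u := by
  let S (N : ℕ) : Set E := (lat E 0 : Set E) ∩
    (fun y => y * σ y - algebraMap F E u) ⁻¹' (lat E (N + 1) : Set E)
  have hclosed (N : ℕ) : IsClosed (S N) := by
    refine (isClosed_lat 0).inter ((isClosed_lat _).preimage ?_)
    exact (continuous_id.mul h.continuous_sigma).sub continuous_const
  -- Solutions to every finite precision yield an exact one, by compactness of `𝒪_E`.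
  obtain ⟨y, hy⟩ := IsCompact.nonempty_iInter_of_sequence_nonempty_isCompact_isClosed S
    (fun N x hx => ⟨hx.1, lat_anti (by push_cast; omega) hx.2⟩)
    (fun N => h.exists_norm_sub_mem ((mem_lat_iff hu0).mpr hu.ge) (not_mem_lat_one hu0 hu) N)
    (isCompact_lat_zero.inter_right ((isClosed_lat _).preimage
      ((continuous_id.mul h.continuous_sigma).sub continuous_const))) hclosed
  rw [Set.mem_iInter] at hy
  have heq : y * σ y = algebraMap F E u := by
    refine sub_eq_zero.mp (eq_zero_of_forall_mem_lat fun N => ?_)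
    exact lat_anti (by omega) (hy N).2
  have hy0 : y ≠ 0 := by
    rintro rfl
    rw [zero_mul, eq_comm, map_eq_zero] at heq
    exact hu0 heq
  refine ⟨Units.mk0 y hy0, ?_, heq⟩
  have h1 := congrArg ord heq
  rw [ord_mul hy0 (by simpa using hy0), h.ord_sigma, h.ord_algebraMap, hu] at h1
  change ord y = 0
  omega

/-- A norm has even order since `σ` preserves orders; conversely an even power of `ϖ` is a norm and
so is every unit. -/
lemma isNorm_iff {x : F} (hx : x ≠ 0) : IsNorm σ x ↔ Even (ord x) := by
  constructor
  · rintro ⟨b, hb⟩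
    rw [← h.ord_algebraMap, hb, ord_mul b.ne_zero (by simp), h.ord_sigma]
    exact ⟨_, rfl⟩
  · rintro ⟨n, hn⟩
    obtain ⟨ϖ, hϖ⟩ := exists_ord_eq_one (L := F)
    have h1 : ord (x * ((ϖ ^ (-n + -n) : Fˣ) : F)) = 0 := by
      rw [ord_mul hx (Units.ne_zero _), ord_uniformizer_zpow hϖ]
      omega
    obtain ⟨y, -, hy⟩ := h.exists_norm_eq (mul_ne_zero hx (Units.ne_zero _)) h1
    refine ⟨y * unitsIncl F E (ϖ ^ n), ?_⟩
    have h2 : σ (unitsIncl F E (ϖ ^ n) : E) = unitsIncl F E (ϖ ^ n) := AlgEquiv.commutes _ _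
    have h3 : (unitsIncl F E (ϖ ^ n) : E) = algebraMap F E ((ϖ ^ n : Fˣ) : F) := rfl
    have h4 : ((ϖ ^ (-n + -n) : Fˣ) : F) * (((ϖ ^ n : Fˣ) : F) * ((ϖ ^ n : Fˣ) : F)) = 1 := by
      rw [← Units.val_mul, ← Units.val_mul, ← zpow_add, ← zpow_add]
      simp
    rw [Units.val_mul, map_mul, h2, mul_mul_mul_comm, hy, h3, ← map_mul, ← map_mul, mul_assoc, h4,
      mul_one]

/-- The classes of `1` and `τ` form a basis of the residue extension, since `τ - σ τ` is a unit. -/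
lemma card_residue : Nat.card 𝓀[E] = Nat.card 𝓀[F] ^ 2 := by
  obtain ⟨τ, hτ, hτ'⟩ := h.exists_sub_sigma
  obtain ⟨hne, hord⟩ := ord_eq_zero_of_mem (sub_mem hτ (h.sigma_mem_lat.mpr hτ)) hτ'
  have hσδ : σ (τ - σ τ) = -(τ - σ τ) := by rw [map_sub, h.invol]; ring
  let e (p : 𝓀[F] × 𝓀[F]) : 𝓀[E] :=
    IsLocalRing.residue 𝒪[E] ⟨algebraMap F E p.1.out.1 + algebraMap F E p.2.out.1 * τ,
      mem_lat_zero.mp (add_mem (h.algebraMap_mem_lat.mpr (mem_lat_zero.mpr p.1.out.2))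
        (mul_mem_lat_zero (h.algebraMap_mem_lat.mpr (mem_lat_zero.mpr p.2.out.2)) hτ))⟩
  have hres (x : 𝓀[F]) : IsLocalRing.residue 𝒪[F] x.out = x := Quotient.out_eq' x
  have key (a b : F) (hm : algebraMap F E a + algebraMap F E b * τ ∈ lat E 1) :
      a ∈ lat F 1 ∧ b ∈ lat F 1 := by
    have hb : b ∈ lat F 1 := by
      have h1 := sub_mem hm (h.sigma_mem_lat.mpr hm)
      rw [map_add, map_mul, AlgEquiv.commutes, AlgEquiv.commutes,
        show algebraMap F E a + algebraMap F E b * τ - (algebraMap F E a + algebraMap F E b * σ τ) =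
          (τ - σ τ) * algebraMap F E b by ring, mul_mem_lat_iff hne, hord, sub_zero,
        h.algebraMap_mem_lat] at h1
      exact h1
    refine ⟨?_, hb⟩
    have h1 := sub_mem hm (mul_mem_lat_right (h.algebraMap_mem_lat.mpr hb) hτ)
    rwa [add_sub_cancel_right, h.algebraMap_mem_lat] at h1
  have hbij : Function.Bijective e := by
    constructor
    · rintro ⟨a, b⟩ ⟨a', b'⟩ hab
      simp only [e] at hab
      rw [residue_eq_residue_iff] at hab
      have h1 := key (a.out.1 - a'.out.1) (b.out.1 - b'.out.1) (by
        convert! hab using 1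
        rw [map_sub, map_sub]
        ring)
      rw [← residue_eq_residue_iff, ← residue_eq_residue_iff, hres, hres, hres, hres] at h1
      exact Prod.ext h1.1 h1.2
    · intro y
      obtain ⟨⟨y, hy⟩, rfl⟩ := IsLocalRing.residue_surjective y
      rw [← mem_lat_zero] at hy
      obtain ⟨b, hb⟩ := h.exists_of_fixed (x := (y - σ y) / (τ - σ τ)) (by
        rw [map_div₀, hσδ, map_sub, h.invol, ← neg_sub, neg_div_neg_eq])
      have hb' : algebraMap F E b * (τ - σ τ) = y - σ y := by rw [hb, div_mul_cancel₀ _ hne]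
      obtain ⟨a, ha⟩ := h.exists_of_fixed (x := y - algebraMap F E b * τ) (by
        rw [map_sub, map_mul, AlgEquiv.commutes]
        linear_combination hb')
      have hbm : b ∈ lat F 0 := by
        rw [← h.algebraMap_mem_lat, hb, div_eq_inv_mul, mul_mem_lat_iff (inv_ne_zero hne), ord_inv,
          hord]
        exact sub_mem hy (h.sigma_mem_lat.mpr hy)
      have ham : a ∈ lat F 0 := by
        rw [← h.algebraMap_mem_lat, ha]
        exact sub_mem hy (mul_mem_lat_zero (h.algebraMap_mem_lat.mpr hbm) hτ)
      refine ⟨⟨IsLocalRing.residue 𝒪[F] ⟨a, mem_lat_zero.mp ham⟩,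
        IsLocalRing.residue 𝒪[F] ⟨b, mem_lat_zero.mp hbm⟩⟩, ?_⟩
      simp only [e]
      rw [residue_eq_residue_iff]
      have h1 := residue_eq_residue_iff.mp (hres (IsLocalRing.residue 𝒪[F] ⟨a, mem_lat_zero.mp ham⟩))
      have h2 := residue_eq_residue_iff.mp (hres (IsLocalRing.residue 𝒪[F] ⟨b, mem_lat_zero.mp hbm⟩))
      rw [← h.algebraMap_mem_lat, map_sub] at h1 h2
      have h3 := add_mem h1 (mul_mem_lat_right h2 hτ)
      convert! h3 using 1
      change _ + _ * τ - y = _ - algebraMap F E a + (_ - algebraMap F E b) * τ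
      linear_combination ha
  rw [← Nat.card_congr (Equiv.ofBijective e hbij), Nat.card_prod, sq]

end IsUnramQuad

end Quadratic

/-! ### Uniqueness of the coefficients of Laurent polynomials -/

section Laurent

/-- The monomial `(α, β) ↦ α^a β^d`. -/
def monomialHom (p : ℤ × ℤ) : ℂˣ × ℂˣ →* ℂ where
  toFun x := ((x.1 ^ p.1 * x.2 ^ p.2 : ℂˣ) : ℂ)
  map_one' := by simp
  map_mul' x y := by
    rw [← Units.val_mul, Prod.fst_mul, Prod.snd_mul, mul_zpow, mul_zpow]
    congr 1
    exact mul_mul_mul_comm _ _ _ _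

lemma monomialHom_injective : Function.Injective monomialHom := by
  have h2 : (2 : ℝ) ≠ 0 := by norm_num
  have key (a b : ℤ) (h : (2 : ℂ) ^ a = 2 ^ b) : a = b := by
    have h1 : (((2 : ℝ) ^ a : ℝ) : ℂ) = ((2 : ℝ) ^ b : ℝ) := by
      push_cast
      exact h
    exact zpow_right_injective₀ (by norm_num) (by norm_num) (Complex.ofReal_injective h1)
  rintro ⟨a, d⟩ ⟨a', d'⟩ h
  have e1 := DFunLike.congr_fun h (Units.mk0 2 (by norm_num), 1)
  have e2 := DFunLike.congr_fun h (1, Units.mk0 2 (by norm_num))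
  simp only [monomialHom, MonoidHom.coe_mk, OneHom.coe_mk, one_zpow, mul_one, one_mul,
    Units.val_zpow_eq_zpow_val, Units.val_mk0] at e1 e2
  rw [key _ _ e1, key _ _ e2]

/-- Distinct monomials are distinct characters of `ℂˣ × ℂˣ`, hence linearly independent by Dedekind.
-/
lemma eq_zero_of_laurent {x : ℤ × ℤ → ℂ} (hx : {p | x p ≠ 0}.Finite)
    (h : ∀ α β : ℂˣ, ∑' p : ℤ × ℤ, x p * ((α ^ p.1 : ℂˣ) * (β ^ p.2 : ℂˣ)) = 0) : x = 0 := by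
  have hli := (linearIndependent_monoidHom (ℂˣ × ℂˣ) ℂ).comp _ monomialHom_injective
  rw [linearIndependent_iff'] at hli
  have hz := hli hx.toFinset x (by
    funext ⟨α, β⟩
    rw [Finset.sum_apply, Pi.zero_apply]
    refine Eq.trans ?_ (h α β)
    rw [tsum_eq_sum (s := hx.toFinset)]
    · refine Finset.sum_congr rfl fun p _ => ?_
      simp [monomialHom]
    · intro p hp
      have : x p = 0 := by simpa using hp
      rw [this, zero_mul])
  funext p
  by_contra hp
  exact hp (hz p (by simpa using hp))

lemma finite_satakeCoef {q : ℂ} {B : ℕ} {c : ℕ → ℤ → ℂ}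
    (hc : {p : ℕ × ℤ | c p.1 p.2 ≠ 0}.Finite) :
    {p : ℤ × ℤ | satakeCoef q B c p.1 p.2 ≠ 0}.Finite := by
  have hfin : (⋃ k ∈ Finset.range B,
      ((fun p : ℕ × ℤ => (p.2 + (k : ℤ), p.1 + p.2 - (k : ℤ))) '' {p | c p.1 p.2 ≠ 0} ∪
      (fun p : ℕ × ℤ => (p.1 + p.2, p.2)) '' {p | c p.1 p.2 ≠ 0})).Finite :=
    (Finset.range B).finite_toSet.biUnion fun k _ => (hc.image _).union (hc.image _)
  refine hfin.subset ?_
  rintro ⟨a, d⟩ hp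
  obtain ⟨k, hk, hne⟩ := Finset.exists_ne_zero_of_sum_ne_zero hp
  refine Set.mem_iUnion₂.mpr ⟨k, hk, ?_⟩
  rcases le_total (a - k) d with hle | hle
  · left
    refine ⟨((a + d - 2 * min (a - k) d).toNat, min (a - k) d),
      right_ne_zero_of_mul hne, ?_⟩
    simp only [Prod.mk.injEq]
    omega
  · right
    refine ⟨((a + d - 2 * min (a - k) d).toNat, min (a - k) d),
      right_ne_zero_of_mul hne, ?_⟩
    simp only [Prod.mk.injEq]
    omega

lemma finite_bcSatake {q : ℂ} {B : ℕ} {c : ℕ → ℤ → ℂ}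
    (hc : {p : ℕ × ℤ | c p.1 p.2 ≠ 0}.Finite) :
    {p : ℤ × ℤ | bcSatake q B c p.1 p.2 ≠ 0}.Finite := by
  refine ((finite_satakeCoef (q := q ^ 2) (B := B) hc).image fun p => (2 * p.1, 2 * p.2)).subset ?_
  rintro ⟨a, d⟩ hp
  simp only [Set.mem_ofPred_eq, bcSatake] at hp
  split_ifs at hp with he
  · refine ⟨(a / 2, d / 2), hp, ?_⟩
    rw [Int.even_iff, Int.even_iff] at he
    simp only [Prod.mk.injEq]
    omega
  · exact absurd rfl hp

end Laurent

/-! ### The base change identity in terms of coefficients -/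

section BaseChange

variable {F E : Type*} [Field F] [Field E] [Algebra F E]
  [ValuativeRel F] [TopologicalSpace F] [IsNonarchimedeanLocalField F]
  [ValuativeRel E] [TopologicalSpace E] [IsNonarchimedeanLocalField E]
  [ValuativeExtension F E]

/-- The unramified character of `Lˣ` with the value `α` at the uniformizers. -/
def unramChar (L : Type*) [Field L] [ValuativeRel L] [TopologicalSpace L]
    [IsNonarchimedeanLocalField L] (α : ℂˣ) : Lˣ →* ℂˣ where
  toFun u := α ^ ord (u : L)
  map_one' := by simp [ord_one]
  map_mul' u v := by rw [Units.val_mul, ord_mul u.ne_zero v.ne_zero, zpow_add]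

lemma unramChar_apply_of_valuation {L : Type*} [Field L] [ValuativeRel L] [TopologicalSpace L]
    [IsNonarchimedeanLocalField L] (α : ℂˣ) (u : Lˣ) (hu : valuation L (u : L) = 1) :
    unramChar L α u = 1 := by
  rw [← ord_eq_zero_iff_valuation u.ne_zero] at hu
  change α ^ ord (u : L) = 1
  rw [hu, zpow_zero]

/-- The group of units of the ring of integers. -/
def unitGroup (L : Type*) [Field L] [ValuativeRel L] [TopologicalSpace L]
    [IsNonarchimedeanLocalField L] : Subgroup Lˣ := (ordHom (L := L)).ker

lemma mem_unitGroup {L : Type*} [Field L] [ValuativeRel L] [TopologicalSpace L]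
    [IsNonarchimedeanLocalField L] {u : Lˣ} : u ∈ unitGroup L ↔ ord (u : L) = 0 := by
  rw [unitGroup, MonoidHom.mem_ker]
  exact Iff.rfl

lemma isOpen_unitGroup {L : Type*} [Field L] [ValuativeRel L] [TopologicalSpace L]
    [IsNonarchimedeanLocalField L] : IsOpen (unitGroup L : Set Lˣ) := by
  refine Subgroup.isOpen_of_mem_nhds (g := 1) _ ?_
  have hS : IsOpen ((fun u : Lˣ => (u : L) - 1) ⁻¹' (lat L 1 : Set L)) :=
    (isOpen_lat 1).preimage (Units.continuous_val.sub continuous_const)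
  refine Filter.mem_of_superset (hS.mem_nhds (by simp)) fun u hu => ?_
  have h1 := (ord_add_eq_left (one_ne_zero (α := L)) (y := (u : L) - 1) (by
    rw [ord_one]
    exact hu)).2
  rw [add_sub_cancel, ord_one] at h1
  exact mem_unitGroup.mpr h1

lemma continuous_unramChar {L : Type*} [Field L] [ValuativeRel L] [TopologicalSpace L]
    [IsNonarchimedeanLocalField L] (α : ℂˣ) : Continuous (unramChar L α) := by
  refine IsLocallyConstant.continuous ((IsLocallyConstant.iff_exists_open _).mpr fun x => ?_)
  refine ⟨(fun y => x⁻¹ * y) ⁻¹' (unitGroup L : Set Lˣ),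
    isOpen_unitGroup.preimage (continuous_const_mul _), by simp [one_mem], fun y hy => ?_⟩
  have h1 : unramChar L α (x⁻¹ * y) = 1 :=
    unramChar_apply_of_valuation α _ ((ord_eq_zero_iff_valuation (Units.ne_zero _)).mp
      (mem_unitGroup.mp hy))
  rw [map_mul, map_inv, inv_mul_eq_one] at h1
  exact h1.symm

variable [MeasurableSpace (GL (Fin 2) F)] [BorelSpace (GL (Fin 2) F)]
  [MeasurableSpace (GL (Fin 2) E)] [BorelSpace (GL (Fin 2) E)]
  (μE : Measure (GL (Fin 2) E)) [μE.IsHaarMeasure]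
  (μF : Measure (GL (Fin 2) F)) [μF.IsHaarMeasure]
  {σ : E ≃ₐ[F] E} (hQ : IsUnramQuad σ) {ϖ : Fˣ} (hϖ : ord (ϖ : F) = 1)

namespace IsUnramQuad

include hQ

lemma ord_unitsNorm (u : Eˣ) : ord (unitsNorm F E u : F) = 2 * ord (u : E) := by
  rw [← hQ.ord_algebraMap]
  change ord (algebraMap F E (Algebra.norm F (u : E))) = _
  rw [hQ.algebraMap_norm, ord_mul u.ne_zero (by simp), hQ.ord_sigma]
  ring

/-- The norm maps the units of `E` onto those of `F`. -/
lemma unramified_comp_norm_iff (χ : Fˣ →* ℂˣ) :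
    (∀ u : Eˣ, valuation E (u : E) = 1 → χ.comp (unitsNorm F E) u = 1) ↔
      ∀ u : Fˣ, valuation F (u : F) = 1 → χ u = 1 := by
  constructor
  · intro h u hu
    rw [← ord_eq_zero_iff_valuation u.ne_zero] at hu
    obtain ⟨y, hy, hyu⟩ := hQ.exists_norm_eq u.ne_zero hu
    rw [ord_eq_zero_iff_valuation y.ne_zero] at hy
    rw [← h y hy, MonoidHom.comp_apply]
    congr 1
    ext
    apply (algebraMap F E).injective
    rw [← hyu]
    exact (hQ.algebraMap_norm _).symm
  · intro h u hu
    rw [← ord_eq_zero_iff_valuation u.ne_zero] at hu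
    refine h _ ?_
    rw [← ord_eq_zero_iff_valuation (Units.ne_zero _), hQ.ord_unitsNorm, hu, mul_zero]

include hϖ

/-- As `Nm ϖ = ϖ²` up to a unit, `χ ∘ Nm` takes the value `χ(ϖ)²` at `ϖ`: the sum over `E` is a sum
over pairs of even exponents. Since `q_E = q²`, the modulus factors agree as well. -/
lemma hasSum_trace_baseChange {χ₁ χ₂ : Fˣ →* ℂˣ} (f : sphericalHecke E)
    (h₁ : ∀ u : Fˣ, valuation F (u : F) = 1 → χ₁ u = 1)
    (h₂ : ∀ u : Fˣ, valuation F (u : F) = 1 → χ₂ u = 1)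
    {B : ℕ} (hB : BoundedBy B (coef (unitsIncl F E ϖ) f.1)) :
    HasSum (fun p : ℤ × ℤ => μE.real (maxCompact E) *
      (bcSatake (Nat.card 𝓀[F]) B (coef (unitsIncl F E ϖ) f.1) p.1 p.2 *
      ((χ₁ ϖ ^ p.1 : ℂˣ) * (χ₂ ϖ ^ p.2 : ℂˣ) *
      (Real.sqrt ((Nat.card 𝓀[F] : ℝ) ^ (p.2 - p.1)) : ℂ))))
    (finiteRankTrace (heckeOp μE (χ₁.comp (unitsNorm F E)) (χ₂.comp (unitsNorm F E)) f)) := by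
  have hϖE : ord (unitsIncl F E ϖ : E) = 1 := by rw [hQ.ord_unitsIncl, hϖ]
  have h := hasSum_trace hϖE μE f ((hQ.unramified_comp_norm_iff χ₁).mpr h₁)
    ((hQ.unramified_comp_norm_iff χ₂).mpr h₂) hB
  have hinj : Function.Injective fun p : ℤ × ℤ => (2 * p.1, 2 * p.2) := by
    rintro ⟨a, d⟩ ⟨a', d'⟩ hp
    simp only [Prod.mk.injEq] at hp ⊢
    omega
  rw [← hinj.hasSum_iff]
  · convert! h using 1
    funext ⟨a, d⟩
    have hχ (χ : Fˣ →* ℂˣ) (hχ : ∀ u : Fˣ, valuation F (u : F) = 1 → χ u = 1) (n : ℤ) :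
        χ.comp (unitsNorm F E) (unitsIncl F E ϖ) ^ n = χ ϖ ^ (2 * n) := by
      rw [MonoidHom.comp_apply, apply_eq_zpow_ord hϖ hχ, hQ.ord_unitsNorm, hϖE, ← zpow_mul,
        mul_one]
    rw [hχ χ₁ h₁, hχ χ₂ h₂]
    simp only [Function.comp_apply, bcSatake]
    rw [if_pos ⟨even_two_mul a, even_two_mul d⟩, show 2 * a / 2 = a by omega,
      show 2 * d / 2 = d by omega, hQ.card_residue]
    have hq : (((Nat.card 𝓀[F] ^ 2 : ℕ) : ℝ)) ^ (d - a) = (Nat.card 𝓀[F] : ℝ) ^ (2 * d - 2 * a) := by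
      rw [Nat.cast_pow, ← zpow_natCast, ← zpow_mul]
      congr 1
      push_cast
      ring
    rw [hq]
    push_cast
    rfl
  · rintro ⟨a, d⟩ hp
    simp only [bcSatake]
    rw [if_neg, zero_mul, mul_zero]
    rintro ⟨⟨a, rfl⟩, ⟨d, rfl⟩⟩
    exact hp ⟨(a, d), by simp [two_mul]⟩

/-- Unramified characters with arbitrary values at `ϖ` give an identity of Laurent polynomials, so
the coefficients agree. If one of the characters is ramified, both traces vanish. -/
lemma isHeckeBaseChange_iff (f : sphericalHecke E) (h : sphericalHecke F) {B B' : ℕ}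
    (hB : BoundedBy B (coef (unitsIncl F E ϖ) f.1)) (hB' : BoundedBy B' (coef ϖ h.1)) :
    IsHeckeBaseChange μE μF f h ↔ ∀ a d, μF.real (maxCompact F) *
      satakeCoef (Nat.card 𝓀[F]) B' (coef ϖ h.1) a d = μE.real (maxCompact E) *
      bcSatake (Nat.card 𝓀[F]) B (coef (unitsIncl F E ϖ) f.1) a d := by
  have hϖE : ord (unitsIncl F E ϖ : E) = 1 := by rw [hQ.ord_unitsIncl, hϖ]
  have hq : (0 : ℝ) < Nat.card 𝓀[F] := by exact_mod_cast Nat.card_pos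
  constructor
  · intro hbc
    let x (p : ℤ × ℤ) : ℂ := (μF.real (maxCompact F) *
      satakeCoef (Nat.card 𝓀[F]) B' (coef ϖ h.1) p.1 p.2 - μE.real (maxCompact E) *
      bcSatake (Nat.card 𝓀[F]) B (coef (unitsIncl F E ϖ) f.1) p.1 p.2) *
      (Real.sqrt ((Nat.card 𝓀[F] : ℝ) ^ (p.2 - p.1)) : ℂ)
    have hx : x = 0 := by
      refine eq_zero_of_laurent ?_ fun α β => ?_
      · refine ((finite_satakeCoef (q := Nat.card 𝓀[F]) (B := B') (finite_coef hϖ h.2)).union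
          (finite_bcSatake (q := Nat.card 𝓀[F]) (B := B) (finite_coef hϖE f.2))).subset ?_
        intro p hp
        by_contra hnot
        simp only [Set.mem_union, Set.mem_ofPred_eq, not_or, not_not] at hnot
        exact hp (by simp only [x, hnot.1, hnot.2]; simp)
      · have e1 := hasSum_trace hϖ μF h (unramChar_apply_of_valuation α)
          (unramChar_apply_of_valuation β) hB'
        have e2 := hQ.hasSum_trace_baseChange μE hϖ f (unramChar_apply_of_valuation α)
          (unramChar_apply_of_valuation β) hB
        rw [hbc _ _ (continuous_unramChar α) (continuous_unramChar β)] at e2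
        have e3 := (e1.sub e2).tsum_eq
        rw [sub_self] at e3
        rw [← e3]
        refine tsum_congr fun p => ?_
        have hα : unramChar F α ϖ = α := by
          change α ^ ord (ϖ : F) = α
          rw [hϖ, zpow_one]
        have hβ : unramChar F β ϖ = β := by
          change β ^ ord (ϖ : F) = β
          rw [hϖ, zpow_one]
        rw [hα, hβ]
        simp only [x]
        ring
    intro a d
    have h1 := congrFun hx (a, d)
    simp only [x, Pi.zero_apply, mul_eq_zero, Complex.ofReal_eq_zero] at h1
    rcases h1 with h1 | h1
    · exact sub_eq_zero.mp h1
    · rw [Real.sqrt_eq_zero (by positivity)] at h1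
      exact absurd h1 (by positivity)
  · intro heq χ₁ χ₂ _ _
    by_cases hu : (∀ u : Fˣ, valuation F (u : F) = 1 → χ₁ u = 1) ∧
      ∀ u : Fˣ, valuation F (u : F) = 1 → χ₂ u = 1
    · rw [← (hQ.hasSum_trace_baseChange μE hϖ f hu.1 hu.2 hB).tsum_eq,
        ← (hasSum_trace hϖ μF h hu.1 hu.2 hB').tsum_eq]
      refine tsum_congr fun p => ?_
      rw [← mul_assoc, ← mul_assoc, ← heq]
      ring
    · rw [trace_eq_zero_of_ramified μF h hu, trace_eq_zero_of_ramified]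
      rw [hQ.unramified_comp_norm_iff, hQ.unramified_comp_norm_iff]
      exact hu

end IsUnramQuad

lemma coef_injective {L : Type*} [Field L] [ValuativeRel L] [TopologicalSpace L]
    [IsNonarchimedeanLocalField L] {ϖ : Lˣ} (hϖ : ord (ϖ : L) = 1) {h h' : sphericalHecke L}
    (he : coef ϖ h.1 = coef ϖ h'.1) : h = h' := by
  refine Subtype.ext (funext fun g => ?_)
  rw [apply_eq_ofCoef hϖ h.2.2, apply_eq_ofCoef hϖ h'.2.2, he]

lemma real_maxCompact_ne_zero {L : Type*} [Field L] [ValuativeRel L] [TopologicalSpace L]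
    [IsNonarchimedeanLocalField L] [MeasurableSpace (GL (Fin 2) L)] [BorelSpace (GL (Fin 2) L)]
    (μ : Measure (GL (Fin 2) L)) [μ.IsHaarMeasure] : μ.real (maxCompact L) ≠ 0 := by
  rw [measureReal_def, ENNReal.toReal_ne_zero]
  exact ⟨(isOpen_maxCompact.measure_pos μ ⟨1, one_mem _⟩).ne',
    isCompact_maxCompact.measure_lt_top.ne⟩

include hQ hϖ in
/-- A function whose values satisfy the difference relation with the function on Hermitian
matrices is the base change. -/
lemma isHeckeBaseChange_iff_eq (V : ℂ) (f : sphericalHecke E) (h : sphericalHecke F) {B B' : ℕ}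
    (hB : BoundedBy B (coef (unitsIncl F E ϖ) f.1)) (hB' : BoundedBy B' (coef ϖ h.1))
    (hD : ∀ l m, coef ϖ h.1 l m - coef ϖ h.1 (l + 2) (m - 1) = (-1) ^ m *
      (V * hermCoef (Nat.card 𝓀[F]) B (coef (unitsIncl F E ϖ) f.1) l m -
       V * hermCoef (Nat.card 𝓀[F]) B (coef (unitsIncl F E ϖ) f.1) (l + 2) (m - 1)))
    (h' : sphericalHecke F) :
    IsHeckeBaseChange μE μF
      ((V * μF.real (maxCompact F) / μE.real (maxCompact E)) • f) h' ↔ h' = h := by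
  have hϖE : ord (unitsIncl F E ϖ : E) = 1 := by rw [hQ.ord_unitsIncl, hϖ]
  set q : ℂ := (Nat.card 𝓀[F] : ℂ)
  set c := coef (unitsIncl F E ϖ) f.1
  have hvF : (μF.real (maxCompact F) : ℂ) ≠ 0 := by exact_mod_cast real_maxCompact_ne_zero μF
  have hvE : (μE.real (maxCompact E) : ℂ) ≠ 0 := by exact_mod_cast real_maxCompact_ne_zero μE
  set r : ℂ := V * μF.real (maxCompact F) / μE.real (maxCompact E) with hr
  have hcoef : coef (unitsIncl F E ϖ) (r • f).1 = fun l m => r * c l m := rfl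
  have hBr : BoundedBy B (coef (unitsIncl F E ϖ) (r • f).1) := fun l hl m => by
    rw [hcoef]
    simp only
    rw [hB l hl, mul_zero]
  have hBV : BoundedBy B (fun l m => V * c l m) := fun l hl m => by
    simp only
    rw [hB l hl, mul_zero]
  have hsat (s : ℂ) (a d : ℤ) : bcSatake q B (fun l m => s * c l m) a d = s * bcSatake q B c a d := by
    simp only [bcSatake, satakeCoef, mul_ite, mul_zero, Finset.mul_sum]
    congr 1
    exact Finset.sum_congr rfl fun k _ => by ring
  have hherm (l : ℕ) (m : ℤ) : hermCoef q B (fun l m => V * c l m) l m = V * hermCoef q B c l m := by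
    simp only [hermCoef, mul_ite, mul_zero, Finset.mul_sum]
    congr 1
    refine Finset.sum_congr rfl fun k _ => ?_
    split_ifs
    · ring
    · rfl
  obtain ⟨B'', hB''⟩ := exists_bound_of_finite (finite_coef hϖ h'.2)
  rw [hQ.isHeckeBaseChange_iff μE μF hϖ _ h' hBr hB'', hcoef]
  -- The volumes of `K` and `K₁` in the two traces cancel against the normalizing factor `r`, which
  -- leaves the function with values `V * c`.
  have h1 : (∀ a d, (μF.real (maxCompact F) : ℂ) * satakeCoef q B'' (coef ϖ h'.1) a d =
      μE.real (maxCompact E) * bcSatake q B (fun l m => r * c l m) a d) ↔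
      satakeCoef q B'' (coef ϖ h'.1) = bcSatake q B (fun l m => V * c l m) := by
    rw [funext_iff]
    refine forall_congr' fun a => ?_
    rw [funext_iff]
    refine forall_congr' fun d => ?_
    rw [hsat, hsat, ← mul_assoc, show (μE.real (maxCompact E) : ℂ) * r = μF.real (maxCompact F) * V by
      rw [hr]; field_simp, mul_assoc, mul_right_inj' hvF]
  rw [h1, satakeCoef_eq_bcSatake_iff hBV hB'']
  have h2 : raySum q B' (coef ϖ h.1) = bcRay q B (fun l m => V * c l m) :=
    raySum_bcCoef hBV hB' fun l m => by rw [hherm, hherm]; exact hD l m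
  rw [← h2]
  constructor
  · intro h3
    exact coef_injective hϖ (eq_of_raySum_eq hB'' hB' h3)
  · rintro rfl
    rw [h2, ← satakeCoef_eq_bcSatake_iff hBV hB'', satakeCoef_eq_bcSatake_iff hBV hB'']
    exact raySum_bcCoef hBV hB'' fun l m => by rw [hherm, hherm]; exact hD l m

end BaseChange

/-! ### The action of GL₂(E) on Hermitian matrices -/

section ConjTranspose

variable {F E : Type*} [Field F] [Field E] [Algebra F E] (σ : E ≃ₐ[F] E)

/-- The conjugate transpose of an invertible matrix. -/
def ctGL (g : GL (Fin 2) E) : GL (Fin 2) E where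
  val := conjT σ g.1
  inv := conjT σ g⁻¹.1
  val_inv := by rw [← conjT_mul, Units.inv_mul, conjT_one]
  inv_val := by rw [← conjT_mul, Units.mul_inv, conjT_one]

lemma ctGL_apply (g : GL (Fin 2) E) (i j : Fin 2) : (ctGL σ g).1 i j = σ (g.1 j i) := rfl

lemma ctGL_mul (g h : GL (Fin 2) E) : ctGL σ (g * h) = ctGL σ h * ctGL σ g :=
  Units.ext (conjT_mul σ g.1 h.1)

lemma ctGL_one : ctGL σ (1 : GL (Fin 2) E) = 1 := Units.ext (conjT_one σ)

variable {σ} in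
lemma ctGL_ctGL (hσ : Function.Involutive σ) (g : GL (Fin 2) E) : ctGL σ (ctGL σ g) = g := by
  refine Units.ext (Matrix.ext fun i j => ?_)
  rw [ctGL_apply, ctGL_apply, hσ]

lemma det_ctGL (g : GL (Fin 2) E) : (ctGL σ g).1.det = σ g.1.det := by
  rw [Matrix.det_fin_two, Matrix.det_fin_two]
  simp only [ctGL_apply, map_sub, map_mul]
  ring

/-- The action `g · s = g s ḡᵗ`. -/
def hermConj (g s : GL (Fin 2) E) : GL (Fin 2) E := g * s * ctGL σ g

lemma hermConj_apply (g s : GL (Fin 2) E) (i j : Fin 2) :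
    (hermConj σ g s).1 i j = (g.1 i 0 * s.1 0 0 + g.1 i 1 * s.1 1 0) * σ (g.1 j 0) +
      (g.1 i 0 * s.1 0 1 + g.1 i 1 * s.1 1 1) * σ (g.1 j 1) := by
  change ((g.1 * s.1) * (ctGL σ g).1) i j = _
  rw [Matrix.mul_apply, Fin.sum_univ_two, Matrix.mul_apply, Matrix.mul_apply, Fin.sum_univ_two,
    Fin.sum_univ_two]
  rfl

lemma hermConj_mul (g h s : GL (Fin 2) E) :
    hermConj σ (g * h) s = hermConj σ g (hermConj σ h s) := by
  simp only [hermConj, ctGL_mul, mul_assoc]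

lemma hermConj_one (s : GL (Fin 2) E) : hermConj σ 1 s = s := by
  simp [hermConj, ctGL_one]

lemma hermConj_inv_self (g s : GL (Fin 2) E) : hermConj σ g⁻¹ (hermConj σ g s) = s := by
  rw [← hermConj_mul, inv_mul_cancel, hermConj_one]

lemma hermConj_self_inv (g s : GL (Fin 2) E) : hermConj σ g (hermConj σ g⁻¹ s) = s := by
  rw [← hermConj_mul, mul_inv_cancel, hermConj_one]

variable {σ} in
lemma ctGL_hermConj (hσ : Function.Involutive σ) {s : GL (Fin 2) E} (hs : ctGL σ s = s)
    (g : GL (Fin 2) E) : ctGL σ (hermConj σ g s) = hermConj σ g s := by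
  simp only [hermConj, ctGL_mul, ctGL_ctGL hσ, hs, mul_assoc]

lemma mem_unitaryGroup_iff {g : GL (Fin 2) E} :
    g ∈ unitaryGroup σ ↔ hermConj σ g (swapMat E) = swapMat E := by
  rw [Units.ext_iff]
  rfl

lemma eq_hermConj_iff {s g : GL (Fin 2) E} :
    s = hermConj σ g (swapMat E) ↔ s.1 = g.1 * wMat E * conjT σ g.1 := by
  rw [Units.ext_iff]
  rfl

end ConjTranspose

/-! ### Classification of Hermitian matrices under GL₂(𝒪) -/

section Classification

variable {F E : Type*} [Field F] [Field E] [Algebra F E]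
  [ValuativeRel F] [TopologicalSpace F] [IsNonarchimedeanLocalField F]
  [ValuativeRel E] [TopologicalSpace E] [IsNonarchimedeanLocalField E]
  [ValuativeExtension F E] {σ : E ≃ₐ[F] E}

namespace IsUnramQuad

variable (hQ : IsUnramQuad σ)

include hQ

lemma content_ctGL (g : GL (Fin 2) E) : content (ctGL σ g).1 = content g.1 := by
  refine content_eq_of_forall fun n => ?_
  simp only [ctGL_apply, hQ.sigma_mem_lat]
  exact ⟨fun h i j => h j i, fun h i j => h j i⟩

lemma ord_det_ctGL (g : GL (Fin 2) E) : ord (ctGL σ g).1.det = ord g.1.det := by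
  rw [det_ctGL, hQ.ord_sigma]

lemma ctGL_mem {g : GL (Fin 2) E} : ctGL σ g ∈ maxCompact E ↔ g ∈ maxCompact E := by
  rw [mem_maxCompact_iff', mem_maxCompact_iff', hQ.content_ctGL, hQ.ord_det_ctGL]

lemma content_hermConj {k : GL (Fin 2) E} (hk : k ∈ maxCompact E) (s : GL (Fin 2) E) :
    content (hermConj σ k s).1 = content s.1 := by
  rw [hermConj, content_mul_right (hQ.ctGL_mem.mpr hk), content_mul_left hk]

lemma ord_det_hermConj (g s : GL (Fin 2) E) :
    ord (hermConj σ g s).1.det = ord s.1.det + 2 * ord g.1.det := by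
  rw [hermConj, ord_det_mul, ord_det_mul, hQ.ord_det_ctGL]
  ring

lemma hermConj_mem_iff {k : GL (Fin 2) E} (hk : k ∈ maxCompact E) (s : GL (Fin 2) E) :
    hermConj σ k s ∈ maxCompact E ↔ s ∈ maxCompact E := by
  rw [hermConj, Subgroup.mul_mem_cancel_right _ (hQ.ctGL_mem.mpr hk),
    Subgroup.mul_mem_cancel_left _ hk]

/-- A Hermitian matrix is equivalent to one whose lower right entry has minimal order. -/
lemma exists_corner {s : GL (Fin 2) E} (hs : ctGL σ s = s) :
    ∃ k ∈ maxCompact E, (hermConj σ k s).1 1 1 ≠ 0 ∧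
      ord ((hermConj σ k s).1 1 1) = content s.1 := by
  set m := content s.1 with hm
  have hent : ∀ i j, s.1 i j ∈ lat E m := (le_content_iff s).mp le_rfl
  by_cases h11 : s.1 1 1 ∈ lat E (m + 1)
  swap
  · refine ⟨1, one_mem _, ?_⟩
    rw [hermConj_one]
    have h0 : s.1 1 1 ≠ 0 := fun h => h11 (h ▸ zero_mem _)
    have h1 := (mem_lat_iff h0).mp (hent 1 1)
    rw [mem_lat_iff h0] at h11
    exact ⟨h0, by omega⟩
  by_cases h00 : s.1 0 0 ∈ lat E (m + 1)
  swap
  · refine ⟨swapMat E, swapMat_mem_maxCompact, ?_⟩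
    have he : (hermConj σ (swapMat E) s).1 1 1 = s.1 0 0 := by
      have hct : ctGL σ (swapMat E) = swapMat E := by
        refine Units.ext (Matrix.ext fun i j => ?_)
        rw [ctGL_apply, coe_swapMat]
        fin_cases i <;> fin_cases j <;> simp
      rw [hermConj, hct, mul_swapMat_apply, swapMat_mul_apply]
      simp
    rw [he]
    have h0 : s.1 0 0 ≠ 0 := fun h => h00 (h ▸ zero_mem _)
    have h1 := (mem_lat_iff h0).mp (hent 0 0)
    rw [mem_lat_iff h0] at h00
    exact ⟨h0, by omega⟩
  have h10 : s.1 1 0 = σ (s.1 0 1) := by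
    conv_lhs => rw [← hs]
    rfl
  have h01 : s.1 0 1 ∉ lat E (m + 1) := by
    intro h01
    have : m + 1 ≤ content s.1 := by
      rw [le_content_iff]
      intro i j
      fin_cases i <;> fin_cases j
      · exact h00
      · exact h01
      · exact h10 ▸ hQ.sigma_mem_lat.mpr h01
      · exact h11
    omega
  have hb0 : s.1 0 1 ≠ 0 := fun h => h01 (h ▸ zero_mem _)
  have hb : ord (s.1 0 1) = m := by
    have h1 := (mem_lat_iff hb0).mp (hent 0 1)
    rw [mem_lat_iff hb0] at h01
    omega
  -- Both diagonal entries are deeper than `s₀₁` here. Adding `c` times the first row to the second,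
  -- and likewise for columns, changes `s₁₁` by the trace of `c s₀₁` and deeper terms. The choice `c
  -- s₀₁ = ϖ^m t` makes this trace have order exactly `m`.
  obtain ⟨t, ht, htr⟩ := hQ.exists_trace_unit
  obtain ⟨ϖ, hϖ⟩ := exists_ord_eq_one (L := F)
  have hp0 : algebraMap F E ((ϖ ^ m : Fˣ) : F) ≠ 0 := by
    rw [map_ne_zero]
    exact Units.ne_zero _
  have hp : ord (algebraMap F E ((ϖ ^ m : Fˣ) : F)) = m := by
    rw [hQ.ord_algebraMap, ord_uniformizer_zpow hϖ]
  set p := algebraMap F E ((ϖ ^ m : Fˣ) : F) with hpdef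
  have hσp : σ p = p := σ.commutes _
  set c := p * (s.1 0 1)⁻¹ * t with hc
  have hcO : c ∈ lat E 0 := by
    have : p * (s.1 0 1)⁻¹ ∈ lat E 0 := by
      rw [mem_lat_iff (mul_ne_zero hp0 (inv_ne_zero hb0)), ord_mul hp0 (inv_ne_zero hb0), ord_inv,
        hp, hb]
      omega
    exact mul_mem_lat_zero this ht
  have hcb : c * s.1 0 1 = p * t := by rw [hc]; field_simp
  refine ⟨lowerMat c, lowerMat_mem_maxCompact hcO, ?_⟩
  have he : (hermConj σ (lowerMat c) s).1 1 1 =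
      p * (t + σ t) + (c * s.1 0 0 * σ c + s.1 1 1) := by
    have h1 : σ (s.1 0 1) * σ c = p * σ t := by
      rw [← map_mul, mul_comm, hcb, map_mul, hσp]
    have h2 : (hermConj σ (lowerMat c) s).1 1 1 =
        c * s.1 0 0 * σ c + s.1 1 0 * σ c + (c * s.1 0 1 + s.1 1 1) := by
      rw [hermConj_apply, coe_lowerMat]
      simp [add_mul]
    rw [h2, h10, h1, hcb]
    ring
  obtain ⟨ht0, hto⟩ := ord_eq_zero_of_mem (add_mem ht (hQ.sigma_mem_lat.mpr ht)) htr
  have h3 : ord (p * (t + σ t)) = m := by rw [ord_mul hp0 ht0, hp, hto, add_zero]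
  have h4 := ord_add_eq_left (mul_ne_zero hp0 ht0) (y := c * s.1 0 0 * σ c + s.1 1 1) (by
    rw [h3]
    exact add_mem (mul_mem_lat_right (mul_mem_lat_zero hcO h00) (hQ.sigma_mem_lat.mpr hcO)) h11)
  rw [he]
  exact ⟨h4.1, h4.2.trans h3⟩

/-- Every Hermitian matrix is equivalent under `GL₂(𝒪)` to a diagonal matrix of powers of the
uniformizer. -/
lemma exists_hermConj_eq_diag {ϖ : Fˣ} (hϖ : ord (ϖ : F) = 1) {s : GL (Fin 2) E}
    (hs : ctGL σ s = s) : ∃ k ∈ maxCompact E, hermConj σ k s =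
      borelMat (unitsIncl F E ϖ ^ (ord s.1.det - content s.1))
        (unitsIncl F E ϖ ^ content s.1) 0 := by
  obtain ⟨k₁, hk₁, h0, hord⟩ := hQ.exists_corner hs
  set s₁ := hermConj σ k₁ s with hs₁
  have hs₁' : ctGL σ s₁ = s₁ := ctGL_hermConj hQ.invol hs k₁
  have hc₁ : content s₁.1 = content s.1 := hQ.content_hermConj hk₁ s
  have hent : ∀ i j, s₁.1 i j ∈ lat E (content s.1) := hc₁ ▸ (le_content_iff s₁).mp le_rfl
  have hherm (i j) : σ (s₁.1 j i) = s₁.1 i j := by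
    conv_rhs => rw [← hs₁']
    rfl
  -- Orthogonalization with respect to the corner entry, which divides all others; the diagonal
  -- entries that result are fixed by `σ` and so lie in `F`.
  set b := -(s₁.1 0 1 * (s₁.1 1 1)⁻¹) with hb
  have hbO : b ∈ lat E 0 := by
    refine neg_mem ?_
    rw [mul_comm, mul_mem_lat_iff (inv_ne_zero h0), ord_inv, hord, zero_sub, neg_neg]
    exact hent 0 1
  have hk₂ : borelMat (1 : Eˣ) 1 b ∈ maxCompact E :=
    borelMat_mem_maxCompact.mpr ⟨ord_one, ord_one, hbO⟩
  have hb1 : s₁.1 0 1 + b * s₁.1 1 1 = 0 := by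
    rw [hb]
    field_simp
    ring
  have hb2 : s₁.1 1 0 + s₁.1 1 1 * σ b = 0 := by
    rw [← hherm 1 0, ← hherm 1 1, mul_comm, ← map_mul, ← map_add, hb1, map_zero]
  clear_value b
  obtain ⟨y, hy⟩ := hQ.exists_of_fixed (hherm 1 1)
  obtain ⟨x, hx⟩ := hQ.exists_of_fixed (x := s₁.1 0 0 + b * s₁.1 1 0) (by
    have : σ (b * s₁.1 1 0) = b * s₁.1 1 0 := by
      have h1 : s₁.1 1 0 = -(s₁.1 1 1 * σ b) := eq_neg_of_add_eq_zero_left hb2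
      have h2 : σ (s₁.1 1 1) = s₁.1 1 1 := hherm 1 1
      generalize s₁.1 1 1 = w at h1 h2
      rw [h1, map_mul, map_neg, map_mul, h2, hQ.invol]
      ring
    rw [map_add, this, hherm 0 0])
  have hval : (hermConj σ (borelMat 1 1 b) s₁).1 = !![algebraMap F E x, 0; 0, algebraMap F E y] := by
    rw [hx, hy]
    refine Matrix.ext fun i j => ?_
    rw [hermConj_apply, coe_borelMat]
    fin_cases i <;> fin_cases j <;> simp
    · exact Or.inl hb1
    · exact hb1
    · exact hb2
  have hdet : algebraMap F E x * algebraMap F E y = (hermConj σ (borelMat 1 1 b) s₁).1.det := by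
    rw [hval, Matrix.det_fin_two_of]
    ring
  have hne := det_ne_zero (hermConj σ (borelMat 1 1 b) s₁)
  rw [← hdet] at hne
  have hx0 : x ≠ 0 := fun h => hne (by simp [h])
  have hy0 : y ≠ 0 := fun h => hne (by simp [h])
  have hoy : ord y = content s.1 := by rw [← hQ.ord_algebraMap, hy, hord]
  have hox : ord x = ord s.1.det - content s.1 := by
    have h1 := congrArg ord hdet
    rw [ord_mul (by simpa using hx0) (by simpa using hy0), hQ.ord_algebraMap, hQ.ord_algebraMap,
      hoy, hQ.ord_det_hermConj, hs₁, hQ.ord_det_hermConj, (mem_maxCompact_iff.mp hk₁).2,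
      (mem_maxCompact_iff.mp hk₂).2] at h1
    omega
  -- Each diagonal entry can be changed by the norm of a unit, that is, by any unit of `F`, hence
  -- made a power of `ϖ`.
  have hscale {z : F} (hz : z ≠ 0) : ∃ u : Eˣ, ord (u : E) = 0 ∧
      u * algebraMap F E z * σ u = ((unitsIncl F E ϖ ^ ord z : Eˣ) : E) := by
    have hv0 : ((ϖ ^ ord z : Fˣ) : F) * z⁻¹ ≠ 0 := mul_ne_zero (Units.ne_zero _) (inv_ne_zero hz)
    obtain ⟨u, hu, hun⟩ := hQ.exists_norm_eq hv0 (by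
      rw [ord_mul (Units.ne_zero _) (inv_ne_zero hz), ord_uniformizer_zpow hϖ, ord_inv]
      omega)
    refine ⟨u, hu, ?_⟩
    have h1 : (u : E) * algebraMap F E z * σ u = algebraMap F E (ϖ ^ ord z : Fˣ) := by
      rw [mul_right_comm, hun, ← map_mul, mul_assoc, inv_mul_cancel₀ hz, mul_one]
    rw [h1, ← map_zpow]
    rfl
  obtain ⟨u, hu, hux⟩ := hscale hx0
  obtain ⟨v, hv, hvy⟩ := hscale hy0
  refine ⟨borelMat u v 0 * (borelMat 1 1 b * k₁),
    mul_mem (borelMat_mem_maxCompact.mpr ⟨hu, hv, zero_mem _⟩) (mul_mem hk₂ hk₁), ?_⟩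
  rw [hermConj_mul, hermConj_mul, ← hs₁]
  refine Units.ext ?_
  refine Matrix.ext fun i j => ?_
  rw [hermConj_apply, hval, coe_borelMat, coe_borelMat, ← hox, ← hoy, ← hux, ← hvy]
  fin_cases i <;> fin_cases j <;> simp

lemma exists_hermConj_eq {s s' : GL (Fin 2) E} (hs : ctGL σ s = s) (hs' : ctGL σ s' = s')
    (hc : content s.1 = content s'.1) (hd : ord s.1.det = ord s'.1.det) :
    ∃ k ∈ maxCompact E, s' = hermConj σ k s := by
  obtain ⟨ϖ, hϖ⟩ := exists_ord_eq_one (L := F)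
  obtain ⟨k, hk, h⟩ := hQ.exists_hermConj_eq_diag hϖ hs
  obtain ⟨k', hk', h'⟩ := hQ.exists_hermConj_eq_diag hϖ hs'
  refine ⟨k'⁻¹ * k, mul_mem (inv_mem hk') hk, ?_⟩
  rw [hermConj_mul, h, hc, hd, ← h', hermConj_inv_self]

/-- All Hermitian matrices in `K` have content and order of the determinant equal to zero, so they
form one `K`-orbit, that of `w`. -/
lemma exists_hermConj_swapMat {s : GL (Fin 2) E} (hs : ctGL σ s = s) (hK : s ∈ maxCompact E) :
    ∃ k ∈ maxCompact E, s = hermConj σ k (swapMat E) := by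
  have hct : ctGL σ (swapMat E) = swapMat E := by
    refine Units.ext (Matrix.ext fun i j => ?_)
    rw [ctGL_apply, coe_swapMat]
    fin_cases i <;> fin_cases j <;> simp
  have hc {g : GL (Fin 2) E} (hg : g ∈ maxCompact E) : content g.1 = 0 ∧ ord g.1.det = 0 := by
    obtain ⟨h1, h2⟩ := mem_maxCompact_iff'.mp hg
    have := two_content_le_ord_det g
    omega
  have h1 := hc hK
  have h2 := hc (swapMat_mem_maxCompact (L := E))
  exact hQ.exists_hermConj_eq hct hs (by rw [h1.1, h2.1]) (by rw [h1.2, h2.2])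

end IsUnramQuad

end Classification

/-! ### The function Φ_f as a sum over cosets of K -/

section OrbitMap

variable {F E : Type*} [Field F] [Field E] [Algebra F E]
  [ValuativeRel F] [TopologicalSpace F] [IsNonarchimedeanLocalField F]
  [ValuativeRel E] [TopologicalSpace E] [IsNonarchimedeanLocalField E]
  [ValuativeExtension F E] {σ : E ≃ₐ[F] E}
  [MeasurableSpace (GL (Fin 2) E)] [BorelSpace (GL (Fin 2) E)]
  (μH : Measure (unitaryGroup σ)) [μH.IsHaarMeasure]

/-- Any two choices of `g` differ by an element of `H₀` on the right, which the invariance of the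
measure absorbs. This frees `PhiOf` from the element chosen in its definition. -/
lemma PhiOf_hermConj {f : GL (Fin 2) E → ℂ} {s : Herm σ} {g : GL (Fin 2) E}
    (hs : s.1 = hermConj σ g (swapMat E)) :
    PhiOf σ μH f s = ∫ h : unitaryGroup σ, f (g * h.1) ∂μH := by
  have hex : ∃ g : GL (Fin 2) E, s.1.1 = g.1 * wMat E * conjT σ g.1 :=
    ⟨g, (eq_hermConj_iff σ).mp hs⟩
  rw [PhiOf, dif_pos hex]
  have h1 : s.1 = hermConj σ hex.choose (swapMat E) := (eq_hermConj_iff σ).mpr hex.choose_spec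
  have h2 : g⁻¹ * hex.choose ∈ unitaryGroup σ := by
    rw [mem_unitaryGroup_iff, hermConj_mul, ← h1, hs, hermConj_inv_self]
  rw [← integral_mul_left_eq_self (fun h : unitaryGroup σ => f (g * h.1)) ⟨_, h2⟩]
  refine integral_congr_ae (Filter.Eventually.of_forall fun h => ?_)
  simp only [Subgroup.coe_mul, ← mul_assoc, mul_inv_cancel, one_mul]

lemma PhiOf_eq_zero {f : GL (Fin 2) E → ℂ} {s : Herm σ}
    (hs : ∀ g, s.1 ≠ hermConj σ g (swapMat E)) : PhiOf σ μH f s = 0 := by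
  rw [PhiOf, dif_neg]
  rintro ⟨g, hg⟩
  exact hs g ((eq_hermConj_iff σ).mpr hg)

lemma PhiOf_equivariant {f : GL (Fin 2) E → ℂ} {k : GL (Fin 2) E} (hf : ∀ g, f (k * g) = f g)
    {s s' : Herm σ} (hs : s'.1 = hermConj σ k s.1) : PhiOf σ μH f s' = PhiOf σ μH f s := by
  by_cases h : ∃ g, s.1 = hermConj σ g (swapMat E)
  · obtain ⟨g, hg⟩ := h
    rw [PhiOf_hermConj μH hg, PhiOf_hermConj μH (g := k * g) (by rw [hs, hg, hermConj_mul])]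
    refine integral_congr_ae (Filter.Eventually.of_forall fun h => ?_)
    simp only [mul_assoc, hf]
  · rw [not_exists] at h
    rw [PhiOf_eq_zero μH h, PhiOf_eq_zero μH]
    intro g hg
    refine h (k⁻¹ * g) ?_
    rw [hermConj_mul, ← hg, hs, hermConj_inv_self]

namespace IsUnramQuad

variable (hQ : IsUnramQuad σ)

include hQ

lemma isClosed_unitaryGroup : IsClosed (unitaryGroup σ : Set (GL (Fin 2) E)) := by
  have h : (unitaryGroup σ : Set (GL (Fin 2) E)) =
      ⋂ i, ⋂ j, {g | (hermConj σ g (swapMat E)).1 i j = (swapMat E).1 i j} := by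
    ext g
    simp only [SetLike.mem_coe, mem_unitaryGroup_iff, Set.mem_iInter, Set.mem_ofPred_eq]
    exact ⟨fun h i j => by rw [h], fun h => Units.ext (Matrix.ext h)⟩
  rw [h]
  refine isClosed_iInter fun i => isClosed_iInter fun j => isClosed_eq ?_ continuous_const
  simp only [hermConj_apply]
  have c1 (i j) : Continuous fun g : GL (Fin 2) E => g.1 i j :=
    Units.continuous_val.matrix_elem i j
  have c2 (i j) : Continuous fun g : GL (Fin 2) E => σ (g.1 i j) :=
    hQ.continuous_sigma.comp (c1 i j)
  exact ((((c1 i 0).mul continuous_const).add ((c1 i 1).mul continuous_const)).mul (c2 j 0)).add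
    ((((c1 i 0).mul continuous_const).add ((c1 i 1).mul continuous_const)).mul (c2 j 1))

lemma measure_unitary_maxCompact :
    μH ((maxCompact E).subgroupOf (unitaryGroup σ)) ≠ ⊤ ∧
      μH.real {k : unitaryGroup σ | k.1 ∈ maxCompact E} ≠ 0 := by
  have hset : {k : unitaryGroup σ | k.1 ∈ maxCompact E} =
      (maxCompact E).subgroupOf (unitaryGroup σ) := rfl
  have hopen : IsOpen ((maxCompact E).subgroupOf (unitaryGroup σ) : Set (unitaryGroup σ)) :=
    isOpen_maxCompact.preimage continuous_subtype_val
  have hcomp : IsCompact ((maxCompact E).subgroupOf (unitaryGroup σ) : Set (unitaryGroup σ)) :=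
    (hQ.isClosed_unitaryGroup.isClosedEmbedding_subtypeVal).isCompact_preimage isCompact_maxCompact
  have hfin : μH ((maxCompact E).subgroupOf (unitaryGroup σ)) ≠ ⊤ := hcomp.measure_lt_top.ne
  refine ⟨hfin, ?_⟩
  rw [hset, measureReal_def, ENNReal.toReal_ne_zero]
  exact ⟨(hopen.measure_pos μH ⟨1, one_mem _⟩).ne', hfin⟩

open Classical in
/-- The function `Φ_f` as a sum over the cosets of `GL₂(𝒪)`. -/
lemma PhiOf_eq_tsum {ι : Type*} (r : ι → GL (Fin 2) E)
    (hr : ∀ g, ∃! i, (r i)⁻¹ * g ∈ maxCompact E) {f : GL (Fin 2) E → ℂ}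
    (hf : ∀ g, ∀ k ∈ maxCompact E, f (g * k) = f g) (hs : {i | f (r i) ≠ 0}.Finite) (s : Herm σ) :
    PhiOf σ μH f s = μH.real {k : unitaryGroup σ | k.1 ∈ maxCompact E} *
      ∑' i, if hermConj σ (r i)⁻¹ s.1 ∈ maxCompact E then f (r i) else 0 := by
  have hsct : ctGL σ s.1 = s.1 := Units.ext s.2
  have hex (i : {i | hermConj σ (r i)⁻¹ s.1 ∈ maxCompact E}) :=
    hQ.exists_hermConj_swapMat (ctGL_hermConj hQ.invol hsct (r i)⁻¹) i.2
  choose k hk hks using hex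
  have hk' (i : {i | hermConj σ (r i)⁻¹ s.1 ∈ maxCompact E}) :
      s.1 = hermConj σ (r i * k i) (swapMat E) := by
    rw [hermConj_mul, ← hks, hermConj_self_inv]
  by_cases horb : ∃ g, s.1 = hermConj σ g (swapMat E)
  · obtain ⟨g, hg⟩ := horb
    rw [PhiOf_hermConj μH hg]
    -- The coset `r i K` meets `g H₀` exactly when `(r i)⁻¹ · s ∈ K`, since such a matrix is then of
    -- the form `k · w`. The elements `g⁻¹ (r i) k` represent `H₀ / (H₀ ∩ K)`.
    let R (i : {i | hermConj σ (r i)⁻¹ s.1 ∈ maxCompact E}) : unitaryGroup σ :=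
      ⟨g⁻¹ * (r i * k i), by
        rw [mem_unitaryGroup_iff, hermConj_mul, ← hk', hg, hermConj_inv_self]⟩
    have hR (i) (h : unitaryGroup σ) :
        (R i)⁻¹ * h ∈ (maxCompact E).subgroupOf (unitaryGroup σ) ↔
          (r i)⁻¹ * (g * h.1) ∈ maxCompact E := by
      rw [Subgroup.mem_subgroupOf]
      have : (((R i)⁻¹ * h : unitaryGroup σ) : GL (Fin 2) E) =
          (k i)⁻¹ * ((r i)⁻¹ * (g * h.1)) := by
        change (g⁻¹ * (r i * k i))⁻¹ * h.1 = _
        group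
      rw [this, Subgroup.mul_mem_cancel_left _ (inv_mem (hk i))]
    rw [integral_eq_tsum_cosets μH ((maxCompact E).subgroupOf (unitaryGroup σ))
      (isOpen_maxCompact.preimage continuous_subtype_val)
      (hQ.measure_unitary_maxCompact μH).1 R]
    · have hfR (i) : f (g * (R i).1) = f (r i) := by
        change f (g * (g⁻¹ * (r i * k i))) = _
        rw [mul_inv_cancel_left, hf _ _ (hk i)]
      simp only [hfR]
      rw [tsum_subtype {i | hermConj σ (r i)⁻¹ s.1 ∈ maxCompact E} fun i => f (r i)]
      congr 1
    · intro h
      obtain ⟨i, hi, huniq⟩ := hr (g * h.1)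
      have hi' : hermConj σ (r i)⁻¹ s.1 ∈ maxCompact E := by
        have : hermConj σ (r i)⁻¹ s.1 = hermConj σ ((r i)⁻¹ * (g * h.1)) (swapMat E) := by
          rw [hermConj_mul, hermConj_mul, (mem_unitaryGroup_iff σ).mp h.2, ← hg]
        rw [this, hQ.hermConj_mem_iff hi]
        exact swapMat_mem_maxCompact
      refine ⟨⟨i, hi'⟩, (hR _ h).mpr hi, fun j hj => Subtype.ext (huniq _ ((hR j h).mp hj))⟩
    · intro h k hk
      simp only [Subgroup.coe_mul, ← mul_assoc]
      exact hf _ _ hk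
    · refine (hs.preimage Subtype.val_injective.injOn).subset fun i hi => ?_
      change f (g * (R i).1) ≠ 0 at hi
      have : f (g * (R i).1) = f (r i) := by
        change f (g * (g⁻¹ * (r i * k i))) = _
        rw [mul_inv_cancel_left, hf _ _ (hk i)]
      rw [this] at hi
      exact hi
  · rw [not_exists] at horb
    rw [PhiOf_eq_zero μH horb]
    have : ∀ i, hermConj σ (r i)⁻¹ s.1 ∉ maxCompact E := fun i hi => horb _ (hk' ⟨i, hi⟩)
    simp [this]

end IsUnramQuad

end OrbitMap

/-! ### Counting solutions of norm congruences -/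

section NormFibres

variable {F E : Type*} [Field F] [Field E] [Algebra F E]
  [ValuativeRel F] [TopologicalSpace F] [IsNonarchimedeanLocalField F]
  [ValuativeRel E] [TopologicalSpace E] [IsNonarchimedeanLocalField E]
  [ValuativeExtension F E] {σ : E ≃ₐ[F] E}

/-- The class modulo `𝒪` of `ϖ^k Nm(y)`. -/
def normClass (ϖ : Fˣ) (k : ℕ) (y : E) : LQuot F :=
  QuotientAddGroup.mk ((ϖ ^ (k : ℤ) : Fˣ) * Algebra.norm F y)

lemma LQuot_mk_eq_mk {L : Type*} [Field L] [ValuativeRel L] [TopologicalSpace L]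
    [IsNonarchimedeanLocalField L] {x y : L} :
    (QuotientAddGroup.mk x : LQuot L) = QuotientAddGroup.mk y ↔ x - y ∈ lat L 0 := by
  rw [eq_comm, QuotientAddGroup.eq, neg_add_eq_sub]

lemma LQuot_mk_out {L : Type*} [Field L] [ValuativeRel L] [TopologicalSpace L]
    [IsNonarchimedeanLocalField L] (y : LQuot L) : (QuotientAddGroup.mk y.out : LQuot L) = y :=
  Quotient.out_eq' y

lemma den_eq_iff {L : Type*} [Field L] [ValuativeRel L] [TopologicalSpace L]
    [IsNonarchimedeanLocalField L] {y : L} {k : ℕ} (hk : 1 ≤ k) :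
    den y = k ↔ y ≠ 0 ∧ ord y = -k := by
  have h1 : den y = k ↔ den y ≤ k ∧ ¬ den y ≤ k - 1 := by omega
  rw [h1, den_le_iff, den_le_iff, mem_lat_iff', mem_lat_iff']
  constructor
  · rintro ⟨h2 | h2, h3⟩
    · exact absurd (Or.inl h2) h3
    · rw [not_or] at h3
      exact ⟨h3.1, by omega⟩
  · rintro ⟨h2, h3⟩
    refine ⟨Or.inr (by omega), ?_⟩
    rw [not_or]
    exact ⟨h2, by omega⟩

namespace IsUnramQuad

variable (hQ : IsUnramQuad σ) {ϖ : Fˣ} (hϖ : ord (ϖ : F) = 1)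

include hQ hϖ

lemma normClass_eq_mk_iff {k : ℕ} {y : E} {z : F} :
    normClass ϖ k y = QuotientAddGroup.mk z ↔
      ((unitsIncl F E ϖ ^ (k : ℤ) : Eˣ) : E) * (y * σ y) - algebraMap F E z ∈ lat E 0 := by
  rw [normClass, LQuot_mk_eq_mk, ← hQ.algebraMap_mem_lat, map_sub, map_mul, hQ.algebraMap_norm,
    ← map_zpow]
  rfl

/-- `ϖ^k x` is integral, so changing `x` by an integer changes `ϖ^k Nm(x)` by an integer only. -/
lemma normClass_congr {k : ℕ} {x y : E} (hx : x ∈ lat E (-k)) (hxy : y - x ∈ lat E 0) :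
    normClass ϖ k y = normClass ϖ k x := by
  have hϖE : ord ((unitsIncl F E ϖ ^ (k : ℤ) : Eˣ) : E) = k := by
    rw [ord_uniformizer_zpow]
    rw [hQ.ord_unitsIncl, hϖ]
  set p : E := ((unitsIncl F E ϖ ^ (k : ℤ) : Eˣ) : E) with hp
  have hp0 : p ≠ 0 := Units.ne_zero _
  rw [show normClass ϖ k x = QuotientAddGroup.mk ((ϖ ^ (k : ℤ) : Fˣ) * Algebra.norm F x) from rfl,
    hQ.normClass_eq_mk_iff hϖ, map_mul, hQ.algebraMap_norm]
  have h0 : algebraMap F E ((ϖ ^ (k : ℤ) : Fˣ) : F) = p := by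
    rw [hp, ← map_zpow]
    rfl
  rw [h0, ← mul_sub]
  have e1 : p * (y * σ y - x * σ x) = (p * x) * σ (y - x) + (y - x) * σ (p * x) +
      p * ((y - x) * σ (y - x)) := by
    have : σ p = p := by rw [← h0, σ.commutes]
    rw [map_mul, this, map_sub]
    ring
  have hpx : p * x ∈ lat E 0 := by
    rw [mul_mem_lat_iff hp0, hϖE, zero_sub]
    exact hx
  have hpO : p ∈ lat E 0 := by
    rw [mem_lat_iff hp0, hϖE]
    positivity
  rw [e1]
  refine add_mem (add_mem (mul_mem_lat_zero hpx (hQ.sigma_mem_lat.mpr hxy))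
    (mul_mem_lat_zero hxy (hQ.sigma_mem_lat.mpr hpx)))
    (mul_mem_lat_zero hpO (mul_mem_lat_zero hxy (hQ.sigma_mem_lat.mpr hxy)))

lemma den_normClass {k : ℕ} (hk : 1 ≤ k) {y : E} (hy : den y = k) :
    denQ (normClass ϖ k y) = k := by
  rw [normClass, denQ_mk, den_eq_iff hk]
  obtain ⟨h0, h1⟩ := (den_eq_iff hk).mp hy
  have hn : Algebra.norm F y ≠ 0 := by
    intro h
    have := hQ.algebraMap_norm y
    rw [h, map_zero, eq_comm, mul_eq_zero] at this
    rcases this with h2 | h2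
    · exact h0 h2
    · exact h0 (by simpa using h2)
  have ho : ord (Algebra.norm F y) = -2 * k := by
    rw [← hQ.ord_algebraMap, hQ.algebraMap_norm, ord_mul h0 (by simpa using h0), hQ.ord_sigma, h1]
    ring
  refine ⟨mul_ne_zero (Units.ne_zero _) hn, ?_⟩
  rw [ord_mul (Units.ne_zero _) hn, ord_uniformizer_zpow hϖ, ho]
  ring

/-- The quotient of the two targets is a unit of `F`, hence the norm of a unit `u` of `E`;
multiplication by `u` maps one fibre injectively to the other. -/
lemma ncard_fibre_le {k : ℕ} (hk : 1 ≤ k) {z z' : LQuot F} (hz : denQ z = k) (hz' : denQ z' = k) :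
    {y : LQuot E | denQ y = k ∧ normClass ϖ k y.out = z}.ncard ≤
      {y : LQuot E | denQ y = k ∧ normClass ϖ k y.out = z'}.ncard := by
  obtain ⟨ζ, rfl⟩ := QuotientAddGroup.mk_surjective z
  obtain ⟨ζ', rfl⟩ := QuotientAddGroup.mk_surjective z'
  rw [denQ_mk, den_eq_iff hk] at hz hz'
  obtain ⟨u, hu, hun⟩ := hQ.exists_norm_eq (mul_ne_zero hz'.1 (inv_ne_zero hz.1)) (by
    rw [ord_mul hz'.1 (inv_ne_zero hz.1), ord_inv, hz.2, hz'.2]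
    ring)
  have huO : (u : E) ∈ lat E 0 := (mem_lat_iff u.ne_zero).mpr hu.ge
  have hden (y : LQuot E) (n : ℕ) : denQ y ≤ n ↔ y.out ∈ lat E (-n) := by
    rw [← den_le_iff, ← denQ_mk, LQuot_mk_out]
  have hdenu (y : E) : den (u * y) = den y := by
    refine eq_of_forall_ge_iff fun n => ?_
    rw [den_le_iff, den_le_iff, mul_mem_lat_iff u.ne_zero, hu, sub_zero]
  refine Set.ncard_le_ncard_of_injOn (fun y => QuotientAddGroup.mk (u * y.out)) ?_ ?_
    ((finite_denQ_eq k).subset fun y hy => hy.1)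
  · rintro y ⟨hy, hyz⟩
    have hd : denQ (QuotientAddGroup.mk (u * y.out) : LQuot E) = k := by
      rw [denQ_mk, hdenu, ← denQ_mk, LQuot_mk_out, hy]
    refine ⟨hd, ?_⟩
    have h1 : (u : E) * y.out ∈ lat E (-k) :=
      mul_mem_lat_zero huO ((hden y k).mp hy.le)
    rw [hQ.normClass_congr hϖ h1 (out_sub_mem _), hQ.normClass_eq_mk_iff hϖ]
    rw [hQ.normClass_eq_mk_iff hϖ] at hyz
    have e1 : algebraMap F E ζ' = u * σ u * algebraMap F E ζ := by
      rw [hun, ← map_mul, mul_assoc, inv_mul_cancel₀ hz.1, mul_one]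
    have e2 : ((unitsIncl F E ϖ ^ (k : ℤ) : Eˣ) : E) * ((u * y.out) * σ (u * y.out)) -
        algebraMap F E ζ' = (u * σ u) * (((unitsIncl F E ϖ ^ (k : ℤ) : Eˣ) : E) *
          (y.out * σ y.out) - algebraMap F E ζ) := by
      rw [e1, map_mul]
      ring
    rw [e2]
    exact mul_mem_lat_zero (mul_mem_lat_zero huO (hQ.sigma_mem_lat.mpr huO)) hyz
  · intro y _ y' _ h
    simp only at h
    rw [LQuot_mk_eq_mk, ← mul_sub, mul_mem_lat_iff u.ne_zero, hu, sub_zero, ← LQuot_mk_eq_mk,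
      LQuot_mk_out, LQuot_mk_out] at h
    exact h

/-- All fibres over classes of exact denominator `k` have equal size, which is therefore `(q^(2k) -
q^(2k-2)) / (q^k - q^(k-1))`. -/
lemma ncard_fibre {k : ℕ} (hk : 1 ≤ k) {z : LQuot F} (hz : denQ z = k) :
    ({y : LQuot E | denQ y = k ∧ normClass ϖ k y.out = z}.ncard : ℂ) =
      normOneCount (Nat.card 𝓀[F]) k := by
  classical
  have hdeno (y : LQuot E) (hy : denQ y = k) : den y.out = k := by
    rw [← denQ_mk, LQuot_mk_out, hy]
  have hcard := Finset.card_eq_sum_card_fiberwise (s := (finite_denQ_eq (L := E) k).toFinset)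
    (t := (finite_denQ_eq (L := F) k).toFinset) (f := fun y => normClass ϖ k y.out) (by
      intro y hy
      rw [Set.Finite.coe_toFinset] at hy ⊢
      exact hQ.den_normClass hϖ hk (hdeno y hy))
  have hfib : ∀ z' ∈ (finite_denQ_eq (L := F) k).toFinset,
      ((finite_denQ_eq (L := E) k).toFinset.filter fun y => normClass ϖ k y.out = z').card =
        {y : LQuot E | denQ y = k ∧ normClass ϖ k y.out = z}.ncard := by
    intro z' hz'
    rw [Set.Finite.mem_toFinset] at hz'
    rw [← Set.ncard_coe_finset]
    have : (((finite_denQ_eq (L := E) k).toFinset.filter fun y => normClass ϖ k y.out = z' :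
        Finset (LQuot E)) : Set (LQuot E)) =
        {y : LQuot E | denQ y = k ∧ normClass ϖ k y.out = z'} := by
      ext y
      simp
    rw [this]
    exact le_antisymm (hQ.ncard_fibre_le hϖ hk hz' hz) (hQ.ncard_fibre_le hϖ hk hz hz')
  rw [Finset.sum_congr rfl hfib, Finset.sum_const, smul_eq_mul,
    ← Set.ncard_eq_toFinset_card _ (finite_denQ_eq k),
    ← Set.ncard_eq_toFinset_card _ (finite_denQ_eq k)] at hcard
  have h1 := congrArg (Nat.cast : ℕ → ℂ) hcard
  rw [Nat.cast_mul, ncard_denQ_eq, ncard_denQ_eq, hQ.card_residue] at h1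
  obtain ⟨j, rfl⟩ : ∃ j, k = j + 1 := ⟨k - 1, by omega⟩
  have hq : (1 : ℕ) < Nat.card 𝓀[F] := one_lt_card_residue
  simp only [denCount, normOneCount] at h1 ⊢
  have hq0 : (Nat.card 𝓀[F] : ℂ) ≠ 0 := by exact_mod_cast (by omega : Nat.card 𝓀[F] ≠ 0)
  have hq1 : (Nat.card 𝓀[F] : ℂ) - 1 ≠ 0 := by
    rw [sub_ne_zero]
    exact_mod_cast (by omega : Nat.card 𝓀[F] ≠ 1)
  push_cast at h1 ⊢
  generalize (Nat.card 𝓀[F] : ℂ) = q at *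
  have h2 : q ^ j * (q - 1) ≠ 0 := mul_ne_zero (pow_ne_zero _ hq0) hq1
  apply mul_left_cancel₀ h2
  linear_combination -h1

end IsUnramQuad

end NormFibres

/-! ### The values of Φ_f -/

section HermitianCount

variable {F E : Type*} [Field F] [Field E] [Algebra F E]
  [ValuativeRel F] [TopologicalSpace F] [IsNonarchimedeanLocalField F]
  [ValuativeRel E] [TopologicalSpace E] [IsNonarchimedeanLocalField E]
  [ValuativeExtension F E] {σ : E ≃ₐ[F] E}

/-- The classes `y` of exact denominator `ϖ^k` with `ϖ^k Nm(y) ≡ -ϖ^(-k)` modulo `𝒪`. -/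
def normFibre (E : Type*) [Field E] [Algebra F E] [ValuativeRel E] [TopologicalSpace E]
    [IsNonarchimedeanLocalField E] (ϖ : Fˣ) (k : ℕ) : Set (LQuot E) :=
  {y | denQ y = k ∧ normClass ϖ k y.out = QuotientAddGroup.mk (-((ϖ ^ (-(k : ℤ)) : Fˣ) : F))}

open Classical in
lemma tsum_indicator_const {ι : Type*} {S : Set ι} (hS : S.Finite) (x : ℂ) :
    Summable (fun i => if i ∈ S then x else 0) ∧
      ∑' i, (if i ∈ S then x else 0) = S.ncard * x := by
  have h (i) (hi : i ∉ hS.toFinset) : (if i ∈ S then x else 0) = 0 := by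
    rw [if_neg (by simpa using hi)]
  refine ⟨summable_of_ne_finset_zero h, ?_⟩
  rw [tsum_eq_sum h, Finset.sum_congr rfl (g := fun _ => x) fun i hi => if_pos (by simpa using hi),
    Finset.sum_const, nsmul_eq_mul, Set.ncard_eq_toFinset_card _ hS]

namespace IsUnramQuad

variable (hQ : IsUnramQuad σ) {ϖ : Fˣ} (hϖ : ord (ϖ : F) = 1)

include hQ hϖ

lemma ncard_normFibre (k : ℕ) :
    ((normFibre E ϖ k).ncard : ℂ) = normOneCount (Nat.card 𝓀[F]) k := by
  rcases Nat.eq_zero_or_pos k with rfl | hk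
  · have : normFibre E ϖ 0 = {y : LQuot E | denQ y = 0} := by
      ext y
      refine ⟨fun h => h.1, fun h => ⟨h, ?_⟩⟩
      have hy : y.out ∈ lat E 0 := by
        have := den_le_iff.mp (show den y.out ≤ 0 by
          rw [← denQ_mk, LQuot_mk_out]
          exact h.le)
        simpa using this
      rw [hQ.normClass_eq_mk_iff hϖ]
      simp only [Nat.cast_zero, zpow_zero, Units.val_one, one_mul, neg_zero, map_neg, map_one,
        sub_neg_eq_add]
      exact add_mem (mul_mem_lat_zero hy (hQ.sigma_mem_lat.mpr hy)) one_mem_lat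
    rw [this, ncard_denQ_eq]
    rfl
  · refine hQ.ncard_fibre hϖ hk ?_
    rw [denQ_mk, den_eq_iff hk, ord_neg, ord_uniformizer_zpow hϖ]
    exact ⟨neg_ne_zero.mpr (Units.ne_zero _), rfl⟩

lemma finite_normFibre (k : ℕ) : (normFibre E ϖ k).Finite :=
  (finite_denQ_eq k).subset fun _ h => h.1

/-- The exactness of the denominator is automatic: if it were smaller than `k`, the term `ϖ^(-k)`
would dominate and the sum would not be integral. -/
lemma mem_normFibre_iff {k : ℕ} {y : LQuot E} : y ∈ normFibre E ϖ k ↔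
    y.out ∈ lat E (-k) ∧ ((unitsIncl F E ϖ ^ (-(k : ℤ)) : Eˣ) : E) +
      ((unitsIncl F E ϖ ^ (k : ℤ) : Eˣ) : E) * (y.out * σ y.out) ∈ lat E 0 := by
  have hϖE : ord (unitsIncl F E ϖ : E) = 1 := by rw [hQ.ord_unitsIncl, hϖ]
  have h0 : ((unitsIncl F E ϖ ^ (-(k : ℤ)) : Eˣ) : E) =
      algebraMap F E ((ϖ ^ (-(k : ℤ)) : Fˣ) : F) := by
    rw [← map_zpow]
    rfl
  have hden : denQ y = den y.out := by
    conv_lhs => rw [← LQuot_mk_out y]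
    rw [denQ_mk]
  rw [normFibre, Set.mem_ofPred_eq, hQ.normClass_eq_mk_iff hϖ, map_neg, sub_neg_eq_add, ← h0,
    add_comm, ← den_le_iff, hden]
  refine ⟨fun h => ⟨h.1.le, h.2⟩, fun h => ⟨le_antisymm h.1 ?_, h.2⟩⟩
  by_contra hlt
  rw [not_le] at hlt
  have hy : y.out ∈ lat E (-((k - 1 : ℕ) : ℤ)) := den_le_iff.mp (by omega)
  have h1 : ((unitsIncl F E ϖ ^ (k : ℤ) : Eˣ) : E) * (y.out * σ y.out) ∈ lat E (1 - k) := by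
    rw [mul_mem_lat_iff (Units.ne_zero _), ord_uniformizer_zpow hϖE]
    exact lat_anti (by omega) (mul_mem_lat hy (hQ.sigma_mem_lat.mpr hy))
  have h2 := sub_mem (lat_anti (by omega : (1 - k : ℤ) ≤ 0) h.2) h1
  rw [add_sub_cancel_right, mem_lat_iff (Units.ne_zero _), ord_uniformizer_zpow hϖE] at h2
  omega

/-- With `k = m - 2d`, the entries of the transformed matrix are `ϖ^k`, `-ϖ^k y`, its conjugate, and
`ϖ^(-k) + ϖ^k Nm(y)` once the order of the determinant is zero. -/
lemma hermConj_cosetRep_mem_iff (l : ℕ) (m a d : ℤ) (y : LQuot E) :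
    hermConj σ (cosetRep (unitsIncl F E ϖ) ((a, d), y))⁻¹
      (borelMat (unitsIncl F E ϖ ^ (m + l)) (unitsIncl F E ϖ ^ m) 0) ∈ maxCompact E ↔
    2 * (a + d) = 2 * m + l ∧ ∃ k : ℕ, m - 2 * d = k ∧ y ∈ normFibre E ϖ k := by
  set p := unitsIncl F E ϖ with hp
  have hpE : ord (p : E) = 1 := by rw [hp, hQ.ord_unitsIncl, hϖ]
  have hσ (n : ℤ) : σ ((p ^ n : Eˣ) : E) = ((p ^ n : Eˣ) : E) := by
    rw [hp, ← map_zpow]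
    exact σ.commutes _
  rw [mem_maxCompact_iff, hQ.ord_det_hermConj, ord_det_inv, ord_det_cosetRep hpE,
    ord_det_borelMat_zpow hpE]
  have hiff : m + l + m + 2 * -(a + d) = 0 ↔ 2 * (a + d) = 2 * m + l := by omega
  rw [hiff, and_comm, and_congr_right_iff]
  intro hdet
  have e11 : ((p ^ (-d) : Eˣ) : E) * (p ^ m : Eˣ) * (p ^ (-d) : Eˣ) =
      (p ^ (m - 2 * d) : Eˣ) := by
    rw [← Units.val_mul, ← Units.val_mul, ← zpow_add, ← zpow_add]
    congr 2
    ring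
  have e00 : ((p ^ (-a) : Eˣ) : E) * (p ^ (m + l) : Eˣ) * (p ^ (-a) : Eˣ) =
      (p ^ (-(m - 2 * d)) : Eˣ) := by
    rw [← Units.val_mul, ← Units.val_mul, ← zpow_add, ← zpow_add]
    congr 2
    omega
  have hinv : (cosetRep p ((a, d), y))⁻¹ =
      borelMat (p ^ (-a)) (p ^ (-d)) (-(y.out * (p ^ (-d) : Eˣ))) := by
    rw [cosetRep, inv_borelMat, ← zpow_neg, ← zpow_neg]
    congr 1
    rw [← mul_assoc, neg_mul, ← Units.val_mul, zpow_neg, inv_mul_cancel, Units.val_one]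
    ring
  have hmat : (hermConj σ (cosetRep p ((a, d), y))⁻¹ (borelMat (p ^ (m + l)) (p ^ m) 0)).1 =
      !![(p ^ (-(m - 2 * d)) : Eˣ) + (p ^ (m - 2 * d) : Eˣ) * (y.out * σ y.out),
        -((p ^ (m - 2 * d) : Eˣ) * y.out); -((p ^ (m - 2 * d) : Eˣ) * σ y.out),
        ((p ^ (m - 2 * d) : Eˣ) : E)] := by
    refine Matrix.ext fun i j => ?_
    rw [hermConj_apply, hinv, coe_borelMat, coe_borelMat, ← e11, ← e00]
    generalize ((p ^ (m + l) : Eˣ) : E) = u at *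
    have h1 := hσ (-a)
    have h2 := hσ (-d)
    generalize ((p ^ (-a) : Eˣ) : E) = A at *
    generalize ((p ^ (-d) : Eˣ) : E) = D at *
    generalize ((p ^ m : Eˣ) : E) = M at *
    fin_cases i <;> fin_cases j <;> simp [h1, h2] <;> ring
  have hentry : (∀ i j, (hermConj σ (cosetRep p ((a, d), y))⁻¹
      (borelMat (p ^ (m + l)) (p ^ m) 0)).1 i j ∈ lat E 0) ↔
      (((p ^ (m - 2 * d) : Eˣ) : E) ∈ lat E 0 ∧ (p ^ (m - 2 * d) : Eˣ) * y.out ∈ lat E 0 ∧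
      (p ^ (-(m - 2 * d)) : Eˣ) + (p ^ (m - 2 * d) : Eˣ) * (y.out * σ y.out) ∈ lat E 0) := by
    rw [hmat]
    constructor
    · intro h
      exact ⟨h 1 1, neg_mem_iff.mp (h 0 1), h 0 0⟩
    · rintro ⟨h1, h2, h3⟩ i j
      have h4 : (p ^ (m - 2 * d) : Eˣ) * σ y.out ∈ lat E 0 := by
        rw [← hσ, ← map_mul]
        exact hQ.sigma_mem_lat.mpr h2
      fin_cases i <;> fin_cases j
      · exact h3
      · exact neg_mem h2
      · exact neg_mem h4
      · exact h1
  rw [hentry, mem_lat_iff (Units.ne_zero _), mul_mem_lat_iff (Units.ne_zero _),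
    ord_uniformizer_zpow hpE, zero_sub]
  constructor
  · rintro ⟨h1, h2, h3⟩
    refine ⟨(m - 2 * d).toNat, by omega, ?_⟩
    rw [hQ.mem_normFibre_iff hϖ, Int.toNat_of_nonneg h1]
    exact ⟨h2, h3⟩
  · rintro ⟨k, hk, hy⟩
    rw [hQ.mem_normFibre_iff hϖ, ← hk] at hy
    exact ⟨by omega, hy⟩

open Classical in
lemma tsum_cosetRep {f : GL (Fin 2) E → ℂ}
    (hf : ∀ k₁ ∈ maxCompact E, ∀ k₂ ∈ maxCompact E, ∀ g, f (k₁ * g * k₂) = f g) {B : ℕ}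
    (hB : BoundedBy B (coef (unitsIncl F E ϖ) f)) (l : ℕ) (m : ℤ) :
    (∑' i, if hermConj σ (cosetRep (unitsIncl F E ϖ) i)⁻¹
        (borelMat (unitsIncl F E ϖ ^ (m + l)) (unitsIncl F E ϖ ^ m) 0) ∈ maxCompact E
      then f (cosetRep (unitsIncl F E ϖ) i) else 0) =
    hermCoef (Nat.card 𝓀[F]) B (coef (unitsIncl F E ϖ) f) l m := by
  have hpE : ord (unitsIncl F E ϖ : E) = 1 := by rw [hQ.ord_unitsIncl, hϖ]
  set c := coef (unitsIncl F E ϖ) f with hc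
  rw [hermCoef]
  split_ifs with hl
  · obtain ⟨r, rfl⟩ := hl
    have hlr : (r + r) / 2 = r := by omega
    rw [hlr]
    let S (k : ℕ) : Set ((ℤ × ℤ) × LQuot E) :=
      (fun y => (((m - k) / 2 + k + r, (m - k) / 2), y)) '' normFibre E ϖ k
    have hSfin (k : ℕ) : (S k).Finite := (hQ.finite_normFibre hϖ k).image _
    have hScard (k : ℕ) : ((S k).ncard : ℂ) = normOneCount (Nat.card 𝓀[F]) k := by
      rw [← hQ.ncard_normFibre hϖ k]
      congr 1
      exact Set.ncard_image_of_injective _ fun y y' h => (Prod.mk.inj h).2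
    have hterm (i : (ℤ × ℤ) × LQuot E) : (if hermConj σ (cosetRep (unitsIncl F E ϖ) i)⁻¹
        (borelMat (unitsIncl F E ϖ ^ (m + (r + r : ℕ))) (unitsIncl F E ϖ ^ m) 0) ∈ maxCompact E
        then f (cosetRep (unitsIncl F E ϖ) i) else 0) =
        ∑ k ∈ Finset.range B, if Even (m - (k : ℤ)) then
          (if i ∈ S k then c (r + k) ((m - k) / 2) else 0) else 0 := by
      obtain ⟨⟨a, d⟩, y⟩ := i
      have hS (k : ℕ) (hk : Even (m - (k : ℤ))) : ((a, d), y) ∈ S k ↔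
          a = d + k + r ∧ m - 2 * d = k ∧ y ∈ normFibre E ϖ k := by
        obtain ⟨t, ht⟩ := hk
        constructor
        · rintro ⟨y', hy', h⟩
          simp only [Prod.mk.injEq] at h
          obtain ⟨⟨h1, h2⟩, rfl⟩ := h
          exact ⟨by omega, by omega, hy'⟩
        · rintro ⟨h1, h2, h3⟩
          refine ⟨y, h3, ?_⟩
          simp only [Prod.mk.injEq, and_true]
          omega
      rw [hQ.hermConj_cosetRep_mem_iff hϖ]
      split_ifs with hcond
      -- Here `d = (m-k)/2`, `a = d + k + r` and the denominator of `y` is `k`, so the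
      -- representative has content `d` and the value of `f` at it is `c (r+k) d`.
      · obtain ⟨h1, k, h2, h3⟩ := hcond
        have hfc : f (cosetRep (unitsIncl F E ϖ) ((a, d), y)) = c (r + k) ((m - k) / 2) := by
          rw [apply_eq_ofCoef hpE hf, ofCoef_cosetRep hpE, ← hc]
          have hmin : min (a - denQ y : ℤ) d = d := by
            rw [h3.1]
            omega
          simp only [hmin]
          congr 1 <;> omega
        have heven : Even (m - (k : ℤ)) := ⟨d, by omega⟩
        have hmem : ((a, d), y) ∈ S k := (hS k heven).mpr ⟨by omega, h2, h3⟩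
        have hne (k' : ℕ) (hk' : k' ≠ k) : (if Even (m - (k' : ℤ)) then
            (if ((a, d), y) ∈ S k' then c (r + k') ((m - k') / 2) else 0) else 0) = 0 := by
          split_ifs with h4 h5
          · exact absurd ((hS k' h4).mp h5).2.1 (by omega)
          · rfl
          · rfl
        by_cases hkB : k < B
        · rw [Finset.sum_eq_single_of_mem k (Finset.mem_range.mpr hkB) fun k' _ => hne k',
            if_pos heven, if_pos hmem, hfc]
        · rw [Finset.sum_eq_zero fun k' hk' => hne k' (by
            have := Finset.mem_range.mp hk'
            omega), hfc, hB _ (by omega)]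
      · refine (Finset.sum_eq_zero fun k _ => ?_).symm
        split_ifs with h4 h5
        · obtain ⟨h6, h7, h8⟩ := (hS k h4).mp h5
          exact absurd ⟨by push_cast; omega, k, h7, h8⟩ hcond
        · rfl
        · rfl
    rw [tsum_congr hterm, Summable.tsum_finsetSum]
    · refine Finset.sum_congr rfl fun k _ => ?_
      split_ifs
      · rw [(tsum_indicator_const (hSfin k) _).2, hScard]
      · exact tsum_zero
    · intro k _
      split_ifs
      · exact (tsum_indicator_const (hSfin k) _).1
      · exact summable_zero
  · have hzero (i : (ℤ × ℤ) × LQuot E) : (if hermConj σ (cosetRep (unitsIncl F E ϖ) i)⁻¹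
        (borelMat (unitsIncl F E ϖ ^ (m + l)) (unitsIncl F E ϖ ^ m) 0) ∈ maxCompact E
        then f (cosetRep (unitsIncl F E ϖ) i) else 0) = 0 := by
      obtain ⟨⟨a, d⟩, y⟩ := i
      rw [hQ.hermConj_cosetRep_mem_iff hϖ, if_neg]
      rintro ⟨h1, -⟩
      exact hl ⟨(a + d - m).toNat, by omega⟩
    rw [tsum_congr hzero, tsum_zero]

variable [MeasurableSpace (GL (Fin 2) E)] [BorelSpace (GL (Fin 2) E)]
  (μH : Measure (unitaryGroup σ)) [μH.IsHaarMeasure]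

/-- The function `Φ_f` in terms of the values of `f` on diagonal matrices. -/
lemma PhiOf_eq_hermCoef {f : GL (Fin 2) E → ℂ} (hf : f ∈ sphericalHecke E) {B : ℕ}
    (hB : BoundedBy B (coef (unitsIncl F E ϖ) f)) (s : Herm σ) :
    PhiOf σ μH f s = μH.real {k : unitaryGroup σ | k.1 ∈ maxCompact E} *
      hermCoef (Nat.card 𝓀[F]) B (coef (unitsIncl F E ϖ) f)
        (ord s.1.1.det - 2 * content s.1.1).toNat (content s.1.1) := by
  have hpE : ord (unitsIncl F E ϖ : E) = 1 := by rw [hQ.ord_unitsIncl, hϖ]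
  have hsct : ctGL σ s.1 = s.1 := Units.ext s.2
  obtain ⟨k, hk, hks⟩ := hQ.exists_hermConj_eq_diag hϖ hsct
  have hct := ctGL_hermConj hQ.invol hsct k
  have hl : ord s.1.1.det - content s.1.1 =
      content s.1.1 + ((ord s.1.1.det - 2 * content s.1.1).toNat : ℤ) := by
    have := two_content_le_ord_det s.1
    omega
  rw [hl] at hks
  rw [← hQ.tsum_cosetRep hϖ hf.2 hB, ← hks]
  rw [← PhiOf_equivariant μH (s := s) (s' := ⟨hermConj σ k s.1, congrArg Units.val hct⟩) (k := k)
    (fun g => by simpa using hf.2 k hk 1 (one_mem _) g) rfl]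
  exact hQ.PhiOf_eq_tsum μH _ (existsUnique_cosetRep hpE)
    (fun g k hk => by simpa using hf.2 1 (one_mem _) k hk g) (finite_cosetRep hpE hf) _

end IsUnramQuad

end HermitianCount

/-! ### Integrals over the multiplicative group of functions of the order -/

section UnitIntegral

variable {L : Type*} [Field L] [ValuativeRel L] [TopologicalSpace L]
  [IsNonarchimedeanLocalField L]

lemma coe_unitGroup : (unitGroup L : Set Lˣ) = {u : Lˣ | valuation L (u : L) = 1} := by
  ext u
  rw [SetLike.mem_coe, mem_unitGroup, ord_eq_zero_iff_valuation u.ne_zero]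
  rfl

variable [MeasurableSpace Lˣ] [BorelSpace Lˣ] (μ : Measure Lˣ) [μ.IsHaarMeasure]
  (hμ : μ {u : Lˣ | valuation L (u : L) = 1} = 1)

include hμ

/-- The integral over `Lˣ` of a function of the order. -/
lemma integral_units_eq_tsum {φ : Lˣ → ℂ} {G : ℤ → ℂ} (hφ : ∀ u, φ u = G (ord (u : L)))
    (hG : {n | G n ≠ 0}.Finite) : ∫ u, φ u ∂μ = ∑' n, G n := by
  obtain ⟨ϖ, hϖ⟩ := exists_ord_eq_one (L := L)
  have hone : μ (unitGroup L) = 1 := by rw [coe_unitGroup, hμ]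
  have hord (n : ℤ) (g : Lˣ) : ord (((ϖ ^ n)⁻¹ * g : Lˣ) : L) = ord (g : L) - n := by
    rw [Units.val_mul, ord_mul (Units.ne_zero _) (Units.ne_zero _), ← zpow_neg,
      ord_uniformizer_zpow hϖ]
    ring
  have hr (n : ℤ) : φ (ϖ ^ n) = G n := by rw [hφ, ord_uniformizer_zpow hϖ]
  rw [integral_eq_tsum_cosets μ (unitGroup L) isOpen_unitGroup (by rw [hone]; simp)
    (fun n : ℤ => ϖ ^ n) (fun g => ?_) φ (fun g k hk => ?_) (by simpa only [hr] using hG),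
    measureReal_def, hone]
  · simp [hr]
  · refine ⟨ord (g : L), mem_unitGroup.mpr (by rw [hord, sub_self]), fun n hn => ?_⟩
    have := mem_unitGroup.mp hn
    rw [hord] at this
    omega
  · rw [hφ, hφ, Units.val_mul, ord_mul (Units.ne_zero _) (Units.ne_zero _), mem_unitGroup.mp hk,
      add_zero]

lemma measure_ord_eq (n : ℤ) : μ {u : Lˣ | ord (u : L) = n} = 1 := by
  obtain ⟨ϖ, hϖ⟩ := exists_ord_eq_one (L := L)
  have h : {u : Lˣ | ord (u : L) = n} = (fun u => ϖ ^ (-n) * u) ⁻¹' (unitGroup L : Set Lˣ) := by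
    ext u
    rw [Set.mem_preimage, SetLike.mem_coe, mem_unitGroup, Units.val_mul,
      ord_mul (Units.ne_zero _) (Units.ne_zero _), ord_uniformizer_zpow hϖ]
    change ord (u : L) = n ↔ _
    omega
  rw [h, measure_preimage_mul, coe_unitGroup, hμ]

end UnitIntegral

/-! ### The isomorphism B₁ ≅ M₂(F) and maximal orders -/

section Quaternion

variable {F E : Type*} [Field F] [Field E] [Algebra F E]
  [ValuativeRel F] [TopologicalSpace F] [IsNonarchimedeanLocalField F]
  [ValuativeRel E] [TopologicalSpace E] [IsNonarchimedeanLocalField E]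
  [ValuativeExtension F E] {σ : E ≃ₐ[F] E} {hσ : Function.Involutive σ}

/-- The inclusion of the units of the quaternion algebra in `GL₂(E)`. -/
def quatToGL (σ : E ≃ₐ[F] E) (hσ : Function.Involutive σ) (ε : Fˣ) :
    (quatAlg σ hσ ε)ˣ →* GL (Fin 2) E :=
  Units.map ((quatAlg σ hσ ε).val : _ →* Matrix (Fin 2) (Fin 2) E)

lemma mem_quatMaxCompact {ε : Fˣ} {g : (quatAlg σ hσ ε)ˣ} :
    g ∈ quatMaxCompact σ hσ ε ↔ quatToGL σ hσ ε g ∈ maxCompact E := Iff.rfl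

namespace IsUnramQuad

variable (hQ : IsUnramQuad σ)

include hQ

/-- The order `𝒪_E + 𝒪_E j` is generated by its units. -/
lemma integral_mem_closure {M : quatAlg σ hσ (1 : Fˣ)} (hM : ∀ i j, M.1 i j ∈ lat E 0) :
    M ∈ AddSubgroup.closure
      {x | ∃ g ∈ quatMaxCompact σ hσ (1 : Fˣ), x = (g : quatAlg σ hσ (1 : Fˣ))} := by
  set C := AddSubgroup.closure
      {x | ∃ g ∈ quatMaxCompact σ hσ (1 : Fˣ), x = (g : quatAlg σ hσ (1 : Fˣ))}
  obtain ⟨a, b, hab⟩ := M.2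
  have ha : a ∈ lat E 0 := by
    have := hM 0 0
    rw [hab] at this
    exact this
  have hb : b ∈ lat E 0 := by
    have := hM 0 1
    rw [hab] at this
    simpa using this
  have unit_a (a : E) (ha0 : a ≠ 0) (ha : ord a = 0) :
      (⟨!![a, 0; 0, σ a], a, 0, by simp⟩ : quatAlg σ hσ (1 : Fˣ)) ∈ C := by
    refine AddSubgroup.subset_closure ⟨torus σ hσ 1 (Units.mk0 a ha0), ?_, rfl⟩
    rw [mem_quatMaxCompact, mem_maxCompact_iff]
    have h1 : (quatToGL σ hσ 1 (torus σ hσ 1 (Units.mk0 a ha0))).1 = !![a, 0; 0, σ a] := rfl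
    rw [h1, Matrix.det_fin_two_of, mul_zero, sub_zero, ord_mul ha0 (by simpa using ha0),
      hQ.ord_sigma, ha]
    refine ⟨fun i j => ?_, rfl⟩
    have h2 : a ∈ lat E 0 := (mem_lat_iff ha0).mpr ha.ge
    fin_cases i <;> fin_cases j
    · exact h2
    · exact zero_mem _
    · exact zero_mem _
    · exact hQ.sigma_mem_lat.mpr h2
  have unit_b (b : E) (hb0 : b ≠ 0) (hb : ord b = 0) :
      (⟨!![0, b; σ b, 0], 0, b, by simp⟩ : quatAlg σ hσ (1 : Fˣ)) ∈ C := by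
    have hb0' : σ b ≠ 0 := by simpa using hb0
    let g : (quatAlg σ hσ (1 : Fˣ))ˣ :=
      ⟨⟨!![0, b; σ b, 0], 0, b, by simp⟩,
        ⟨!![0, (σ b)⁻¹; b⁻¹, 0], 0, (σ b)⁻¹, by simp [hσ b]⟩, by
          refine Subtype.ext (Matrix.ext fun i j => ?_)
          fin_cases i <;> fin_cases j <;> simp [Matrix.mul_apply, hb0], by
          refine Subtype.ext (Matrix.ext fun i j => ?_)
          fin_cases i <;> fin_cases j <;> simp [Matrix.mul_apply, hb0]⟩
    refine AddSubgroup.subset_closure ⟨g, ?_, rfl⟩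
    rw [mem_quatMaxCompact, mem_maxCompact_iff]
    have h1 : (quatToGL σ hσ 1 g).1 = !![0, b; σ b, 0] := rfl
    rw [h1, Matrix.det_fin_two_of, mul_zero, zero_sub, ord_neg, ord_mul hb0 hb0',
      hQ.ord_sigma, hb]
    refine ⟨fun i j => ?_, rfl⟩
    have h2 : b ∈ lat E 0 := (mem_lat_iff hb0).mpr hb.ge
    fin_cases i <;> fin_cases j
    · exact zero_mem _
    · exact h2
    · exact hQ.sigma_mem_lat.mpr h2
    · exact zero_mem _
  -- An integer is a unit or the sum of the units `1` and `x - 1`.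
  have split (x : E) (hx : x ∈ lat E 0) : ∃ y z : E, x = y + z ∧
      (y ≠ 0 ∧ ord y = 0) ∧ (z = 0 ∨ (z ≠ 0 ∧ ord z = 0)) := by
    by_cases h1 : x ∈ lat E 1
    · refine ⟨1, x - 1, by ring, ⟨one_ne_zero, ord_one⟩, Or.inr ?_⟩
      refine ord_eq_zero_of_mem (sub_mem hx one_mem_lat) fun h => ?_
      have h2 := sub_mem h1 h
      rw [sub_sub_cancel] at h2
      exact not_mem_lat_one one_ne_zero ord_one h2
    · exact ⟨x, 0, by ring, ord_eq_zero_of_mem hx h1, Or.inl rfl⟩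
  have all_a (a : E) (ha : a ∈ lat E 0) :
      (⟨!![a, 0; 0, σ a], a, 0, by simp⟩ : quatAlg σ hσ (1 : Fˣ)) ∈ C := by
    obtain ⟨y, z, rfl, hy, hz⟩ := split a ha
    rcases hz with rfl | hz
    · simpa using unit_a y hy.1 hy.2
    · have := add_mem (unit_a y hy.1 hy.2) (unit_a z hz.1 hz.2)
      convert! this using 1
      refine Subtype.ext (Matrix.ext fun i j => ?_)
      fin_cases i <;> fin_cases j <;> simp
  have all_b (b : E) (hb : b ∈ lat E 0) :
      (⟨!![0, b; σ b, 0], 0, b, by simp⟩ : quatAlg σ hσ (1 : Fˣ)) ∈ C := by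
    obtain ⟨y, z, rfl, hy, hz⟩ := split b hb
    rcases hz with rfl | hz
    · simpa using unit_b y hy.1 hy.2
    · have := add_mem (unit_b y hy.1 hy.2) (unit_b z hz.1 hz.2)
      convert! this using 1
      refine Subtype.ext (Matrix.ext fun i j => ?_)
      fin_cases i <;> fin_cases j <;> simp
  have := add_mem (all_a a ha) (all_b b hb)
  convert! this using 1
  refine Subtype.ext ?_
  rw [hab]
  refine Matrix.ext fun i j => ?_
  fin_cases i <;> fin_cases j <;> simp

end IsUnramQuad

/-- The matrices with integral entries. -/
def integralMat (L : Type*) [Field L] [ValuativeRel L] [TopologicalSpace L]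
    [IsNonarchimedeanLocalField L] : AddSubgroup (Matrix (Fin 2) (Fin 2) L) where
  carrier := {M | ∀ i j, M i j ∈ lat L 0}
  zero_mem' _ _ := zero_mem _
  add_mem' hM hN i j := add_mem (hM i j) (hN i j)
  neg_mem' hM i j := neg_mem (hM i j)

/-- The ring `M₂(𝒪)` is generated by its units. -/
lemma matrix_integral_mem_closure {L : Type*} [Field L] [ValuativeRel L] [TopologicalSpace L]
    [IsNonarchimedeanLocalField L] {M : Matrix (Fin 2) (Fin 2) L} (hM : ∀ i j, M i j ∈ lat L 0) :
    M ∈ AddSubgroup.closure {x | ∃ g ∈ maxCompact L, x = (g : GL (Fin 2) L).1} := by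
  set C := AddSubgroup.closure {x | ∃ g ∈ maxCompact L, x = (g : GL (Fin 2) L).1}
  have key (x y z w : L) (hx : x ∈ lat L 0) (hy : y ∈ lat L 0) (hz : z ∈ lat L 0)
      (hw : w ∈ lat L 0) (hdet : x * w - y * z = 1 ∨ x * w - y * z = -1) : !![x, y; z, w] ∈ C := by
    have h0 : (!![x, y; z, w]).det ≠ 0 := by
      rw [Matrix.det_fin_two_of]
      rcases hdet with h | h <;> simp [h]
    refine AddSubgroup.subset_closure
      ⟨Matrix.GeneralLinearGroup.mkOfDetNeZero !![x, y; z, w] h0, ?_, rfl⟩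
    rw [mem_maxCompact_iff]
    constructor
    · intro i j
      fin_cases i <;> fin_cases j
      · exact hx
      · exact hy
      · exact hz
      · exact hw
    · change ord (!![x, y; z, w]).det = 0
      rw [Matrix.det_fin_two_of]
      rcases hdet with h | h
      · rw [h, ord_one]
      · rw [h, ord_neg, ord_one]
  have h1 : (1 : L) ∈ lat L 0 := one_mem_lat
  have h0 : (0 : L) ∈ lat L 0 := zero_mem _
  have h2 : (2 : L) ∈ lat L 0 := by
    rw [← one_add_one_eq_two]
    exact add_mem h1 h1
  -- Four matrices of determinant `±1`, each carrying one entry of `M`, add up to `M` plus an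
  -- integral matrix that is itself a sum of two matrices of determinant `±1`.
  have hsum := sub_mem (sub_mem (add_mem (add_mem (add_mem
    (key (M 0 0) 1 1 0 (hM 0 0) h1 h1 h0 (Or.inr (by ring)))
    (key 0 1 1 (M 1 1) h0 h1 h1 (hM 1 1) (Or.inr (by ring))))
    (key 1 (M 0 1) 0 1 h1 (hM 0 1) h0 h1 (Or.inl (by ring))))
    (key 1 0 (M 1 0) 1 h1 h0 (hM 1 0) h1 (Or.inl (by ring))))
    (key 1 1 1 2 h1 h1 h1 h2 (Or.inl (by ring))))
    (key 1 1 1 0 h1 h1 h1 h0 (Or.inr (by ring)))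
  convert! hsum using 1
  refine Matrix.ext fun i j => ?_
  fin_cases i <;> fin_cases j <;> simp <;> ring

namespace IsUnramQuad

variable (hQ : IsUnramQuad σ)
  (e : quatAlg σ hσ (1 : Fˣ) ≃ₐ[F] Matrix (Fin 2) (Fin 2) F)
  (he : (quatMaxCompact σ hσ (1 : Fˣ)).map (Units.mapEquiv (e : _ ≃* _)).toMonoidHom =
      maxCompact F)

include hQ he

/-- The hypothesis concerns unit groups only; additivity of `e` extends it to the orders, since each
is additively generated by its units. -/
lemma integral_iff (M : quatAlg σ hσ (1 : Fˣ)) :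
    (∀ i j, M.1 i j ∈ lat E 0) ↔ ∀ i j, e M i j ∈ lat F 0 := by
  constructor
  · intro hM
    have hle : AddSubgroup.closure
        {x | ∃ g ∈ quatMaxCompact σ hσ (1 : Fˣ), x = (g : quatAlg σ hσ (1 : Fˣ))} ≤
        (integralMat F).comap (e : quatAlg σ hσ (1 : Fˣ) →+ Matrix (Fin 2) (Fin 2) F) := by
      rw [AddSubgroup.closure_le]
      rintro _ ⟨g, hg, rfl⟩
      have h1 : Units.mapEquiv (e : _ ≃* _) g ∈ maxCompact F := he ▸ ⟨g, hg, rfl⟩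
      exact (mem_maxCompact_iff.mp h1).1
    exact hle (hQ.integral_mem_closure hM)
  · intro hM
    have hle : AddSubgroup.closure {x | ∃ g ∈ maxCompact F, x = (g : GL (Fin 2) F).1} ≤
        (integralMat E).comap (((quatAlg σ hσ (1 : Fˣ)).val : _ →+ Matrix (Fin 2) (Fin 2) E).comp
          (e.symm : Matrix (Fin 2) (Fin 2) F →+ quatAlg σ hσ (1 : Fˣ))) := by
      rw [AddSubgroup.closure_le]
      rintro _ ⟨g, hg, rfl⟩
      rw [← he] at hg
      obtain ⟨g, hg, rfl⟩ := hg
      have h1 : e.symm (e g.1) = g.1 := e.symm_apply_apply _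
      change ∀ i j, (e.symm (e g.1)).1 i j ∈ lat E 0
      rw [h1]
      exact (mem_maxCompact_iff.mp (mem_quatMaxCompact.mp hg)).1
    have h1 := hle (matrix_integral_mem_closure hM)
    change ∀ i j, (e.symm (e M)).1 i j ∈ lat E 0 at h1
    rwa [e.symm_apply_apply] at h1

/-- Scaling by powers of `ϖ`, which commutes with the `F`-linear map `e`, reduces to integrality. -/
lemma content_equiv (g : (quatAlg σ hσ (1 : Fˣ))ˣ) :
    content (Units.mapEquiv (e : _ ≃* _) g : GL (Fin 2) F).1 =
      content (quatToGL σ hσ 1 g).1 := by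
  obtain ⟨ϖ, hϖ⟩ := exists_ord_eq_one (L := F)
  refine eq_of_forall_le_iff fun n => ?_
  rw [le_content_iff, le_content_iff]
  have h := hQ.integral_iff e he ((((ϖ ^ (-n) : Fˣ) : F)) • (g : quatAlg σ hσ (1 : Fˣ)))
  have h1 (i j) : ((((ϖ ^ (-n) : Fˣ) : F)) • (g : quatAlg σ hσ (1 : Fˣ))).1 i j =
      algebraMap F E (ϖ ^ (-n) : Fˣ) * (quatToGL σ hσ 1 g).1 i j := by
    rw [← Algebra.smul_def]
    rfl
  have h2 (i j) : e ((((ϖ ^ (-n) : Fˣ) : F)) • (g : quatAlg σ hσ (1 : Fˣ))) i j =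
      ((ϖ ^ (-n) : Fˣ) : F) * (Units.mapEquiv (e : _ ≃* _) g : GL (Fin 2) F).1 i j := by
    rw [map_smul]
    rfl
  have h0 : algebraMap F E (ϖ ^ (-n) : Fˣ) ≠ 0 := by
    rw [map_ne_zero]
    exact Units.ne_zero _
  simp only [h1, h2, mul_mem_lat_iff h0, mul_mem_lat_iff (Units.ne_zero (ϖ ^ (-n))),
    hQ.ord_algebraMap, ord_uniformizer_zpow hϖ] at h
  simpa using h.symm

/-- The order of the determinant is the difference of the contents of `g` and `g⁻¹`, so no
comparison of reduced norms is needed. -/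
lemma ord_det_equiv (g : (quatAlg σ hσ (1 : Fˣ))ˣ) :
    ord (Units.mapEquiv (e : _ ≃* _) g : GL (Fin 2) F).1.det =
      ord (quatToGL σ hσ 1 g).1.det := by
  have h1 := hQ.content_equiv e he g
  have h2 := hQ.content_equiv e he g⁻¹
  rw [map_inv, map_inv, content_inv, content_inv] at h2
  omega

lemma ofCoef_equiv (c : ℕ → ℤ → ℂ) (g : (quatAlg σ hσ (1 : Fˣ))ˣ) :
    ofCoef c (Units.mapEquiv (e : _ ≃* _) g : GL (Fin 2) F) =
      ofCoef c (quatToGL σ hσ 1 g) := by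
  rw [ofCoef, ofCoef, hQ.content_equiv e he, hQ.ord_det_equiv e he]

end IsUnramQuad

end Quaternion

/-! ### Orbital integrals on the quaternion side -/

section QuaternionIntegral

variable {F E : Type*} [Field F] [Field E] [Algebra F E]
  [ValuativeRel F] [TopologicalSpace F] [IsNonarchimedeanLocalField F]
  [ValuativeRel E] [TopologicalSpace E] [IsNonarchimedeanLocalField E]
  [ValuativeExtension F E] {σ : E ≃ₐ[F] E} (hQ : IsUnramQuad σ)

namespace IsUnramQuad

include hQ

/-- Since `Eˣ = Fˣ 𝒪_Eˣ`, the units meet each coset of `Fˣ` in a translate of `𝒪_Fˣ`, of volume `1`;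
so the volume of the quotient is that of `𝒪_Eˣ`. -/
lemma quotient_measure_univ [MeasurableSpace Eˣ] [BorelSpace Eˣ] [MeasurableSpace Fˣ]
    [BorelSpace Fˣ] {μE : Measure Eˣ} [μE.IsHaarMeasure]
    (hμE : μE {u : Eˣ | valuation E (u : E) = 1} = 1)
    {μF : Measure Fˣ} [μF.IsHaarMeasure] (hμF : μF {u : Fˣ | valuation F (u : F) = 1} = 1)
    {μQ : Measure (Eˣ ⧸ (unitsIncl F E).range)} (hμQ : IsQuotientMeasure μE μF μQ) :
    μQ Set.univ = 1 := by
  have h := hμQ (unitGroup E) isOpen_unitGroup.measurableSet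
  rw [coe_unitGroup, hμE] at h
  have h1 (q : Eˣ ⧸ (unitsIncl F E).range) :
      μF {z | q.out * unitsIncl F E z ∈ {u : Eˣ | valuation E (u : E) = 1}} = 1 := by
    rw [← measure_ord_eq μF hμF (-ord (q.out : E))]
    congr 1
    ext z
    change valuation E ((q.out * unitsIncl F E z : Eˣ) : E) = 1 ↔ ord (z : F) = _
    rw [← ord_eq_zero_iff_valuation (Units.ne_zero _), Units.val_mul,
      ord_mul (Units.ne_zero _) (Units.ne_zero _), hQ.ord_unitsIncl]
    omega
  rw [lintegral_congr h1, lintegral_one] at h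
  exact h.symm

/-- The content and the determinant of a translate of `1 + b j` by the torus. -/
lemma content_deltaElt (h₁ h₂ b : Eˣ)
    (hb : algebraMap F E (1 : Fˣ) * ((b : E) * σ b) ≠ 1) :
    content (quatToGL σ hQ.invol 1 ((torus σ hQ.invol 1 h₁)⁻¹ * deltaElt σ hQ.invol 1 b hb *
        torus σ hQ.invol 1 h₂)).1 = ord (h₂ : E) - ord (h₁ : E) + min 0 (ord (b : E)) ∧
      ord (quatToGL σ hQ.invol 1 ((torus σ hQ.invol 1 h₁)⁻¹ * deltaElt σ hQ.invol 1 b hb *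
        torus σ hQ.invol 1 h₂)).1.det =
        2 * (ord (h₂ : E) - ord (h₁ : E)) + ord (1 - (b : E) * σ b) := by
  have htor (a : Eˣ) : (quatToGL σ hQ.invol 1 (torus σ hQ.invol 1 a)).1 =
      !![(a : E), 0; 0, σ a] := rfl
  have hdel : (quatToGL σ hQ.invol 1 (deltaElt σ hQ.invol 1 b hb)).1 =
      !![1, (b : E); σ b, 1] := by
    change !![1, (b : E) * algebraMap F E (1 : Fˣ); σ b, 1] = _
    simp
  have hmat : (quatToGL σ hQ.invol 1 ((torus σ hQ.invol 1 h₁)⁻¹ * deltaElt σ hQ.invol 1 b hb *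
      torus σ hQ.invol 1 h₂)).1 =
      !![((h₁⁻¹ * h₂ : Eˣ) : E), (h₁⁻¹ : Eˣ) * b * σ h₂;
        σ (h₁⁻¹ : Eˣ) * σ b * h₂, σ (h₁⁻¹ * h₂ : Eˣ)] := by
    rw [map_mul, map_mul, ← map_inv, Units.val_mul, Units.val_mul, htor, htor, hdel]
    refine Matrix.ext fun i j => ?_
    fin_cases i <;> fin_cases j <;> simp [Matrix.mul_apply]
  have hσ0 (a : Eˣ) : σ (a : E) ≠ 0 := by simp
  have hinv (a : Eˣ) : ord ((a⁻¹ : Eˣ) : E) = -ord (a : E) := by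
    rw [Units.val_inv_eq_inv_val, ord_inv]
  constructor
  · refine eq_of_forall_le_iff fun n => ?_
    rw [le_content_iff, hmat]
    have h00 : ((h₁⁻¹ * h₂ : Eˣ) : E) ∈ lat E n ↔ n ≤ ord (h₂ : E) - ord (h₁ : E) := by
      rw [mem_lat_iff (Units.ne_zero _), Units.val_mul, ord_mul (Units.ne_zero _) (Units.ne_zero _),
        hinv]
      omega
    have h01 : ((h₁⁻¹ : Eˣ) : E) * b * σ h₂ ∈ lat E n ↔
        n ≤ ord (h₂ : E) - ord (h₁ : E) + ord (b : E) := by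
      rw [mem_lat_iff (mul_ne_zero (mul_ne_zero (Units.ne_zero _) (Units.ne_zero _)) (hσ0 _)),
        ord_mul (mul_ne_zero (Units.ne_zero _) (Units.ne_zero _)) (hσ0 _),
        ord_mul (Units.ne_zero _) (Units.ne_zero _), hinv, hQ.ord_sigma]
      omega
    have h10 : σ ((h₁⁻¹ : Eˣ) : E) * σ b * h₂ ∈ lat E n ↔
        n ≤ ord (h₂ : E) - ord (h₁ : E) + ord (b : E) := by
      rw [← hQ.sigma_mem_lat, map_mul, map_mul, hQ.invol, hQ.invol, h01]
    have h11 := (hQ.sigma_mem_lat (x := ((h₁⁻¹ * h₂ : Eˣ) : E)) (n := n)).trans h00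
    constructor
    · intro h
      have e1 := h00.mp (h 0 0)
      have e2 := h01.mp (h 0 1)
      omega
    · intro h i j
      fin_cases i <;> fin_cases j
      · exact h00.mpr (by omega)
      · exact h01.mpr (by omega)
      · exact h10.mpr (by omega)
      · exact h11.mpr (by omega)
  · have hd0 : (1 : E) - b * σ b ≠ 0 := by
      rw [sub_ne_zero]
      intro h
      exact hb (by simp [← h])
    rw [map_mul, map_mul, ord_det_mul, ord_det_mul, map_inv, ord_det_inv, htor, htor, hdel,
      Matrix.det_fin_two_of, Matrix.det_fin_two_of, Matrix.det_fin_two_of]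
    simp only [mul_zero, sub_zero, one_mul]
    rw [ord_mul h₁.ne_zero (hσ0 _), ord_mul h₂.ne_zero (hσ0 _), hQ.ord_sigma, hQ.ord_sigma]
    ring

variable [MeasurableSpace Eˣ] [BorelSpace Eˣ] [MeasurableSpace Fˣ]
    [BorelSpace Fˣ] {μE : Measure Eˣ} [μE.IsHaarMeasure]
    (hμE : μE {u : Eˣ | valuation E (u : E) = 1} = 1)
    {μF : Measure Fˣ} [μF.IsHaarMeasure] (hμF : μF {u : Fˣ | valuation F (u : F) = 1} = 1)
    {μQ : Measure (Eˣ ⧸ (unitsIncl F E).range)} (hμQ : IsQuotientMeasure μE μF μQ)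
    {Ω : Eˣ →* ℂˣ} (hΩ : ∀ u : Eˣ, valuation E (u : E) = 1 → Ω u = 1)

include hμE hμF hμQ hΩ

/-- The orbital integrals on the quaternion side. -/
lemma orbQuat_eq {ϖ : Eˣ} (hϖ : ord (ϖ : E) = 1) {c : ℕ → ℤ → ℂ}
    (hc : {p : ℕ × ℤ | c p.1 p.2 ≠ 0}.Finite)
    {f : (quatAlg σ hQ.invol (1 : Fˣ))ˣ → ℂ} (hf : ∀ g, f g = ofCoef c (quatToGL σ hQ.invol 1 g))
    (b : Eˣ) (hb : algebraMap F E (1 : Fˣ) * ((b : E) * σ b) ≠ 1) :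
    orbQuat σ hQ.invol μE μQ Ω 1 (deltaElt σ hQ.invol 1 b hb) f =
      ((Ω ϖ)⁻¹ : ℂˣ) ^ (-min 0 (ord (b : E))) * ∑' n : ℤ,
        c (ord (1 - (b : E) * σ b) - 2 * min 0 (ord (b : E))).toNat n *
          (((Ω ϖ)⁻¹ : ℂˣ) : ℂ) ^ n := by
  set t : ℂ := (((Ω ϖ)⁻¹ : ℂˣ) : ℂ) with ht
  have ht0 : t ≠ 0 := Units.ne_zero _
  set m₀ := min 0 (ord (b : E)) with hm₀
  set l := (ord (1 - (b : E) * σ b) - 2 * m₀).toNat with hl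
  have hfin : {n : ℤ | c l n ≠ 0}.Finite :=
    (hc.image Prod.snd).subset fun n hn => ⟨(l, n), hn, rfl⟩
  have hΩt (u : Eˣ) : (((Ω u)⁻¹ : ℂˣ) : ℂ) = t ^ ord (u : E) := by
    rw [apply_eq_zpow_ord hϖ hΩ u, ht, ← inv_zpow, Units.val_zpow_eq_zpow_val]
  -- The torus only shifts the content by `ord h₂ - ord h₁`, and `l` depends on `b` alone.
  -- Reindexing by the content therefore gives the same inner integral for all `q`.
  have hinner (q : Eˣ ⧸ (unitsIncl F E).range) : (∫ h₂ : Eˣ,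
      f ((torus σ hQ.invol 1 q.out)⁻¹ * deltaElt σ hQ.invol 1 b hb * torus σ hQ.invol 1 h₂) *
      (Ω q.out : ℂ) * ((Ω h₂)⁻¹ : ℂˣ) ∂μE) = t ^ (-m₀) * ∑' n : ℤ, c l n * t ^ n := by
    have hΩq : (Ω q.out : ℂ) = t ^ (-ord (q.out : E)) := by
      rw [zpow_neg, ← hΩt, Units.val_inv_eq_inv_val, inv_inv]
    rw [integral_units_eq_tsum μE hμE
      (G := fun n => c l (n - ord (q.out : E) + m₀) * t ^ (n - ord (q.out : E)))]
    · rw [← tsum_mul_left, ← (Equiv.addRight (m₀ - ord (q.out : E))).tsum_eq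
        (fun n => t ^ (-m₀) * (c l n * t ^ n))]
      refine tsum_congr fun n => ?_
      have h1 : t ^ (n - ord (q.out : E)) = t ^ (-m₀) * t ^ (n - ord (q.out : E) + m₀) := by
        rw [← zpow_add₀ ht0]
        congr 1
        ring
      simp only [Equiv.coe_addRight]
      rw [show n + (m₀ - ord (q.out : E)) = n - ord (q.out : E) + m₀ by ring, h1]
      ring
    · intro u
      obtain ⟨h1, h2⟩ := hQ.content_deltaElt q.out u b hb
      rw [hf, ofCoef, h1, h2, hΩt, hΩq, mul_assoc, ← zpow_add₀ ht0]
      congr 2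
      · congr 1
        omega
      · ring
    · refine (hfin.preimage (f := fun n : ℤ => n - ord (q.out : E) + m₀) ?_).subset ?_
      · intro x _ y _ h
        simp only at h
        omega
      · intro n hn
        exact left_ne_zero_of_mul hn
  rw [orbQuat]
  simp only [hinner]
  rw [integral_const, measureReal_def, hQ.quotient_measure_univ hμE hμF hμQ]
  simp [ht]

end IsUnramQuad

end QuaternionIntegral

/-! ### Summation of the Hermitian orbital integral -/

section Series

/-- The series `∑ Φ(l, m) (-t)^m`. -/
def twistSum (Φ : ℕ → ℤ → ℂ) (t : ℂ) (l : ℕ) : ℂ := ∑' m : ℤ, Φ l m * (-t) ^ m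

lemma hasSum_twistSum {Φ : ℕ → ℤ → ℂ} (hΦ : {p : ℕ × ℤ | Φ p.1 p.2 ≠ 0}.Finite) (t : ℂ) (l : ℕ) :
    HasSum (fun m : ℤ => Φ l m * (-t) ^ m) (twistSum Φ t l) := by
  refine (summable_of_hasFiniteSupport ?_).hasSum
  refine (hΦ.image Prod.snd).subset fun m hm => ⟨(l, m), left_ne_zero_of_mul hm, rfl⟩

lemma twistSum_eq_zero {B : ℕ} {Φ : ℕ → ℤ → ℂ} (hB : BoundedBy B Φ) (t : ℂ) {l : ℕ} (hl : B ≤ l) :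
    twistSum Φ t l = 0 := by
  rw [twistSum, ← tsum_zero (α := ℂ) (β := ℤ)]
  exact tsum_congr fun m => by rw [hB l hl, zero_mul]

/-- The sign `(-1)^m` in `bcCoef` turns `t` into `-t`, and the shift of `m` by `r + 1` produces
`t^(r+1)`, its sign cancelling the alternating one. -/
lemma tsum_bcCoef {Φ : ℕ → ℤ → ℂ} (hΦ : {p : ℕ × ℤ | Φ p.1 p.2 ≠ 0}.Finite) (B : ℕ) {t : ℂ}
    (ht : t ≠ 0) (l : ℕ) : ∑' n : ℤ, bcCoef B Φ l n * t ^ n = twistSum Φ t l +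
      2 * ∑ r ∈ Finset.range B, t ^ (r + 1) * twistSum Φ t (l + 2 * (r + 1)) := by
  have h1 (r : ℕ) : HasSum (fun n : ℤ => 2 * t ^ (r + 1) *
      (Φ (l + 2 * (r + 1)) (n - (r + 1 : ℕ)) * (-t) ^ (n - (r + 1 : ℕ))))
      (2 * t ^ (r + 1) * twistSum Φ t (l + 2 * (r + 1))) :=
    ((Equiv.subRight ((r + 1 : ℕ) : ℤ)).hasSum_iff.mpr
      (hasSum_twistSum hΦ t (l + 2 * (r + 1)))).mul_left _
  have h2 := (hasSum_twistSum hΦ t l).add (hasSum_sum fun r (_ : r ∈ Finset.range B) => h1 r)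
  rw [Finset.mul_sum]
  simp only [mul_assoc] at h2 ⊢
  rw [← h2.tsum_eq]
  refine tsum_congr fun n => ?_
  have h3 : (-t) ^ n = (-1) ^ n * t ^ n := by rw [← mul_zpow, neg_one_mul]
  rw [bcCoef, mul_add, add_mul, h3, Finset.mul_sum, Finset.mul_sum, Finset.sum_mul]
  congr 1
  · ring
  · refine Finset.sum_congr rfl fun r _ => ?_
    have h4 : (-t) ^ (n - ((r + 1 : ℕ) : ℤ)) * t ^ (r + 1) = (-1) ^ n * t ^ n * (-1) ^ (r + 1) := by
      rw [zpow_sub₀ (neg_ne_zero.mpr ht), h3, zpow_natCast, neg_pow t (r + 1),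
        div_mul_eq_mul_div, div_eq_iff (mul_ne_zero (pow_ne_zero _ (by norm_num)) (pow_ne_zero _ ht))]
      have h5 : ((-1 : ℂ) ^ (r + 1)) * (-1) ^ (r + 1) = 1 := by
        rw [← mul_pow]
        norm_num
      linear_combination -((-1) ^ n * t ^ n * t ^ (r + 1)) * h5
    linear_combination -(2 * Φ (l + 2 * (r + 1)) (n - ((r + 1 : ℕ) : ℤ))) * h4

lemma tsum_of_even {f : ℤ → ℂ} (hf : ∀ r, f (-r) = f r) {N : ℕ} (hN : ∀ n : ℕ, N ≤ n → f n = 0) :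
    ∑' r, f r = 2 * ∑ n ∈ Finset.range N, f (n : ℤ) - f 0 := by
  have h1 : HasSum (fun n : ℕ => f n) (∑ n ∈ Finset.range N, f (n : ℤ)) :=
    hasSum_sum_of_ne_finset_zero fun n hn => hN n (by simpa using hn)
  have h2 := HasSum.of_nat_of_neg h1 (by simpa only [hf] using h1)
  rw [h2.tsum_eq]
  ring

/-- The content of `diag(a, 1) γ(x) diag(ā, 1)`, where `v` and `j` are the orders of `x`, `a`. -/
def orbContent (v j : ℤ) : ℤ := min (v + 2 * j) (min j 0)

/-- The contribution of the `a` of order `j` to the orbital integral. -/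
def orbTerm (v w : ℤ) (t : ℂ) (ψ : ℕ → ℂ) (j : ℤ) : ℂ :=
  t ^ j * ((-t) ^ (-orbContent v j) * ψ (2 * j + w - 2 * orbContent v j).toNat)

/-- The reflection shifts the content by `-v - 2j`, so the argument of `ψ` and the total power of
`t` are unchanged; only the sign `(-1)^content` changes, by `(-1)^v`. -/
lemma orbTerm_reflect (v w : ℤ) {t : ℂ} (ht : t ≠ 0) (ψ : ℕ → ℂ) (j : ℤ) :
    orbTerm v w t ψ (-v - j) = (-1) ^ v * orbTerm v w t ψ j := by
  have h1 : orbContent v (-v - j) = orbContent v j - v - 2 * j := by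
    rw [orbContent, orbContent]
    omega
  have h3 (n : ℤ) : (-t) ^ n = (-1) ^ n * t ^ n := by rw [← mul_zpow, neg_one_mul]
  have h2 : t ^ (-v - j) * (-t) ^ (-orbContent v (-v - j)) =
      (-1) ^ v * (t ^ j * (-t) ^ (-orbContent v j)) := by
    have h4 : ((-1 : ℂ)) ^ (-orbContent v (-v - j)) = (-1) ^ v * (-1) ^ (-orbContent v j) := by
      rw [h1, ← zpow_add₀ (by norm_num), show -(orbContent v j - v - 2 * j) =
        v + -orbContent v j + 2 * j by ring, zpow_add₀ (by norm_num), zpow_mul]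
      norm_num
    have h5 : t ^ (-v - j) * t ^ (-orbContent v (-v - j)) = t ^ j * t ^ (-orbContent v j) := by
      rw [← zpow_add₀ ht, ← zpow_add₀ ht, h1]
      congr 1
      ring
    rw [h3, h3, h4]
    linear_combination ((-1) ^ v * (-1) ^ (-orbContent v j)) * h5
  rw [orbTerm, orbTerm, ← mul_assoc, h2, h1]
  rw [show 2 * (-v - j) + w - 2 * (orbContent v j - v - 2 * j) =
    2 * j + w - 2 * orbContent v j by ring]
  ring

lemma finite_orbTerm {B : ℕ} {ψ : ℕ → ℂ} (hψ : ∀ l, B ≤ l → ψ l = 0) (v w : ℤ) (t : ℂ) :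
    {j | orbTerm v w t ψ j ≠ 0}.Finite := by
  refine (Set.finite_Icc (-|w| - 2 * |v| - B) (|w| + B)).subset fun j hj => ?_
  have h : ¬ B ≤ (2 * j + w - 2 * orbContent v j).toNat := fun h => hj (by
    rw [orbTerm, hψ _ h, mul_zero, mul_zero])
  rw [orbContent] at h
  have h1 := neg_abs_le w
  have h2 := le_abs_self v
  have h3 := neg_abs_le v
  have h4 := le_abs_self w
  rw [Set.mem_Icc]
  omega

lemma tsum_orbTerm_of_odd {v : ℤ} (hv : ¬ Even v) (w : ℤ) {t : ℂ} (ht : t ≠ 0) (ψ : ℕ → ℂ) :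
    ∑' j, orbTerm v w t ψ j = 0 := by
  have h := (Equiv.subLeft (-v)).tsum_eq (orbTerm v w t ψ)
  simp only [Equiv.subLeft_apply, orbTerm_reflect v w ht,
    (Int.not_even_iff_odd.mp hv).neg_one_zpow] at h
  rw [tsum_mul_left] at h
  linear_combination -(1 / 2 : ℂ) * h

lemma two_mul_sum_neg_one_pow (u : ℕ) :
    2 * ∑ n ∈ Finset.range (u + 1), (-1 : ℂ) ^ n = 1 + (-1) ^ u := by
  induction u with
  | zero => norm_num
  | succ u ih =>
    rw [Finset.sum_range_succ, mul_add, ih]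
    ring

/-- The reflection is centred at `j = -v`, so with `j = r - v` the terms are even in `r` and the sum
folds. For `v ≤ 0` the content is `0` for all `r ≥ 0`, which gives the series directly. For `v > 0`
and `w = 0` the terms with `|r| ≤ v` are `±ψ 0` with alternating signs and add up to `ψ 0`; the
terms beyond give the rest. -/
lemma tsum_orbTerm_of_even {B : ℕ} {ψ : ℕ → ℂ} (hψ : ∀ l, B ≤ l → ψ l = 0) {v w : ℤ} {t : ℂ}
    (ht : t ≠ 0) (hneg : v < 0 → w = 2 * v) (hzero : v = 0 → 0 ≤ w) (hpos : 0 < v → w = 0) :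
    ∑' j, orbTerm (2 * v) w t ψ j = t ^ (-min 0 v) * (ψ (w - 2 * min 0 v).toNat +
      2 * ∑ r ∈ Finset.range B, t ^ (r + 1) * ψ ((w - 2 * min 0 v).toNat + 2 * (r + 1))) := by
  rw [← (Equiv.subRight v).tsum_eq (orbTerm (2 * v) w t ψ)]
  have heven (r : ℤ) : orbTerm (2 * v) w t ψ (Equiv.subRight v (-r)) =
      orbTerm (2 * v) w t ψ (Equiv.subRight v r) := by
    rw [Equiv.subRight_apply, Equiv.subRight_apply,
      show -r - v = -(2 * v) - (r - v) by ring, orbTerm_reflect _ _ ht,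
      (even_two_mul v).neg_one_zpow, one_mul]
  rcases le_or_gt v 0 with hv | hv
  · have hw : 0 ≤ w - 2 * v := by
      rcases hv.lt_or_eq with h | h
      · rw [hneg h]
        omega
      · have := hzero h
        omega
    have hterm (n : ℕ) : orbTerm (2 * v) w t ψ (Equiv.subRight v (n : ℤ)) =
        t ^ (-v) * (t ^ n * ψ ((w - 2 * v).toNat + 2 * n)) := by
      have hc : orbContent (2 * v) (n - v) = 0 := by
        rw [orbContent]
        omega
      rw [Equiv.subRight_apply, orbTerm, hc, neg_zero, zpow_zero, one_mul, mul_zero, sub_zero,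
        sub_eq_add_neg (n : ℤ) v, zpow_add₀ ht, zpow_natCast]
      rw [show (2 * ((n : ℤ) + -v) + w).toNat = (w - 2 * v).toNat + 2 * n by omega]
      ring
    rw [tsum_of_even (f := fun r => orbTerm (2 * v) w t ψ (Equiv.subRight v r)) heven (N := B + 1)
      fun n hn => by rw [hterm, hψ _ (by omega), mul_zero, mul_zero]]
    have h0 := hterm 0
    rw [Nat.cast_zero] at h0
    simp only [h0, hterm]
    rw [min_eq_right hv, Finset.sum_range_succ', ← Finset.mul_sum]
    simp only [pow_zero, mul_zero, add_zero, one_mul]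
    ring
  · obtain ⟨u, rfl⟩ : ∃ u : ℕ, v = u := ⟨v.toNat, by omega⟩
    obtain rfl : w = 0 := hpos hv
    rw [min_eq_left hv.le]
    have hlow (n : ℕ) (hn : n ≤ u) : orbTerm (2 * (u : ℤ)) 0 t ψ (Equiv.subRight (u : ℤ) (n : ℤ)) =
        (-1) ^ u * ((-1) ^ n * ψ 0) := by
      have hc : orbContent (2 * (u : ℤ)) (n - u) = n - u := by
        rw [orbContent]
        omega
      have h1 : t ^ ((n : ℤ) - u) * (-t) ^ (-((n : ℤ) - u)) = (-1) ^ u * (-1) ^ n := by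
        have h3 (n : ℤ) : (-t) ^ n = (-1) ^ n * t ^ n := by rw [← mul_zpow, neg_one_mul]
        rw [h3, mul_left_comm, ← zpow_add₀ ht, add_neg_cancel, zpow_zero, mul_one, neg_sub,
          zpow_sub₀ (by norm_num), zpow_natCast, zpow_natCast, div_eq_iff (pow_ne_zero _ (by norm_num)),
          mul_assoc,
          ← mul_pow]
        norm_num
      rw [Equiv.subRight_apply, orbTerm, hc, ← mul_assoc, h1, show (2 * ((n : ℤ) - u) + 0 -
        2 * ((n : ℤ) - u)).toNat = 0 by omega, mul_assoc]
    have hhigh (r : ℕ) : orbTerm (2 * (u : ℤ)) 0 t ψ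
        (Equiv.subRight (u : ℤ) ((u + 1 + r : ℕ) : ℤ)) = t ^ (r + 1) * ψ (2 * (r + 1)) := by
      have hj : ((u + 1 + r : ℕ) : ℤ) - u = (r + 1 : ℕ) := by
        push_cast
        ring
      have hc : orbContent (2 * (u : ℤ)) (r + 1 : ℕ) = 0 := by
        rw [orbContent]
        omega
      rw [Equiv.subRight_apply, hj, orbTerm, hc, neg_zero, zpow_zero, one_mul, zpow_natCast,
        show (2 * ((r + 1 : ℕ) : ℤ) + 0 - 2 * 0).toNat = 2 * (r + 1) by omega]
    rw [tsum_of_even (f := fun r => orbTerm (2 * (u : ℤ)) 0 t ψ (Equiv.subRight (u : ℤ) r)) heven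
      (N := u + 1 + B) fun n hn => by
        obtain ⟨r, rfl⟩ := Nat.exists_eq_add_of_le (show u + 1 ≤ n by omega)
        rw [hhigh, hψ _ (by omega), mul_zero]]
    have h0 := hlow 0 (Nat.zero_le _)
    rw [Nat.cast_zero] at h0
    rw [Finset.sum_range_add, Finset.sum_congr rfl fun r _ => hhigh r,
      Finset.sum_congr rfl fun n hn => hlow n (by
        have := Finset.mem_range.mp hn
        omega), h0, ← Finset.mul_sum, ← Finset.sum_mul]
    have h1 := two_mul_sum_neg_one_pow u
    have h2 : ((-1 : ℂ) ^ u) * (-1) ^ u = 1 := by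
      rw [← mul_pow]
      norm_num
    simp only [mul_zero, sub_zero, Int.toNat_zero, neg_zero, zpow_zero, zero_add, pow_zero, one_mul]
    linear_combination ((-1) ^ u * ψ 0) * h1 + ψ 0 * h2

end Series

/-! ### Orbital integrals on the Hermitian side and the matching -/

section HermitianIntegral

variable {F E : Type*} [Field F] [Field E] [Algebra F E]
  [ValuativeRel F] [TopologicalSpace F] [IsNonarchimedeanLocalField F]
  [ValuativeRel E] [TopologicalSpace E] [IsNonarchimedeanLocalField E]
  [ValuativeExtension F E] {σ : E ≃ₐ[F] E} (hQ : IsUnramQuad σ)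

namespace IsUnramQuad

include hQ

lemma etaChar_eq (z : Fˣ) : etaChar σ z = (-1) ^ ord (z : F) := by
  rw [etaChar, hQ.isNorm_iff z.ne_zero]
  split_ifs with h
  · rw [h.neg_one_zpow]
  · rw [(Int.not_even_iff_odd.mp h).neg_one_zpow]

lemma content_hermAct {x : F} (hx0 : x ≠ 0) (hx : x ≠ 1) (a : Eˣ) (z : Fˣ) :
    content (hermAct σ hQ.invol a z (gammaElt σ x hx)).1.1 =
        ord (z : F) + orbContent (ord x) (ord (a : E)) ∧
      ord (hermAct σ hQ.invol a z (gammaElt σ x hx)).1.1.det =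
        2 * ord (z : F) + 2 * ord (a : E) + ord (1 - x) := by
  have hmat : (hermAct σ hQ.invol a z (gammaElt σ x hx)).1.1 =
      !![algebraMap F E z * (algebraMap F E x * (a * σ a)), algebraMap F E z * a;
        algebraMap F E z * σ a, algebraMap F E z] := by
    change !![(a : E), 0; 0, 1] * !![algebraMap F E x, 1; 1, 1] * !![σ a, 0; 0, 1] *
      !![algebraMap F E z, 0; 0, algebraMap F E z] = _
    refine Matrix.ext fun i j => ?_
    fin_cases i <;> fin_cases j <;> simp [Matrix.mul_apply] <;> ring
  have hz0 : algebraMap F E z ≠ 0 := by simp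
  have hx0' : algebraMap F E x ≠ 0 := by simpa using hx0
  have ha0 : σ (a : E) ≠ 0 := by simp
  constructor
  · refine eq_of_forall_le_iff fun n => ?_
    rw [le_content_iff, hmat, orbContent]
    have h00 : algebraMap F E z * (algebraMap F E x * (a * σ a)) ∈ lat E n ↔
        n ≤ ord (z : F) + (ord x + 2 * ord (a : E)) := by
      rw [mem_lat_iff (mul_ne_zero hz0 (mul_ne_zero hx0' (mul_ne_zero a.ne_zero ha0))),
        ord_mul hz0 (mul_ne_zero hx0' (mul_ne_zero a.ne_zero ha0)),
        ord_mul hx0' (mul_ne_zero a.ne_zero ha0), ord_mul a.ne_zero ha0, hQ.ord_sigma,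
        hQ.ord_algebraMap, hQ.ord_algebraMap]
      omega
    have h01 : algebraMap F E z * a ∈ lat E n ↔ n ≤ ord (z : F) + ord (a : E) := by
      rw [mem_lat_iff (mul_ne_zero hz0 a.ne_zero), ord_mul hz0 a.ne_zero, hQ.ord_algebraMap]
    have h10 : algebraMap F E z * σ a ∈ lat E n ↔ n ≤ ord (z : F) + ord (a : E) := by
      rw [mem_lat_iff (mul_ne_zero hz0 ha0), ord_mul hz0 ha0, hQ.ord_algebraMap, hQ.ord_sigma]
    have h11 : algebraMap F E z ∈ lat E n ↔ n ≤ ord (z : F) := by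
      rw [mem_lat_iff hz0, hQ.ord_algebraMap]
    constructor
    · intro h
      have e1 := h00.mp (h 0 0)
      have e2 := h01.mp (h 0 1)
      have e3 := h11.mp (h 1 1)
      omega
    · intro h i j
      fin_cases i <;> fin_cases j
      · exact h00.mpr (by omega)
      · exact h01.mpr (by omega)
      · exact h10.mpr (by omega)
      · exact h11.mpr (by omega)
  · have h1 : algebraMap F E (1 - x) ≠ 0 := by
      rw [map_ne_zero, sub_ne_zero]
      exact hx.symm
    have hdet : (hermAct σ hQ.invol a z (gammaElt σ x hx)).1.1.det =
        -((algebraMap F E z * algebraMap F E z) * ((a * σ a) * algebraMap F E (1 - x))) := by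
      rw [hmat, Matrix.det_fin_two_of, map_sub, map_one]
      ring
    rw [hdet, ord_neg, ord_mul (mul_ne_zero hz0 hz0) (mul_ne_zero (mul_ne_zero a.ne_zero ha0) h1),
      ord_mul hz0 hz0, ord_mul (mul_ne_zero a.ne_zero ha0) h1, ord_mul a.ne_zero ha0, hQ.ord_sigma,
      hQ.ord_algebraMap, hQ.ord_algebraMap]
    ring

variable [MeasurableSpace Eˣ] [BorelSpace Eˣ] [MeasurableSpace Fˣ]
    [BorelSpace Fˣ] {μE : Measure Eˣ} [μE.IsHaarMeasure]
    (hμE : μE {u : Eˣ | valuation E (u : E) = 1} = 1)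
    {μF : Measure Fˣ} [μF.IsHaarMeasure] (hμF : μF {u : Fˣ | valuation F (u : F) = 1} = 1)
    {Ω : Eˣ →* ℂˣ} (hΩ : ∀ u : Eˣ, valuation E (u : E) = 1 → Ω u = 1)

include hμE hμF hΩ

/-- The orbital integrals on the Hermitian side. -/
lemma orbHerm_eq {ϖ : Eˣ} (hϖ : ord (ϖ : E) = 1) {B : ℕ} {c : ℕ → ℤ → ℂ} (hB : BoundedBy B c)
    (hc : {p : ℕ × ℤ | c p.1 p.2 ≠ 0}.Finite) {Φ : Herm σ → ℂ} (hΦ : ∀ s, Φ s = ofCoef c s.1)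
    {x : F} (hx0 : x ≠ 0) (hx : x ≠ 1) :
    orbHerm σ hQ.invol μE μF Ω (gammaElt σ x hx) Φ =
      ∑' j : ℤ, orbTerm (ord x) (ord (1 - x)) (((Ω ϖ)⁻¹ : ℂˣ) : ℂ)
        (twistSum c (((Ω ϖ)⁻¹ : ℂˣ) : ℂ)) j := by
  set t : ℂ := (((Ω ϖ)⁻¹ : ℂˣ) : ℂ) with ht
  have ht0 : t ≠ 0 := Units.ne_zero _
  have hΩt (u : Eˣ) : (((Ω u)⁻¹ : ℂˣ) : ℂ) = t ^ ord (u : E) := by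
    rw [apply_eq_zpow_ord hϖ hΩ u, ht, ← inv_zpow, Units.val_zpow_eq_zpow_val]
  -- The scalar `z` only shifts the content, by `ord z`, and `η ω⁻¹(z) = (-t)^(ord z)`. So the
  -- integral over `z` is `twistSum` at an `l` depending on `a`, times a power of `-t`.
  have hinner (a : Eˣ) : (∫ z : Fˣ, Φ (hermAct σ hQ.invol a z (gammaElt σ x hx)) *
      (etaChar σ z * ((Ω (unitsIncl F E z))⁻¹ : ℂˣ)) * ((Ω a)⁻¹ : ℂˣ) ∂μF) =
      orbTerm (ord x) (ord (1 - x)) t (twistSum c t) (ord (a : E)) := by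
    set k := orbContent (ord x) (ord (a : E)) with hk
    set l := (2 * ord (a : E) + ord (1 - x) - 2 * k).toNat with hl
    have hfin : {n : ℤ | c l n ≠ 0}.Finite :=
      (hc.image Prod.snd).subset fun n hn => ⟨(l, n), hn, rfl⟩
    rw [integral_units_eq_tsum μF hμF (G := fun n => c l (n + k) * (-t) ^ n * t ^ ord (a : E))]
    · rw [orbTerm, ← hk, ← hl, twistSum, ← tsum_mul_left, ← tsum_mul_left,
        ← (Equiv.addRight k).tsum_eq
        (fun n => t ^ ord (a : E) * ((-t) ^ (-k) * (c l n * (-t) ^ n)))]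
      refine tsum_congr fun n => ?_
      have h1 : (-t) ^ n = (-t) ^ (-k) * (-t) ^ (n + k) := by
        rw [← zpow_add₀ (neg_ne_zero.mpr ht0)]
        congr 1
        ring
      simp only [Equiv.coe_addRight]
      rw [h1]
      ring
    · intro z
      obtain ⟨h1, h2⟩ := hQ.content_hermAct hx0 hx a z
      rw [hΦ, ofCoef, h1, h2, ← hk, hΩt, hΩt, hQ.etaChar_eq, hQ.ord_unitsIncl, ← mul_zpow,
        neg_one_mul]
      congr 3
      omega
    · refine (hfin.preimage (f := fun n : ℤ => n + k) ?_).subset ?_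
      · intro x _ y _ h
        simp only at h
        omega
      · intro n hn
        exact left_ne_zero_of_mul (left_ne_zero_of_mul hn)
  rw [orbHerm]
  simp only [hinner]
  exact integral_units_eq_tsum μE hμE (fun _ => rfl)
    (finite_orbTerm (fun l hl => twistSum_eq_zero hB t hl) _ _ _)

variable {μQ : Measure (Eˣ ⧸ (unitsIncl F E).range)} (hμQ : IsQuotientMeasure μE μF μQ)

include hμQ

/-- Pure matching of the functions attached to `c` and to its base change. -/
lemma purelyMatches_of_coef {ϖ : Eˣ} (hϖ : ord (ϖ : E) = 1) {B : ℕ} {c : ℕ → ℤ → ℂ}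
    (hB : BoundedBy B c) (hc : {p : ℕ × ℤ | c p.1 p.2 ≠ 0}.Finite) {Φ : Herm σ → ℂ}
    (hΦ : ∀ s, Φ s = ofCoef c s.1) {f : (quatAlg σ hQ.invol (1 : Fˣ))ˣ → ℂ}
    (hf : ∀ g, f g = ofCoef (bcCoef B c) (quatToGL σ hQ.invol 1 g)) :
    PurelyMatches σ hQ.invol μE μF μQ Ω Φ 1 f := by
  have ht0 : (((Ω ϖ)⁻¹ : ℂˣ) : ℂ) ≠ 0 := Units.ne_zero _
  have hord {x : F} {ε : Fˣ} {b : Eˣ} (hb : algebraMap F E x = algebraMap F E ε * (b * σ b)) :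
      x ≠ 0 ∧ ord x = ord (ε : F) + 2 * ord (b : E) := by
    have hb0 : (b : E) * σ b ≠ 0 := mul_ne_zero b.ne_zero (by simp)
    have hε : algebraMap F E ε ≠ 0 := by simp
    constructor
    · rintro rfl
      rw [map_zero] at hb
      exact mul_ne_zero hε hb0 hb.symm
    · rw [← hQ.ord_algebraMap, hb, ord_mul hε hb0, ord_mul b.ne_zero (by simp), hQ.ord_sigma,
        hQ.ord_algebraMap]
      ring
  constructor
  · intro x hx b hb
    obtain ⟨hx0, hv⟩ := hord hb
    rw [Units.val_one, ord_one, zero_add] at hv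
    have hw : ord (1 - (b : E) * σ b) = ord (1 - x) := by
      rw [← hQ.ord_algebraMap, map_sub, map_one, hb, Units.val_one, map_one, one_mul]
    have hb0 : (b : E) * σ b = algebraMap F E x := by
      rw [hb, Units.val_one, map_one, one_mul]
    rw [hQ.orbHerm_eq hμE hμF hΩ hϖ hB hc hΦ hx0 hx,
      hQ.orbQuat_eq hμE hμF hμQ hΩ hϖ (finite_bcCoef hc) hf b, tsum_bcCoef hc B ht0, hv, hw]
    -- The three remaining goals are the ultrametric relations between `ord x = 2 ord b` and `ord (1
    -- - x)`.
    rw [tsum_orbTerm_of_even (fun l hl => twistSum_eq_zero hB _ hl) ht0]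
    · intro h
      have := (ord_add_eq_left (neg_ne_zero.mpr hx0) (y := (1 : F)) (by
        rw [mem_lat_iff one_ne_zero, ord_one, ord_neg, hv]
        omega)).2
      rw [neg_add_eq_sub, ord_neg, hv] at this
      exact this
    · intro h
      have hmem : 1 - x ∈ lat F 0 :=
        sub_mem one_mem_lat ((mem_lat_iff hx0).mpr (by omega))
      exact (mem_lat_iff (sub_ne_zero.mpr hx.symm)).mp hmem
    · intro h
      have := (ord_add_eq_left (one_ne_zero (α := F)) (y := -x) (by
        rw [mem_lat_iff (neg_ne_zero.mpr hx0), ord_one, ord_neg, hv]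
        omega)).2
      rw [← sub_eq_add_neg, ord_one] at this
      exact this
  · intro ε' hε' x hx b hb
    obtain ⟨hx0, hv⟩ := hord hb
    rw [div_one, hQ.isNorm_iff ε'.ne_zero] at hε'
    -- Since `ε'` is not a norm, its order is odd, hence so is that of `x`, and the reflection makes
    -- the Hermitian side vanish.
    rw [hQ.orbHerm_eq hμE hμF hΩ hϖ hB hc hΦ hx0 hx, tsum_orbTerm_of_odd _ _ ht0]
    · simp [orbQuat]
    · rw [hv, Int.even_add]
      exact fun h => hε' (h.mpr (even_two_mul _))

end IsUnramQuad

end HermitianIntegral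

/-! ### The unit element of the Hecke algebra -/

section UnitElement

variable {L : Type*} [Field L] [ValuativeRel L] [TopologicalSpace L]
  [IsNonarchimedeanLocalField L]

/-- The coefficients of a multiple of the characteristic function of `GL₂(𝒪)`. -/
def unitCoef (x : ℂ) (l : ℕ) (m : ℤ) : ℂ := if l = 0 ∧ m = 0 then x else 0

lemma unitCoef_boundedBy (x : ℂ) : BoundedBy 1 (unitCoef x) := fun l hl m => by
  rw [unitCoef, if_neg (by omega)]

lemma finite_unitCoef (x : ℂ) : {p : ℕ × ℤ | unitCoef x p.1 p.2 ≠ 0}.Finite := by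
  refine (Set.finite_singleton ((0, 0) : ℕ × ℤ)).subset ?_
  rintro ⟨l, m⟩ hp
  simp only [Set.mem_ofPred_eq, unitCoef] at hp
  split_ifs at hp with h
  · rw [Set.mem_singleton_iff, h.1, h.2]
  · exact absurd rfl hp

lemma ofCoef_unitCoef (x : ℂ) (g : GL (Fin 2) L) :
    ofCoef (unitCoef x⁻¹) g = (maxCompact L : Set (GL (Fin 2) L)).indicator 1 g / x := by
  have h1 : (ord g.1.det - 2 * content g.1).toNat = 0 ∧ content g.1 = 0 ↔ g ∈ maxCompact L := by
    have := two_content_le_ord_det g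
    rw [mem_maxCompact_iff']
    omega
  rw [ofCoef, unitCoef]
  by_cases hg : g ∈ maxCompact L
  · rw [if_pos (h1.mpr hg), Set.indicator_of_mem (SetLike.mem_coe.mpr hg), Pi.one_apply, one_div]
  · rw [if_neg fun h => hg (h1.mp h), Set.indicator_of_notMem (by simpa using hg), zero_div]

/-- Only `k = 0` contributes, and then `l = m = 0` is forced; the parity conditions rule out
spurious zeros of the integer divisions by two. -/
lemma hermCoef_unitCoef (q x : ℂ) : hermCoef q 1 (unitCoef x) = unitCoef x := by
  funext l m
  simp only [hermCoef, Finset.range_one, Finset.sum_singleton, Nat.cast_zero, sub_zero, normOneCount,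
    one_mul, unitCoef, add_zero]
  split_ifs with h1 h2 h3 h4 h5 h6
  all_goals first | rfl | skip
  all_goals simp only [Int.even_iff, Nat.even_iff] at *
  all_goals omega

lemma bcCoef_unitCoef (B : ℕ) (x : ℂ) : bcCoef B (unitCoef x) = unitCoef x := by
  funext l m
  have h (r : ℕ) : unitCoef x (l + 2 * (r + 1)) (m - (r + 1 : ℕ)) = 0 := by
    rw [unitCoef, if_neg (by omega)]
  simp only [bcCoef, h, mul_zero, Finset.sum_const_zero, add_zero]
  rw [unitCoef]
  split_ifs with h1
  · rw [h1.2, zpow_zero, one_mul]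
  · rw [mul_zero]

end UnitElement

end

end FundLemma

/-! ### Assembly of the proof -/

theorem proposition8
    {F E : Type*} [Field F] [Field E] [Algebra F E]
    [ValuativeRel F] [TopologicalSpace F] [IsNonarchimedeanLocalField F]
    [ValuativeRel E] [TopologicalSpace E] [IsNonarchimedeanLocalField E]
    [ValuativeExtension F E]
    -- `E/F` is an unramified quadratic extension with nontrivial automorphism `σ`
    (hdeg : Module.finrank F E = 2) (hunr : IsUnramifiedExt F E)
    (σ : E ≃ₐ[F] E) (hσ : Function.Involutive σ) (hσ' : σ ≠ AlgEquiv.refl)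
    -- Borel measurable structures
    [MeasurableSpace Eˣ] [BorelSpace Eˣ] [MeasurableSpace Fˣ] [BorelSpace Fˣ]
    [MeasurableSpace (GL (Fin 2) E)] [BorelSpace (GL (Fin 2) E)]
    [MeasurableSpace (GL (Fin 2) F)] [BorelSpace (GL (Fin 2) F)]
    -- the Haar measures on `Eˣ` and `Fˣ` for which the units have volume one, and the quotient
    -- measure on `Eˣ/Fˣ`
    (μE : Measure Eˣ) [μE.IsHaarMeasure] (hμE : μE {u : Eˣ | valuation E (u : E) = 1} = 1)
    (μF : Measure Fˣ) [μF.IsHaarMeasure] (hμF : μF {u : Fˣ | valuation F (u : F) = 1} = 1)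
    (μQ : Measure (Eˣ ⧸ (unitsIncl F E).range)) (hμQ : IsQuotientMeasure μE μF μQ)
    -- Haar measures on `G = GL₂(E)`, on `G₁ = GL₂(F)` and on `H₀`
    (μG : Measure (GL (Fin 2) E)) [μG.IsHaarMeasure]
    (μG₁ : Measure (GL (Fin 2) F)) [μG₁.IsHaarMeasure]
    (μH : Measure (unitaryGroup σ)) [μH.IsHaarMeasure]
    -- an unramified character of `Eˣ`
    (Ω : Eˣ →* ℂˣ) (hΩ : Continuous Ω)
    (hΩ' : ∀ u : Eˣ, valuation E (u : E) = 1 → Ω u = 1)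
    -- an isomorphism from `G₁ = Bˣ` to `GL₂(F)` that maps `K₁` onto `GL₂(𝒪_F)`
    (e : quatAlg σ hσ (1 : Fˣ) ≃ₐ[F] Matrix (Fin 2) (Fin 2) F)
    (he : (quatMaxCompact σ hσ (1 : Fˣ)).map (Units.mapEquiv (e : _ ≃* _)).toMonoidHom =
      maxCompact F) :
    (∀ f : sphericalHecke E, ∃ h : sphericalHecke F,
      (∀ h' : sphericalHecke F,
        IsHeckeBaseChange μG μG₁
          (((μH.real {k : unitaryGroup σ | k.1 ∈ maxCompact E} * μG₁.real (maxCompact F) /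
            μG.real (maxCompact E) : ℝ) : ℂ) • f) h' ↔ h' = h) ∧
      PurelyMatches σ hσ μE μF μQ Ω (PhiOf σ μH f.1) 1
        (fun g => h.1 (Units.mapEquiv (e : _ ≃* _) g))) ∧
    PurelyMatches σ hσ μE μF μQ Ω
      (PhiOf σ μH fun g => (maxCompact E : Set (GL (Fin 2) E)).indicator 1 g /
        ((μH.real {k : unitaryGroup σ | k.1 ∈ maxCompact E} * μG₁.real (maxCompact F) : ℝ) : ℂ)) 1
      (fun g => (quatMaxCompact σ hσ (1 : Fˣ) : Set (quatAlg σ hσ (1 : Fˣ))ˣ).indicator 1 g /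
        ((μG₁.real (maxCompact F) : ℝ) : ℂ)) := by
  have hQ : IsUnramQuad σ := ⟨hdeg, hunr, hσ, hσ'⟩
  obtain ⟨ϖ, hϖ⟩ := exists_ord_eq_one (L := F)
  have hϖE : ord (unitsIncl F E ϖ : E) = 1 := by rw [hQ.ord_unitsIncl, hϖ]
  have hV := (hQ.measure_unitary_maxCompact μH).2
  set V := μH.real {k : unitaryGroup σ | k.1 ∈ maxCompact E}
  have hPhi {f : GL (Fin 2) E → ℂ} (hf : f ∈ sphericalHecke E) {B : ℕ}
      (hB : BoundedBy B (coef (unitsIncl F E ϖ) f)) (s : Herm σ) : PhiOf σ μH f s =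
        ofCoef (fun l m => (V : ℂ) * hermCoef (Nat.card 𝓀[F]) B (coef (unitsIncl F E ϖ) f) l m)
          s.1 := hQ.PhiOf_eq_hermCoef hϖ μH hf hB s
  constructor
  · intro f
    obtain ⟨B, hB⟩ := exists_bound_of_finite (finite_coef hϖE f.2)
    -- The volume `V` of `K ∩ H₀` is kept inside `Φ`, so that `bcCoef` of `Φ` is the base change
    -- with the stated normalization. The bound doubles because `hermCoef` at `l` involves `c` at
    -- `l/2 + k`.
    set Φ : ℕ → ℤ → ℂ :=
      fun l m => (V : ℂ) * hermCoef (Nat.card 𝓀[F]) B (coef (unitsIncl F E ϖ) f.1) l m with hΦ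
    have hΦfin : {p : ℕ × ℤ | Φ p.1 p.2 ≠ 0}.Finite :=
      (finite_hermCoef (q := Nat.card 𝓀[F]) (B := B) (finite_coef hϖE f.2)).subset
        fun p hp => right_ne_zero_of_mul hp
    have hΦB : BoundedBy (2 * B) Φ := fun l hl m => by
      simp only [hΦ]
      rw [hermCoef_boundedBy hB l hl, mul_zero]
    refine ⟨⟨ofCoef (bcCoef (2 * B) Φ), ofCoef_mem hϖ (finite_bcCoef hΦfin)⟩, fun h' => ?_, ?_⟩
    · have := isHeckeBaseChange_iff_eq μG μG₁ hQ hϖ (V : ℂ) f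
        ⟨ofCoef (bcCoef (2 * B) Φ), ofCoef_mem hϖ (finite_bcCoef hΦfin)⟩ hB
        (B' := 2 * B) (by rw [coef_ofCoef hϖ]; exact bcCoef_boundedBy hΦB) (by
          intro l m
          rw [coef_ofCoef hϖ]
          exact bcCoef_sub hΦB l m) h'
      rw [← this]
      push_cast
      rfl
    · exact hQ.purelyMatches_of_coef hμE hμF hΩ' hμQ hϖE hΦB hΦfin (hPhi f.2 hB)
        (fun g => hQ.ofCoef_equiv e he (bcCoef (2 * B) Φ) g)
  -- The functions attached to the unit element have their only nonzero value at `(0, 0)` and are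
  -- fixed by `hermCoef` and `bcCoef`. The volume of `K ∩ H₀` cancels, and the criterion for
  -- matching applies directly.
  · have hV' : (V : ℂ) ≠ 0 := by exact_mod_cast hV
    set x : ℂ := ((V * μG₁.real (maxCompact F) : ℝ) : ℂ) with hx
    set f₀ : GL (Fin 2) E → ℂ := ofCoef (unitCoef x⁻¹) with hf₀
    have hf₀mem : f₀ ∈ sphericalHecke E := ofCoef_mem hϖE (finite_unitCoef _)
    have hfun : (fun g => (maxCompact E : Set (GL (Fin 2) E)).indicator 1 g / x) = f₀ :=
      funext fun g => (ofCoef_unitCoef x g).symm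
    have hcoef : coef (unitsIncl F E ϖ) f₀ = unitCoef x⁻¹ := coef_ofCoef hϖE _
    have hB : BoundedBy 1 (coef (unitsIncl F E ϖ) f₀) := hcoef ▸ unitCoef_boundedBy _
    have hval : (fun l m => (V : ℂ) *
        hermCoef (Nat.card 𝓀[F]) 1 (coef (unitsIncl F E ϖ) f₀) l m) =
        unitCoef (μG₁.real (maxCompact F) : ℂ)⁻¹ := by
      funext l m
      rw [hcoef, hermCoef_unitCoef, unitCoef, unitCoef, mul_ite, mul_zero, hx]
      push_cast
      rw [mul_inv, mul_inv_cancel_left₀ hV']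
    rw [hfun]
    refine hQ.purelyMatches_of_coef hμE hμF hΩ' hμQ hϖE (c := unitCoef (μG₁.real (maxCompact F))⁻¹)
      (unitCoef_boundedBy _) (finite_unitCoef _) (fun s => ?_) fun g => ?_
    · exact (hPhi hf₀mem hB s).trans (by rw [hval])
    · rw [bcCoef_unitCoef, ofCoef_unitCoef]
      rfl
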